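/- Write $\hat{\mathbb C}=\mathbb C\cup\{\infty\}$ for the Riemann sphere. For a domain $G\subset\hat{\mathbb C}$, let $\mathcal C(G)$ be the set of connected components of $\hat{\mathbb C}\setminus G$; a component $p\in\mathcal C(G)$ is non-trivial, $p\in\mathcal C_N(G)$, if the Euclidean diameter $\operatorname{diam}(p\cap\mathbb C)$ is positive, and is a point-component, $p\in\mathcal C_P(G)$, otherwise. Let $\hat G$ be the quotient space of $\hat{\mathbb C}$ obtained by collapsing each $p\in\mathcal C(G)$ to a point; we regard $\mathcal C(G)$ also as a subset of $\hat G$. Every homeomorphism $f\colon G\to G'$ between domains has a homeomorphic extension $\hat f\colon\hat G\to\hat G'$. A circle domain is a domain $D\subset\hat{\mathbb C}$ such that each $p\in\mathcal C_N(D)$ is a closed disk of the sphere (a closed Euclidean disk of positive radius, a closed half-plane together with $\infty$, or the complement of an open Euclidean disk). Let $T_0\subset\mathbb C$ be the standard tripod, the union of the segments $[0,e^{2\pi i j/3}]$, $j=0,1,2$. A set $T\subset\mathbb C$ is an $H$-quasitripod if there is a homeomorphism $\phi\colon T_0\to T$ such that $|\phi(z_2)-\phi(z_1)|\le H|\phi(z_3)-\phi(z_1)|$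 whenever $z_1,z_2,z_3\in T_0$ and $|z_2-z_1|\le|z_3-z_1|$. The transboundary modulus of a family $\Gamma$ of paths in $\hat G$ is $$\operatorname{Mod}(\Gamma)=\inf_\rho\ \int_{G\cap\mathbb C}\rho^2\,dA+\sum_{p\in\mathcal C(G)}\rho(p)^2,$$ where the infimum is over all Borel functions $\rho\colon\hat G\to[0,\infty]$ such that $\int_\gamma\rho\,ds+\sum_{p\in\mathcal C(G)\cap|\gamma|}\rho(p)\ge1$ for every $\gamma\in\Gamma$ whose restriction to $G\cap\mathbb C$ is locally rectifiable; here $|\gamma|$ is the image of $\gamma$ and $\int_\gamma\rho\,ds$ is the path integral over the part of $\gamma$ in $G\cap\mathbb C$. **Theorem.** There is a domain $\Omega\subset\hat{\mathbb C}$ with $\infty\in\Omega$ such that: 1. $\mathcal C(\Omega)$ is countable, and $\{0\}$ is the only point-component: $\mathcal C_P(\Omega)=\{\{0\}\}$. 2. For every $p\in\mathcal C_N(\Omega)$ there are $c>0$ and a $10^6$-biLipschitz map of $cT_0=\{cz: z\in T_0\}$ onto $p$. 3. Condition (i) holds with $H=10^{12}$: every $p\in\mathcal C_N(\Omega)$ contains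 an $H$-quasitripod $T$ with $\operatorname{diam}(T)\ge\operatorname{diam}(p)/H$. 4. The packing condition (ii) fails: there is no $N\ge1$ such that for all $z_0\in\mathbb C$ and $r>0$ at most $N$ elements $p\in\mathcal C_N(\Omega)$ satisfy $\operatorname{diam}(p)\ge r$ and $p\cap\mathbb D(z_0,r)\ne\emptyset$. 5. For every conformal homeomorphism $f\colon\Omega\to D$ onto a circle domain $D$, $\hat f(\{0\})\in\mathcal C_N(D)$; that is, $\hat f(\{0\})$ is a non-degenerate disk. 6. There is $p_\emptyset\in\mathcal C_N(\Omega)$ such that the family of all paths in $\hat\Omega$ joining $p_\emptyset$ and $\{0\}$ has positive transboundary modulus. -/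

import Mathlib

open Set Topology
open scoped ENNReal

noncomputable section

namespace KoebeTripod

/-! The Riemann sphere is `OnePoint ℂ`. -/

/-- The finite coordinate of a point of the sphere (junk value `0` at `∞`). -/
def toC (z : OnePoint ℂ) : ℂ := z.elim 0 id

/-- The inversion `z ↦ 1 / z` of the sphere, exchanging `0` and `∞`. -/
def sphereInv (z : OnePoint ℂ) : OnePoint ℂ :=
  open Classical in
  if z = OnePoint.infty then ((0 : ℂ) : OnePoint ℂ)
  else if z = ((0 : ℂ) : OnePoint ℂ) then OnePoint.infty
  else (((toC z)⁻¹ : ℂ) : OnePoint ℂ)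

/-- The coordinate used near the point `z`: the identity if `z` is finite, `1 / w` if `z = ∞`. -/
def chart (z : OnePoint ℂ) : OnePoint ℂ → ℂ :=
  open Classical in if z = OnePoint.infty then fun w => toC (sphereInv w) else toC

/-- The inverse of the coordinate used near the point `z`. -/
def chartSymm (z : OnePoint ℂ) : ℂ → OnePoint ℂ :=
  open Classical in
  if z = OnePoint.infty then fun w => sphereInv (w : OnePoint ℂ) else fun w => (w : OnePoint ℂ)

/-- `f` is continuous and complex differentiable, in the standard coordinates of the sphere,
at the point `z`. -/
def HolomorphicAtPoint (f : OnePoint ℂ → OnePoint ℂ) (z : OnePoint ℂ) : Prop :=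
  ContinuousAt f z ∧
    DifferentiableAt ℂ (fun w : ℂ => chart (f z) (f (chartSymm z w))) (chart z z)

/-- `f` restricts to a conformal homeomorphism from the domain `G` onto the domain `G'`:
a holomorphic bijection. -/
def IsConformalOnto (f : OnePoint ℂ → OnePoint ℂ) (G G' : Set (OnePoint ℂ)) : Prop :=
  BijOn f G G' ∧ ∀ z ∈ G, HolomorphicAtPoint f z

/-- A domain in the sphere: a non-empty connected open set. -/
def IsSphereDomain (G : Set (OnePoint ℂ)) : Prop := IsOpen G ∧ IsConnected G

/-- The Euclidean diameter of `p ∩ ℂ`. -/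
def planeDiam (p : Set (OnePoint ℂ)) : ℝ≥0∞ :=
  Metric.ediam ((fun z : ℂ => (z : OnePoint ℂ)) ⁻¹' p)

/-- The collection `𝒞(G)` of connected components of the complement of `G`. -/
def complComponents (G : Set (OnePoint ℂ)) : Set (Set (OnePoint ℂ)) :=
  {p | ∃ z ∈ Gᶜ, p = connectedComponentIn Gᶜ z}

/-- The non-trivial (non-point) complementary components. -/
def nonpointComponents (G : Set (OnePoint ℂ)) : Set (Set (OnePoint ℂ)) :=
  {p | p ∈ complComponents G ∧ 0 < planeDiam p}

/-- The point-components. -/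
def pointComponents (G : Set (OnePoint ℂ)) : Set (Set (OnePoint ℂ)) :=
  {p | p ∈ complComponents G ∧ ¬ 0 < planeDiam p}

/-- A closed disk of positive radius in the sphere: a closed Euclidean disk, a closed half-plane
together with `∞`, or the complement of an open Euclidean disk. -/
def IsSphereDisk (p : Set (OnePoint ℂ)) : Prop :=
  (∃ (a : ℂ) (r : ℝ), 0 < r ∧ p = (fun z : ℂ => (z : OnePoint ℂ)) '' Metric.closedBall a r) ∨
  (∃ (u : ℂ) (c : ℝ), u ≠ 0 ∧
    p = insert OnePoint.infty ((fun z : ℂ => (z : OnePoint ℂ)) '' {z : ℂ | (u * z).re ≤ c})) ∨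
  (∃ (a : ℂ) (r : ℝ), 0 < r ∧ p = ((fun z : ℂ => (z : OnePoint ℂ)) '' Metric.ball a r)ᶜ)

/-- A circle domain: every non-point complementary component is a disk. -/
def IsCircleDomain (D : Set (OnePoint ℂ)) : Prop :=
  IsSphereDomain D ∧ ∀ p ∈ nonpointComponents D, IsSphereDisk p

/-! ### The quotient of the sphere by the complementary components -/

/-- Two points are identified if they are equal or lie in the same complementary component. -/
def hatSetoid (G : Set (OnePoint ℂ)) : Setoid (OnePoint ℂ) where
  r z w := z = w ∨ ∃ p ∈ complComponents G, z ∈ p ∧ w ∈ p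
  iseqv :=
    { refl := fun _ => Or.inl rfl
      symm := by
        rintro z w (h | ⟨p, hp, hz, hw⟩)
        · exact Or.inl h.symm
        · exact Or.inr ⟨p, hp, hw, hz⟩
      trans := by
        rintro x y z (rfl | ⟨p, hp, hx, hy⟩) (rfl | ⟨q, hq, hy', hz⟩)
        · exact Or.inl rfl
        · exact Or.inr ⟨q, hq, hy', hz⟩
        · exact Or.inr ⟨p, hp, hx, hy⟩
        · refine Or.inr ⟨p, hp, hx, ?_⟩
          obtain ⟨a, _, rfl⟩ := hp
          obtain ⟨b, _, rfl⟩ := hq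
          rw [connectedComponentIn_eq hy, ← connectedComponentIn_eq hy']
          exact hz }

/-- The quotient space `Ĝ`. -/
def Hat (G : Set (OnePoint ℂ)) : Type := Quotient (hatSetoid G)

/-- The quotient map `π_G`. -/
def hatMk (G : Set (OnePoint ℂ)) (z : OnePoint ℂ) : Hat G := Quotient.mk (hatSetoid G) z

instance instTopologicalSpaceHat (G : Set (OnePoint ℂ)) : TopologicalSpace (Hat G) :=
  TopologicalSpace.coinduced (hatMk G) inferInstance

instance instMeasurableSpaceHat (G : Set (OnePoint ℂ)) : MeasurableSpace (Hat G) :=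
  borel (Hat G)

/-- The subset of the sphere represented by a point of `Ĝ`: a point of `G` or a complementary
component. -/
def fiber {G : Set (OnePoint ℂ)} (q : Hat G) : Set (OnePoint ℂ) := hatMk G ⁻¹' {q}

/-- `𝒞(G)`, regarded as a subset of `Ĝ`. -/
def hatComponents (G : Set (OnePoint ℂ)) : Set (Hat G) := hatMk G '' Gᶜ

/-- `F : Ĝ → Ĝ'` is a homeomorphic extension of `f : G → G'`. -/
def IsHatExtension {G G' : Set (OnePoint ℂ)} (f : OnePoint ℂ → OnePoint ℂ)
    (F : Hat G ≃ₜ Hat G') : Prop :=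
  ∀ z ∈ G, F (hatMk G z) = hatMk G' (f z)

/-! ### Tripods -/

/-- The standard tripod: the union of the segments `[0, exp (2 π i j / 3)]`, `j = 0, 1, 2`. -/
def standardTripod : Set ℂ :=
  ⋃ j : Fin 3, segment ℝ (0 : ℂ) (Complex.exp (Complex.I * (2 * (j : ℕ) * Real.pi / 3)))

/-- `φ` restricts to a homeomorphism of `E` onto `F`. -/
def IsHomeoOnto (φ : ℂ → ℂ) (E F : Set ℂ) : Prop :=
  BijOn φ E F ∧ ContinuousOn φ E ∧ ContinuousOn (Function.invFunOn φ E) F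

/-- `T` is an `H`-quasitripod: the image of the standard tripod under a weakly
`H`-quasisymmetric homeomorphism. -/
def IsQuasitripod (H : ℝ) (T : Set ℂ) : Prop :=
  ∃ φ : ℂ → ℂ, IsHomeoOnto φ standardTripod T ∧
    ∀ z₁ ∈ standardTripod, ∀ z₂ ∈ standardTripod, ∀ z₃ ∈ standardTripod,
      ‖z₂ - z₁‖ ≤ ‖z₃ - z₁‖ → ‖φ z₂ - φ z₁‖ ≤ H * ‖φ z₃ - φ z₁‖

/-- `p` is the image of a scaled standard tripod `c T₀`, `c > 0`, under an `L`-biLipschitz map. -/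
def IsBilipschitzTripod (L : ℝ) (p : Set (OnePoint ℂ)) : Prop :=
  ∃ (c : ℝ) (φ : ℂ → ℂ), 0 < c ∧
    (∀ z ∈ (fun x : ℂ => (c : ℂ) * x) '' standardTripod,
      ∀ w ∈ (fun x : ℂ => (c : ℂ) * x) '' standardTripod,
        L⁻¹ * ‖z - w‖ ≤ ‖φ z - φ w‖ ∧ ‖φ z - φ w‖ ≤ L * ‖z - w‖) ∧
    p = (fun z : ℂ => (z : OnePoint ℂ)) ''
      (φ '' ((fun x : ℂ => (c : ℂ) * x) '' standardTripod))

/-- Condition (i): every non-point complementary component `p` contains an `H`-quasitripod `T`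
with `diam T ≥ diam p / H`. -/
def QuasitripodCondition (H : ℝ) (G : Set (OnePoint ℂ)) : Prop :=
  ∀ p ∈ nonpointComponents G, ∃ T : Set ℂ, IsQuasitripod H T ∧
    (fun z : ℂ => (z : OnePoint ℂ)) '' T ⊆ p ∧
    planeDiam p / ENNReal.ofReal H ≤ Metric.ediam T

/-- Condition (ii): at most `N` non-point complementary components of diameter at least `r` meet
the disk `𝔻(z₀, r)`, for all `z₀` and `r`. -/
def PackingCondition (N : ℕ) (G : Set (OnePoint ℂ)) : Prop :=
  ∀ (z₀ : ℂ) (r : ℝ), 0 < r →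
    {p | p ∈ nonpointComponents G ∧ ENNReal.ofReal r ≤ planeDiam p ∧
      (p ∩ (fun z : ℂ => (z : OnePoint ℂ)) '' Metric.ball z₀ r).Nonempty}.encard ≤ N

/-! ### Transboundary modulus -/

/-- A path in `Ĝ`. -/
abbrev HatPath (G : Set (OnePoint ℂ)) : Type := C(unitInterval, Hat G)

/-- The path as a function of a real parameter (constant outside `[0, 1]`). -/
def HatPath.ext {G : Set (OnePoint ℂ)} (γ : HatPath G) : ℝ → Hat G :=
  IccExtend zero_le_one γ

/-- The parameters at which the path lies in `G ∩ ℂ`. -/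
def HatPath.regular {G : Set (OnePoint ℂ)} (γ : HatPath G) : Set ℝ :=
  {t | t ∈ Icc (0 : ℝ) 1 ∧ ∃ z : ℂ, (z : OnePoint ℂ) ∈ G ∧ γ.ext t = hatMk G (z : OnePoint ℂ)}

/-- The path in the plane coordinate; it is meaningful at the parameters in `γ.regular`, where
the class `γ.ext t` has exactly one representative. -/
def HatPath.plane {G : Set (OnePoint ℂ)} (γ : HatPath G) (t : ℝ) : ℂ :=
  toC (Quotient.out (γ.ext t))

/-- The restriction of the path to `G ∩ ℂ` is locally rectifiable. -/
def HatPath.LocallyRectifiable {G : Set (OnePoint ℂ)} (γ : HatPath G) : Prop :=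
  ∀ a b : ℝ, Icc a b ⊆ γ.regular → eVariationOn γ.plane (Icc a b) ≠ ⊤

/-- The path integral `∫ ρ ds` over the rectifiable plane path `σ` on `[a, b]`, computed in its
parametrization by arc length. -/
def arcIntegral (ρ : ℂ → ℝ≥0∞) (σ : ℝ → ℂ) (a b : ℝ) : ℝ≥0∞ :=
  ∫⁻ s in Icc 0 (eVariationOn σ (Icc a b)).toReal,
    ρ (naturalParameterization σ (Icc a b) a s)

/-- The path integral of the restriction of the path to `G ∩ ℂ`: the sum, over the connected
components of the set of regular parameters, of the path integrals over the corresponding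
subpaths (each the supremum over its compact subpaths). -/
def HatPath.lineIntegral {G : Set (OnePoint ℂ)} (γ : HatPath G) (ρ : Hat G → ℝ≥0∞) : ℝ≥0∞ :=
  ∑' C : {C : Set ℝ // ∃ t ∈ γ.regular, C = connectedComponentIn γ.regular t},
    ⨆ (a : ℝ) (b : ℝ) (_ : a ≤ b) (_ : Icc a b ⊆ C.1),
      arcIntegral (fun z => ρ (hatMk G (z : OnePoint ℂ))) γ.plane a b

/-- The sum of `ρ` over the complementary components met by the path. -/
def HatPath.componentSum {G : Set (OnePoint ℂ)} (γ : HatPath G) (ρ : Hat G → ℝ≥0∞) : ℝ≥0∞ :=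
  ∑' q : {q : Hat G // q ∈ hatComponents G ∧ q ∈ range γ}, ρ q.1

/-- Admissible functions for a family of paths. As usual for path integrals, the inequality is
required for those paths whose restriction to `G ∩ ℂ` is locally rectifiable. -/
def IsAdmissible {G : Set (OnePoint ℂ)} (Γ : Set (HatPath G)) (ρ : Hat G → ℝ≥0∞) : Prop :=
  Measurable ρ ∧
    ∀ γ ∈ Γ, γ.LocallyRectifiable → 1 ≤ γ.lineIntegral ρ + γ.componentSum ρ

/-- The quantity `∫_{G ∩ ℂ} ρ² dA + ∑_{p ∈ 𝒞(G)} ρ(p)²`. -/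
def energy {G : Set (OnePoint ℂ)} (ρ : Hat G → ℝ≥0∞) : ℝ≥0∞ :=
  (∫⁻ z in (fun z : ℂ => (z : OnePoint ℂ)) ⁻¹' G, ρ (hatMk G (z : OnePoint ℂ)) ^ 2) +
    ∑' q : {q : Hat G // q ∈ hatComponents G}, ρ q.1 ^ 2

/-- Schramm's transboundary modulus of a family of paths in `Ĝ`. -/
def transboundaryModulus {G : Set (OnePoint ℂ)} (Γ : Set (HatPath G)) : ℝ≥0∞ :=
  ⨅ (ρ : Hat G → ℝ≥0∞) (_ : IsAdmissible Γ ρ), energy ρ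

/-- The family of all paths in `Ĝ` joining two points of `Ĝ`. -/
def joiningPaths {G : Set (OnePoint ℂ)} (q q' : Hat G) : Set (HatPath G) :=
  {γ | γ 0 = q ∧ γ 1 = q'}

end KoebeTripod

end

noncomputable section

namespace KoebeTripod

/-! The complementary components of the domain `Om` are the origin and one tripod for each vertex of
the infinite binary tree, numbered in heap order. Tripod `m` has a long leg crossing all circles of
radius `exp (-t)` with `m ≤ t ≤ 4 m`, and a circular head at its outer end. It has size comparable
to `exp (-m)` and is uniformly bi-Lipschitz to a scaled standard tripod (`isBilipschitzTripod_tri`),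
while the number of legs crossing one circle is unbounded near the origin, so packing fails. The
angular position of a leg is its infix label in the tree, a dyadic number. Whenever a head has to be
inserted, the other legs bend away from it on both sides without changing their order. Once both
children of a vertex are present, the legs of parent and child are angular neighbours, and an arc of
angular length `2 ^ (-(k + 2))` joins them inside the domain if the parent has level `k`.

The engine is `exists_cheap_ray`. Given a density on the domain and weights on the tripods, both of
small square sum, there are an infinite branch of the tree and connecting arcs whose total cost is
at most `1 / 2`. The arcs are cheap because their lengths decay geometrically with the level, and
one can average over the radius. The weights are cheap because their average over all branches is
small: level `k` has `2 ^ k` vertices, and a vertex of it lies on a random branch with probability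
`2 ^ (-k)`. The branch, with every tripod collapsed to a point, is a path in the quotient from the
first tripod to the origin. An admissible density would have to charge it at least `1`, so the
transboundary modulus is positive (`modulus_pos`).

Suppose that a conformal map onto a circle domain sends the origin to a point-component. Around that
point there are `N` annuli such that no complementary component meets two of them (`exists_annuli`).
The density `1 / (N R)` on the annulus of radii `R` and `2 R`, with the corresponding weights on the
complementary components, has energy of order `1 / N`; here one needs that disks are fat, namely
that the radial size squared is bounded by the area. Pulled back to `Om` it admits a cheap branch,
but the image of this branch crosses all `N` annuli and costs at least `1`, a contradiction
(`planeDiam_fiber_origin_ne_zero`).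

The homeomorphic extension to the quotient spaces rests on unicoherence of the sphere: a
complementary component has small saturated neighbourhoods with connected trace on the domain
(`exists_connected_nhd`), so the map has a limit there. The same fact yields the connectedness of
`Om`. -/

section

/-! ### Logarithms on the sphere and unicoherence. -/

theorem isPreconnected_compl_closedBall (R : ℝ) :
    IsPreconnected (Metric.closedBall (0 : ℂ) R)ᶜ := by
  rcases lt_or_ge R 0 with hR | hR
  · rw [Metric.closedBall_eq_empty.2 hR, compl_empty]
    exact isPreconnected_univ
  · have : (Metric.closedBall (0 : ℂ) R)ᶜ =
        (fun p : ℝ × ℝ => (p.1 : ℂ) * Complex.exp (p.2 * Complex.I)) '' (Ioi R ×ˢ univ) := by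
      ext z
      simp only [mem_compl_iff, Metric.mem_closedBall, dist_zero_right, not_le, mem_image,
        mem_prod, mem_Ioi, mem_univ, and_true, Prod.exists]
      constructor
      · intro hz
        exact ⟨‖z‖, z.arg, hz, Complex.norm_mul_exp_arg_mul_I z⟩
      · rintro ⟨a, b, ha, rfl⟩
        rw [norm_mul, Complex.norm_exp_ofReal_mul_I, mul_one, Complex.norm_real, Real.norm_eq_abs]
        exact ha.trans_le (le_abs_self a)
    rw [this]
    refine (isPreconnected_Ioi.prod isPreconnected_univ).image _ ?_
    fun_prop

/-- Every continuous map from the sphere to the circle has a continuous logarithm. -/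
theorem exists_circle_lift (g : OnePoint ℂ → Circle) (hg : Continuous g) :
    ∃ θ : OnePoint ℂ → ℝ, Continuous θ ∧ ∀ x, Circle.exp (θ x) = g x := by
  have hgc : Continuous (fun z : ℂ => g (z : OnePoint ℂ)) := hg.comp OnePoint.continuous_coe
  obtain ⟨e0, he0⟩ := Circle.exp_surjective (g ((0 : ℂ) : OnePoint ℂ))
  -- The plane is simply connected, so the logarithm exists there; the only issue is its behaviour
  -- at `∞`.
  obtain ⟨F, ⟨hF0, hF⟩, -⟩ := Circle.isCoveringMap_exp.existsUnique_continuousMap_lifts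
    (⟨_, hgc⟩ : C(ℂ, Circle)) (a₀ := 0) (e₀ := e0) he0
  have hF' : ∀ z : ℂ, Circle.exp (F z) = g z := fun z => congrFun hF z
  obtain ⟨e1, he1⟩ := Circle.exp_surjective (g OnePoint.infty)
  -- the argument, normalised at infinity
  set ψ : OnePoint ℂ → ℝ := fun x => Complex.arg ((g x * (g OnePoint.infty)⁻¹ : Circle) : ℂ) + e1
    with hψ
  have hψexp : ∀ x, Circle.exp (ψ x) = g x := by
    intro x
    simp only [hψ, Circle.exp_add, Circle.exp_arg, he1, inv_mul_cancel_right]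
  have hSo : IsOpen {x : OnePoint ℂ | ((g x * (g OnePoint.infty)⁻¹ : Circle) : ℂ) ∈ Complex.slitPlane} :=
    Complex.isOpen_slitPlane.preimage (by fun_prop)
  have hS1 : OnePoint.infty ∈ {x : OnePoint ℂ | ((g x * (g OnePoint.infty)⁻¹ : Circle) : ℂ) ∈ Complex.slitPlane} := by
    simp
  have hKc := (OnePoint.isOpen_def.1 hSo).1 hS1
  obtain ⟨R, hR⟩ := hKc.isBounded.subset_closedBall 0
  have hout : ∀ z : ℂ, z ∈ (Metric.closedBall (0 : ℂ) R)ᶜ →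
      ((g z * (g OnePoint.infty)⁻¹ : Circle) : ℂ) ∈ Complex.slitPlane := by
    intro z hz
    by_contra hcon
    exact hz (hR (by simpa using hcon))
  have hψc : ∀ x : OnePoint ℂ, ((g x * (g OnePoint.infty)⁻¹ : Circle) : ℂ) ∈ Complex.slitPlane →
      ContinuousAt ψ x := by
    intro x hx
    refine ContinuousAt.add ?_ continuousAt_const
    exact (Complex.continuousAt_arg hx).comp (f := fun x => ((g x * (g OnePoint.infty)⁻¹ : Circle) : ℂ))
      (by fun_prop)
  have hconn : IsPreconnected (Metric.closedBall (0 : ℂ) R)ᶜ := isPreconnected_compl_closedBall R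
  obtain ⟨z0, hz0⟩ : ((Metric.closedBall (0 : ℂ) R)ᶜ).Nonempty := by
    refine ⟨((|R| + 1 : ℝ) : ℂ), ?_⟩
    simp only [mem_compl_iff, Metric.mem_closedBall, dist_zero_right, Complex.norm_real,
      Real.norm_eq_abs, not_le]
    rw [abs_of_pos (by positivity)]
    linarith [le_abs_self R]
  have hcexp : Circle.exp (F z0 - ψ z0) = 1 := by
    rw [Circle.exp_sub, hF', hψexp]; simp
  -- Two logarithms on the connected exterior of a disk differ by a constant. Hence the lift over
  -- the plane continues through `∞` by the branch of the argument.
  have heq : EqOn F (fun z => ψ (z : OnePoint ℂ) + (F z0 - ψ z0)) (Metric.closedBall (0 : ℂ) R)ᶜ := by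
    refine Circle.isCoveringMap_exp.eqOn_of_comp_eqOn hconn F.continuous.continuousOn ?_ ?_ hz0
      (by simp)
    · intro z hz
      refine ContinuousAt.continuousWithinAt (ContinuousAt.add ?_ continuousAt_const)
      exact (hψc z (hout z hz)).comp (f := fun z : ℂ => (z : OnePoint ℂ))
        OnePoint.continuous_coe.continuousAt
    · intro z hz
      simp only [Function.comp, Circle.exp_add, hcexp, hF', hψexp, mul_one]
  set θ : OnePoint ℂ → ℝ := fun x => x.elim (ψ OnePoint.infty + (F z0 - ψ z0)) F with hθ
  refine ⟨θ, ?_, ?_⟩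
  · rw [continuous_iff_continuousAt]
    intro x
    induction x using OnePoint.rec with
    | infty =>
      have : ContinuousAt (fun x => ψ x + (F z0 - ψ z0)) OnePoint.infty :=
        (hψc _ hS1).add continuousAt_const
      refine this.congr ?_
      have hop : IsOpen ((fun z : ℂ => (z : OnePoint ℂ)) '' Metric.closedBall (0 : ℂ) R)ᶜ := by
        rw [OnePoint.isOpen_compl_image_coe]
        exact ⟨Metric.isClosed_closedBall, isCompact_closedBall _ _⟩
      filter_upwards [hop.mem_nhds (by simp)] with y hy
      induction y using OnePoint.rec with
      | infty => rfl
      | coe z => exact (heq (by intro hz; exact hy ⟨z, hz, rfl⟩)).symm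
    | coe z =>
      rw [OnePoint.continuousAt_coe]
      exact F.continuous.continuousAt
  · intro x
    induction x using OnePoint.rec with
    | infty => simp only [hθ, OnePoint.elim_infty, Circle.exp_add, hψexp, hcexp, mul_one]
    | coe z => exact hF' z

/-- The sphere is unicoherent: two connected open sets covering it have connected intersection. -/
theorem isPreconnected_inter_of_union_eq_univ {U V : Set (OnePoint ℂ)} (hU : IsOpen U)
    (hV : IsOpen V) (hUc : IsPreconnected U) (hVc : IsPreconnected V) (hUV : U ∪ V = univ) :
    IsPreconnected (U ∩ V) := by
  classical
  -- Suppose that the intersection splits into open sets `A` and `B`. A circle-valued map winding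
  -- once across `A` and constant elsewhere has a logarithm. Off `A`, this logarithm takes one
  -- constant value on `V` and another, larger by `2 π`, on `U`; the points of `B` lie in both.
  intro u v hu hv hsub hne1 hne2
  by_contra hcon
  rw [not_nonempty_iff_eq_empty] at hcon
  set A := U ∩ V ∩ u
  set B := U ∩ V ∩ v
  have hA : IsOpen A := (hU.inter hV).inter hu
  have hB : IsOpen B := (hU.inter hV).inter hv
  have hAB : Disjoint A B := by
    rw [Set.disjoint_left]
    rintro x ⟨h1, h2⟩ ⟨-, h3⟩
    exact (hcon ▸ (⟨h1, h2, h3⟩ : x ∈ U ∩ V ∩ (u ∩ v)) : x ∈ (∅ : Set (OnePoint ℂ)))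
  have hcl : ∀ x ∈ frontier A, x ∈ Uᶜ ∪ Vᶜ := by
    intro x hx
    by_contra hx'
    have hx1 : x ∈ U ∩ V := by
      simpa [not_or] using hx'
    have hxA : x ∉ A := by
      rw [hA.frontier_eq] at hx; exact hx.2
    have hxB : x ∈ B := ⟨hx1, (hsub hx1).resolve_left fun h => hxA ⟨hx1, h⟩⟩
    exact (hAB.closure_left hB).le_bot ⟨hA.frontier_eq ▸ hx |>.1, hxB⟩
  have hdis : Disjoint Uᶜ Vᶜ := by
    rw [Set.disjoint_compl_left_iff_subset]
    intro x hx
    have : x ∈ U ∪ V := hUV ▸ mem_univ x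
    exact this.resolve_right hx
  obtain ⟨h, h0, h1, -⟩ := exists_continuous_zero_one_of_isClosed hU.isClosed_compl
    hV.isClosed_compl hdis
  -- The definition glues continuously: the frontier of `A` lies outside `U` or outside `V`, where
  -- `h` is `0` or `1`.
  set g : OnePoint ℂ → Circle := fun x => if x ∈ A then Circle.exp (2 * Real.pi * h x) else 1
  have hg : Continuous g := by
    refine Continuous.if ?_ (by fun_prop) continuous_const
    intro x hx
    rcases hcl x hx with hx | hx
    · simp [h0 hx]
    · simp [h1 hx]
  obtain ⟨θ, hθ, hθg⟩ := exists_circle_lift g hg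
  obtain ⟨a, ha⟩ := hne1
  obtain ⟨b, hb⟩ := hne2
  have hbA : b ∉ A := fun h => hAB.le_bot ⟨h, hb⟩
  set c := θ a - 2 * Real.pi * h a
  have hc : Circle.exp c = 1 := by
    rw [Circle.exp_sub, hθg]
    simp [g, show a ∈ A from ha]
  have e1 : EqOn θ (fun x => (if x ∈ A then 2 * Real.pi * h x else 0) + c) V := by
    refine Circle.isCoveringMap_exp.eqOn_of_comp_eqOn hVc hθ.continuousOn ?_ ?_ ha.1.2 ?_
    · refine ContinuousOn.add (ContinuousOn.if ?_ (by fun_prop) continuousOn_const) continuousOn_const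
      intro x hx
      rcases hcl x hx.2 with h' | h'
      · simp [h0 h']
      · exact absurd hx.1 h'
    · intro x hx
      simp only [Function.comp, hθg, Circle.exp_add, hc, mul_one, g]
      split_ifs <;> simp
    · simp [show a ∈ A from ha, c]
  have e2 : EqOn θ (fun x => (if x ∈ A then 2 * Real.pi * h x else 2 * Real.pi) + c) U := by
    refine Circle.isCoveringMap_exp.eqOn_of_comp_eqOn hUc hθ.continuousOn ?_ ?_ ha.1.1 ?_
    · refine ContinuousOn.add (ContinuousOn.if ?_ (by fun_prop) continuousOn_const) continuousOn_const
      intro x hx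
      rcases hcl x hx.2 with h' | h'
      · exact absurd hx.1 h'
      · simp [h1 h']
    · intro x hx
      simp only [Function.comp, hθg, Circle.exp_add, hc, mul_one, g]
      split_ifs <;> simp
    · simp [show a ∈ A from ha, c]
  have := (e1 hb.1.2).symm.trans (e2 hb.1.1)
  simp [hbA, Real.pi_ne_zero] at this

/-- Makes connected components of open sets of the sphere open, as needed in `exists_connected_nhd`.
-/
instance : LocallyConnectedSpace (OnePoint ℂ) := by
  have e := onePointEquivSphereOfFinrankEq (ι := Fin 3) (V := ℂ) (by simp)
  have : Fact (Module.finrank ℝ (EuclideanSpace ℝ (Fin 3)) = 2 + 1) := ⟨by simp⟩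
  have : LocallyConnectedSpace (Metric.sphere (0 : EuclideanSpace ℝ (Fin 3)) 1) :=
    ChartedSpace.locallyConnectedSpace (EuclideanSpace ℝ (Fin 2)) _
  exact e.locallyConnectedSpace

end

section

/-! ### Complementary components and the quotient space -/

variable {G : Set (OnePoint ℂ)}

theorem continuous_hatMk : Continuous (hatMk G) := continuous_coinduced_rng

theorem hatMk_surjective : Function.Surjective (hatMk G) := Quotient.mk_surjective

theorem isOpen_hat_iff {U : Set (Hat G)} : IsOpen U ↔ IsOpen (hatMk G ⁻¹' U) :=
  isOpen_coinduced

theorem hatMk_eq_iff {z w : OnePoint ℂ} :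
    hatMk G z = hatMk G w ↔ z = w ∨ ∃ p ∈ complComponents G, z ∈ p ∧ w ∈ p := by
  exact Quotient.eq (r := hatSetoid G)

theorem eq_component_of_mem {p : Set (OnePoint ℂ)} (hp : p ∈ complComponents G) {z : OnePoint ℂ}
    (hz : z ∈ p) : p = connectedComponentIn Gᶜ z := by
  obtain ⟨w, -, rfl⟩ := hp
  exact connectedComponentIn_eq hz

theorem subset_compl_of_mem_complComponents {p : Set (OnePoint ℂ)} (hp : p ∈ complComponents G) :
    p ⊆ Gᶜ := by
  obtain ⟨w, -, rfl⟩ := hp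
  exact connectedComponentIn_subset _ _

theorem isConnected_of_mem_complComponents {p : Set (OnePoint ℂ)} (hp : p ∈ complComponents G) :
    IsConnected p := by
  obtain ⟨w, hw, rfl⟩ := hp
  exact isConnected_connectedComponentIn_iff.2 hw

theorem isClosed_of_mem_complComponents (hG : IsOpen G) {p : Set (OnePoint ℂ)}
    (hp : p ∈ complComponents G) : IsClosed p := by
  obtain ⟨w, hw, rfl⟩ := hp
  rw [connectedComponentIn_eq_image hw]
  exact hG.isClosed_compl.isClosedEmbedding_subtypeVal.isClosedMap _ isClosed_connectedComponent

theorem fiber_hatMk_of_mem {z : OnePoint ℂ} (hz : z ∈ G) : fiber (hatMk G z) = {z} := by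
  ext w
  simp only [fiber, mem_preimage, mem_singleton_iff, hatMk_eq_iff]
  refine ⟨?_, Or.inl⟩
  rintro (h | ⟨p, hp, -, h⟩)
  · exact h
  · exact absurd hz (subset_compl_of_mem_complComponents hp h)

theorem fiber_hatMk_of_notMem {z : OnePoint ℂ} (hz : z ∈ Gᶜ) :
    fiber (hatMk G z) = connectedComponentIn Gᶜ z := by
  ext w
  simp only [fiber, mem_preimage, mem_singleton_iff, hatMk_eq_iff]
  constructor
  · rintro (rfl | ⟨p, hp, h1, h2⟩)
    · exact mem_connectedComponentIn hz
    · rwa [← eq_component_of_mem hp h2]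
  · intro h
    exact Or.inr ⟨_, ⟨z, hz, rfl⟩, h, mem_connectedComponentIn hz⟩

theorem fiber_mem_complComponents {z : OnePoint ℂ} (hz : z ∈ Gᶜ) :
    fiber (hatMk G z) ∈ complComponents G := ⟨z, hz, fiber_hatMk_of_notMem hz⟩

theorem mem_fiber_hatMk (z : OnePoint ℂ) : z ∈ fiber (hatMk G z) := rfl

theorem fiber_eq_of_mem {p : Set (OnePoint ℂ)} (hp : p ∈ complComponents G) {z : OnePoint ℂ}
    (hz : z ∈ p) : fiber (hatMk G z) = p := by
  rw [fiber_hatMk_of_notMem (subset_compl_of_mem_complComponents hp hz), eq_component_of_mem hp hz]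

theorem isConnected_fiber (q : Hat G) : IsConnected (fiber q) := by
  obtain ⟨z, rfl⟩ := hatMk_surjective q
  by_cases hz : z ∈ G
  · rw [fiber_hatMk_of_mem hz]; exact isConnected_singleton
  · exact isConnected_of_mem_complComponents (fiber_mem_complComponents hz)

theorem isClosed_fiber (hG : IsOpen G) (q : Hat G) : IsClosed (fiber q) := by
  obtain ⟨z, rfl⟩ := hatMk_surjective q
  by_cases hz : z ∈ G
  · rw [fiber_hatMk_of_mem hz]; exact isClosed_singleton
  · exact isClosed_of_mem_complComponents hG (fiber_mem_complComponents hz)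

/-- A set is saturated if it contains every complementary component that it meets. -/
def IsSaturated (G W : Set (OnePoint ℂ)) : Prop :=
  ∀ p ∈ complComponents G, (p ∩ W).Nonempty → p ⊆ W

theorem IsSaturated.preimage_image {W : Set (OnePoint ℂ)} (hW : IsSaturated G W) :
    hatMk G ⁻¹' (hatMk G '' W) = W := by
  refine (subset_preimage_image _ _).antisymm' ?_
  rintro z ⟨w, hw, h⟩
  rcases hatMk_eq_iff.1 h with rfl | ⟨p, hp, h1, h2⟩
  · exact hw
  · exact hW p hp ⟨w, h1, hw⟩ h2

theorem isOpen_image_hatMk {W : Set (OnePoint ℂ)} (hW : IsSaturated G W) (hWo : IsOpen W) :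
    IsOpen (hatMk G '' W) := by
  rw [isOpen_hat_iff, hW.preimage_image]; exact hWo

theorem isSaturated_of_subset {W : Set (OnePoint ℂ)} (hW : W ⊆ G) : IsSaturated G W := by
  rintro p hp ⟨z, hz, hzW⟩
  exact absurd (hW hzW) (subset_compl_of_mem_complComponents hp hz)

/-! ### Neighbourhoods of complementary components. -/

theorem subset_left_of_isClosed {X : Type*} [TopologicalSpace X] {s L M : Set X}
    (hs : IsPreconnected s) (hL : IsClosed L) (hM : IsClosed M) (hd : Disjoint L M)
    (hsub : s ⊆ L ∪ M) (hne : (s ∩ L).Nonempty) : s ⊆ L := by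
  intro x hx
  by_contra hxL
  obtain ⟨y, -, hy1, hy2⟩ := isPreconnected_closed_iff.1 hs L M hL hM hsub hne
    ⟨x, hx, (hsub hx).resolve_left hxL⟩
  exact hd.le_bot ⟨hy1, hy2⟩

/-- In the compact Hausdorff space `Gᶜ` a component is the intersection of the clopen sets
containing it, so by compactness one clopen set `L` already lies in `V`. Removing the rest of `Gᶜ`
from `V` gives the neighbourhood. -/
theorem exists_saturated_nhd (hG : IsOpen G) {p V : Set (OnePoint ℂ)} (hp : p ∈ complComponents G)
    (hV : IsOpen V) (hpV : p ⊆ V) :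
    ∃ W, IsOpen W ∧ p ⊆ W ∧ W ⊆ V ∧ IsSaturated G W ∧ IsClosed (W ∩ Gᶜ) := by
  obtain ⟨z, hz, rfl⟩ := hp
  have hK : IsClosed Gᶜ := hG.isClosed_compl
  have hKc : CompactSpace (Gᶜ : Set (OnePoint ℂ)) := isCompact_iff_compactSpace.1 hK.isCompact
  have hcc := connectedComponent_eq_iInter_isClopen (⟨z, hz⟩ : (Gᶜ : Set (OnePoint ℂ)))
  have : Nonempty {s : Set (Gᶜ : Set (OnePoint ℂ)) // IsClopen s ∧ ⟨z, hz⟩ ∈ s} :=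
    ⟨univ, isClopen_univ, mem_univ _⟩
  obtain ⟨⟨L, hL, hzL⟩, hLV⟩ : ∃ L : {s : Set (Gᶜ : Set (OnePoint ℂ)) // IsClopen s ∧ ⟨z, hz⟩ ∈ s},
      L.1 ⊆ Subtype.val ⁻¹' V := by
    refine exists_subset_nhds_of_compactSpace (V := fun L : {s : Set (Gᶜ : Set (OnePoint ℂ)) //
      IsClopen s ∧ ⟨z, hz⟩ ∈ s} => L.1) ?_ (fun L => L.2.1.isClosed) ?_
    · rintro A B
      exact ⟨⟨A.1 ∩ B.1, A.2.1.inter B.2.1, A.2.2, B.2.2⟩, inter_subset_left, inter_subset_right⟩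
    · intro x hx
      rw [← hcc] at hx
      refine (hV.preimage continuous_subtype_val).mem_nhds (hpV ?_)
      rw [connectedComponentIn_eq_image hz]
      exact ⟨x, hx, rfl⟩
  have hLc : IsClosed (Subtype.val '' L) := (hK.isClosedEmbedding_subtypeVal.isClosedMap _ hL.isClosed)
  have hMc : IsClosed (Subtype.val '' Lᶜ) :=
    (hK.isClosedEmbedding_subtypeVal.isClosedMap _ hL.compl.isClosed)
  have hdisj : Disjoint (Subtype.val '' L) (Subtype.val '' Lᶜ) :=
    (disjoint_image_iff Subtype.val_injective).2 disjoint_compl_right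
  have hcov : Gᶜ = Subtype.val '' L ∪ Subtype.val '' Lᶜ := by
    rw [← image_union, union_compl_self, image_univ, Subtype.range_coe]
  have hWK : (V \ Subtype.val '' Lᶜ) ∩ Gᶜ = Subtype.val '' L := by
    ext x
    constructor
    · rintro ⟨⟨-, h1⟩, h2⟩
      rw [hcov] at h2
      exact h2.resolve_right h1
    · intro h
      refine ⟨⟨?_, fun h' => hdisj.le_bot ⟨h, h'⟩⟩, ?_⟩
      · obtain ⟨y, hy, rfl⟩ := h; exact hLV hy
      · rw [hcov]; exact Or.inl h
  have hsat : IsSaturated G (V \ Subtype.val '' Lᶜ) := by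
    rintro p hp ⟨x, hxp, hxW⟩
    have hpK := subset_compl_of_mem_complComponents hp
    have hxL : x ∈ Subtype.val '' L := hWK ▸ ⟨hxW, hpK hxp⟩
    have : p ⊆ Subtype.val '' L :=
      subset_left_of_isClosed (isConnected_of_mem_complComponents hp).isPreconnected hLc hMc hdisj
        (hcov ▸ hpK) ⟨x, hxp, hxL⟩
    rw [← hWK] at this
    exact this.trans inter_subset_left
  have hzmem : z ∈ V \ Subtype.val '' Lᶜ := by
    have : z ∈ (V \ Subtype.val '' Lᶜ) ∩ Gᶜ := hWK ▸ ⟨⟨z, hz⟩, hzL, rfl⟩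
    exact this.1
  refine ⟨V \ Subtype.val '' Lᶜ, hV.sdiff hMc, ?_, sdiff_subset, hsat, hWK ▸ hLc⟩
  exact hsat _ ⟨z, hz, rfl⟩ ⟨z, mem_connectedComponentIn hz, hzmem⟩

/-- Filling in the part of `Gᶜ` outside `L` keeps `G` connected: a piece of a separation that misses
`G` would be clopen in the whole sphere. -/
theorem isPreconnected_compl_of_isClosed (hG : IsSphereDomain G) {L : Set (OnePoint ℂ)}
    (hL : L ⊆ Gᶜ) (hLcl : IsClosed L) (hLc : IsClosed (Gᶜ \ L)) : IsPreconnected Lᶜ := by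
  have key : ∀ u v : Set (OnePoint ℂ), IsOpen u → IsOpen v → IsOpen Lᶜ → Lᶜ ⊆ u ∪ v →
      (Lᶜ ∩ v).Nonempty → Lᶜ ∩ (u ∩ v) = ∅ → ¬ G ⊆ u := by
    intro u v hu hv hLo hcov hne hcon hGu
    have hB : Lᶜ ∩ v = (Gᶜ \ L) ∩ uᶜ := by
      ext x
      constructor
      · rintro ⟨h1, h2⟩
        have hxu : x ∉ u := fun h => (hcon ▸ (⟨h1, h, h2⟩ : x ∈ Lᶜ ∩ (u ∩ v)) :
          x ∈ (∅ : Set (OnePoint ℂ)))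
        exact ⟨⟨fun h => hxu (hGu h), h1⟩, hxu⟩
      · rintro ⟨⟨-, h1⟩, h2⟩
        exact ⟨h1, (hcov h1).resolve_left h2⟩
    have hclopen : IsClopen (Lᶜ ∩ v) := ⟨hB ▸ hLc.inter hu.isClosed_compl, hLo.inter hv⟩
    have huniv := hclopen.eq_univ hne
    obtain ⟨x, hx⟩ := hG.2.nonempty
    have : x ∈ Lᶜ ∩ v := huniv ▸ mem_univ x
    rw [hB] at this
    exact this.1.1 hx
  intro u v hu hv hcov hne1 hne2
  by_contra hcon
  rw [not_nonempty_iff_eq_empty] at hcon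
  have hLo : IsOpen Lᶜ := hLcl.isOpen_compl
  have hGL : G ⊆ Lᶜ := fun x hx h => hL h hx
  by_cases hGu : (G ∩ u).Nonempty
  · by_cases hGv : (G ∩ v).Nonempty
    · obtain ⟨x, hx, hxu⟩ := hG.2.isPreconnected u v hu hv (hGL.trans hcov) hGu hGv
      exact (hcon ▸ (⟨hGL hx, hxu⟩ : x ∈ Lᶜ ∩ (u ∩ v)) : x ∈ (∅ : Set (OnePoint ℂ)))
    · exact key u v hu hv hLo hcov hne2 hcon fun x hx =>
        (hcov (hGL hx)).resolve_right fun h => hGv ⟨x, hx, h⟩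
  · exact key v u hv hu hLo (union_comm u v ▸ hcov) hne1 (inter_comm u v ▸ hcon) fun x hx =>
        (hcov (hGL hx)).resolve_left fun h => hGu ⟨x, hx, h⟩

/-- A complementary component has arbitrarily small saturated neighbourhoods whose trace on the
domain is connected. -/
theorem exists_connected_nhd (hG : IsSphereDomain G) {p V : Set (OnePoint ℂ)}
    (hp : p ∈ complComponents G) (hV : IsOpen V) (hpV : p ⊆ V) :
    ∃ W, IsOpen W ∧ p ⊆ W ∧ W ⊆ V ∧ IsSaturated G W ∧ IsConnected (W ∩ G) := by
  obtain ⟨W, hWo, hpW, hWV, hWs, hWc⟩ := exists_saturated_nhd hG.1 hp hV hpV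
  have hpc := isConnected_of_mem_complComponents hp
  obtain ⟨x, hx⟩ := hpc.nonempty
  -- Passing to one component of `W` keeps saturation, since complementary components are connected,
  -- and makes the neighbourhood itself connected.
  set Z := connectedComponentIn W x
  have hZo : IsOpen Z := hWo.connectedComponentIn
  have hZW : Z ⊆ W := connectedComponentIn_subset _ _
  have hZc : IsPreconnected Z := isPreconnected_connectedComponentIn
  have hpZ : p ⊆ Z := hpc.isPreconnected.subset_connectedComponentIn hx hpW
  have hWZ : IsOpen (W \ Z) := by
    rw [isOpen_iff_mem_nhds]
    rintro y ⟨hyW, hyZ⟩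
    filter_upwards [(hWo.connectedComponentIn (x := y)).mem_nhds (mem_connectedComponentIn hyW)]
      with z hz
    refine ⟨connectedComponentIn_subset _ _ hz, fun hzZ => hyZ ?_⟩
    change y ∈ connectedComponentIn W x
    rw [connectedComponentIn_eq hzZ, ← connectedComponentIn_eq hz]
    exact mem_connectedComponentIn hyW
  have hZsat : IsSaturated G Z := by
    rintro p' hp' ⟨y, hyp, hyZ⟩
    have := (isConnected_of_mem_complComponents hp').isPreconnected.subset_connectedComponentIn
      hyp (hWs p' hp' ⟨y, hyp, hZW hyZ⟩)
    rwa [← connectedComponentIn_eq hyZ] at this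
  have hLc : IsClosed (Z ∩ Gᶜ) := by
    have : Z ∩ Gᶜ = (W ∩ Gᶜ) ∩ (W \ Z)ᶜ := by
      ext y
      have := @hZW y
      simp only [mem_inter_iff, mem_compl_iff, mem_sdiff]
      tauto
    rw [this]
    exact hWc.inter hWZ.isClosed_compl
  have hMc : IsClosed (Gᶜ \ (Z ∩ Gᶜ)) := by
    have : Gᶜ \ (Z ∩ Gᶜ) = Gᶜ ∩ Zᶜ := by
      ext y
      simp only [mem_inter_iff, mem_compl_iff, mem_sdiff]
      tauto
    rw [this]
    exact hG.1.isClosed_compl.inter hZo.isClosed_compl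
  have hco := isPreconnected_compl_of_isClosed hG inter_subset_right hLc hMc
  have hZG : Z ∩ (Z ∩ Gᶜ)ᶜ = Z ∩ G := by
    ext y
    simp only [mem_inter_iff, mem_compl_iff]
    tauto
  refine ⟨Z, hZo, hpZ, hZW.trans hWV, hZsat, ?_, ?_⟩
  · rw [nonempty_iff_ne_empty]
    intro hemp
    have hZK : Z ∩ Gᶜ = Z := by
      rw [inter_eq_left]
      exact fun y hy hyG => (hemp ▸ (⟨hy, hyG⟩ : y ∈ Z ∩ G) : y ∈ (∅ : Set (OnePoint ℂ)))
    have hZu : Z = univ := IsClopen.eq_univ ⟨hZK ▸ hLc, hZo⟩ ⟨x, hpZ hx⟩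
    obtain ⟨y, hy⟩ := hG.2.nonempty
    exact (hemp ▸ (⟨hZu ▸ mem_univ y, hy⟩ : y ∈ Z ∩ G) : y ∈ (∅ : Set (OnePoint ℂ)))
  · rw [← hZG]
    -- `Z` and the complement of `Z ∩ Gᶜ` are connected open sets covering the sphere, and they meet
    -- exactly in `Z ∩ G`.
    refine isPreconnected_inter_of_union_eq_univ hZo hLc.isOpen_compl hZc hco ?_
    ext y
    simp only [mem_union, mem_compl_iff, mem_inter_iff, mem_univ, iff_true]
    tauto

/-- Upper semicontinuity of the decomposition into fibres; it makes the quotient map closed and the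
quotient Hausdorff. -/
theorem isOpen_fiber_subset (hG : IsOpen G) {V : Set (OnePoint ℂ)} (hV : IsOpen V) :
    IsOpen {q : Hat G | fiber q ⊆ V} := by
  rw [isOpen_hat_iff, isOpen_iff_mem_nhds]
  intro z hz
  simp only [mem_preimage, mem_ofPred_eq] at hz
  by_cases hzG : z ∈ G
  · filter_upwards [(hG.inter hV).mem_nhds ⟨hzG, hz (mem_fiber_hatMk z)⟩] with y hy
    simp only [mem_preimage, mem_ofPred_eq, fiber_hatMk_of_mem hy.1, singleton_subset_iff]
    exact hy.2
  · obtain ⟨W, hWo, hpW, hWV, hWs, -⟩ := exists_saturated_nhd hG (fiber_mem_complComponents hzG)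
      hV hz
    filter_upwards [hWo.mem_nhds (hpW (mem_fiber_hatMk z))] with y hy
    simp only [mem_preimage, mem_ofPred_eq]
    by_cases hyG : y ∈ G
    · rw [fiber_hatMk_of_mem hyG, singleton_subset_iff]
      exact hWV hy
    · exact (hWs _ (fiber_mem_complComponents hyG) ⟨y, mem_fiber_hatMk y, hy⟩).trans hWV

theorem isClosedMap_hatMk (hG : IsOpen G) : IsClosedMap (hatMk G) := by
  intro C hC
  rw [← isOpen_compl_iff]
  convert isOpen_fiber_subset hG hC.isOpen_compl using 1
  ext q
  simp only [mem_compl_iff, mem_image, not_exists, not_and, mem_ofPred_eq, subset_def, fiber,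
    mem_preimage, mem_singleton_iff]
  exact ⟨fun h x hx hxC => h x hxC hx, fun h x hx hxq => h x hxq hx⟩

/-- A closed map with connected fibres pulls connected closed sets back to connected sets. It turns
a path of the quotient into a connected subset of the sphere, which must meet every separating
circle. -/
theorem isPreconnected_preimage_hatMk (hG : IsOpen G) {S : Set (Hat G)} (hSc : IsClosed S)
    (hS : IsPreconnected S) : IsPreconnected (hatMk G ⁻¹' S) := by
  rw [isPreconnected_closed_iff]
  intro t t' ht ht' hcov hne hne'
  have hT : IsClosed (hatMk G ⁻¹' S) := hSc.preimage continuous_hatMk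
  have h1 : S ⊆ hatMk G '' (hatMk G ⁻¹' S ∩ t) ∪ hatMk G '' (hatMk G ⁻¹' S ∩ t') := by
    intro q hq
    obtain ⟨z, rfl⟩ := hatMk_surjective q
    rcases hcov hq with h | h
    · exact Or.inl ⟨z, ⟨hq, h⟩, rfl⟩
    · exact Or.inr ⟨z, ⟨hq, h⟩, rfl⟩
  have h2 : ∀ s : Set (OnePoint ℂ), (hatMk G ⁻¹' S ∩ s).Nonempty →
      (S ∩ hatMk G '' (hatMk G ⁻¹' S ∩ s)).Nonempty := by
    rintro s ⟨z, hz⟩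
    exact ⟨hatMk G z, hz.1, z, hz, rfl⟩
  obtain ⟨q, hqS, ⟨x, hx, rfl⟩, ⟨y, hy, hxy⟩⟩ := isPreconnected_closed_iff.1 hS _ _
    (isClosedMap_hatMk hG _ (hT.inter ht)) (isClosedMap_hatMk hG _ (hT.inter ht')) h1
    (h2 t hne) (h2 t' hne')
  have hsub : fiber (hatMk G x) ⊆ hatMk G ⁻¹' S := by
    intro w hw
    have : hatMk G w = hatMk G x := hw
    rw [mem_preimage, this]; exact hqS
  obtain ⟨w, hw, hw2⟩ := isPreconnected_closed_iff.1 (isConnected_fiber (hatMk G x)).isPreconnected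
    t t' ht ht' (hsub.trans hcov) ⟨x, rfl, hx.2⟩ ⟨y, hxy, hy.2⟩
  exact ⟨w, hsub hw, hw2⟩

theorem t2Space_hat (hG : IsOpen G) : T2Space (Hat G) := by
  refine ⟨fun q q' hne => ?_⟩
  have hd : Disjoint (fiber q) (fiber q') := by
    rw [Set.disjoint_left]
    exact fun z h1 h2 => hne (Eq.trans (Eq.symm h1) h2)
  obtain ⟨U, V, hU, hV, hqU, hqV, hUV⟩ := normal_separation (isClosed_fiber hG q)
    (isClosed_fiber hG q') hd
  refine ⟨_, _, isOpen_fiber_subset hG hU, isOpen_fiber_subset hG hV, hqU, hqV, ?_⟩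
  rw [Set.disjoint_left]
  intro r h1 h2
  obtain ⟨z, hz⟩ := (isConnected_fiber r).nonempty
  exact hUV.le_bot ⟨h1 hz, h2 hz⟩

instance : CompactSpace (Hat G) := inferInstanceAs (CompactSpace (Quotient (hatSetoid G)))

theorem dense_image_hatMk (hG : IsSphereDomain G) : Dense (hatMk G '' G) := by
  intro q
  obtain ⟨z, rfl⟩ := hatMk_surjective q
  by_cases hz : z ∈ G
  · exact subset_closure ⟨z, hz, rfl⟩
  rw [mem_closure_iff]
  intro U hU hzU
  obtain ⟨W, -, -, hWU, -, ⟨x, hx⟩, -⟩ := exists_connected_nhd hG (fiber_mem_complComponents hz)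
    (hU.preimage continuous_hatMk) (fun w hw => by
      have : hatMk G w = hatMk G z := hw
      rwa [mem_preimage, this])
  exact ⟨hatMk G x, hWU hx.1, x, hx.2, rfl⟩

end

section

/-! ### Extension of homeomorphisms to the quotient spaces -/

variable {G G' : Set (OnePoint ℂ)}

theorem fiber_subset_iff {V : Set (OnePoint ℂ)} {U : Set (Hat G)} {z : OnePoint ℂ}
    (hU : hatMk G z ∈ U) (hV : hatMk G ⁻¹' U = V) : fiber (hatMk G z) ⊆ V := by
  intro w hw
  have : hatMk G w = hatMk G z := hw
  rw [← hV, mem_preimage, this]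
  exact hU

/-- Near a complementary component, the image of a homeomorphism between domains converges to a
single point of the quotient space of the target. -/
theorem exists_tendsto_hat (hG : IsSphereDomain G) (hG' : IsSphereDomain G')
    {f g : OnePoint ℂ → OnePoint ℂ} (hf : ContinuousOn f G) (hg : ContinuousOn g G')
    (hgm : MapsTo g G' G) (hgf : ∀ z ∈ G, g (f z) = z) {z : OnePoint ℂ} (hz : z ∉ G) :
    ∃ y : Hat G', ∀ U : Set (Hat G'), IsOpen U → y ∈ U →
      ∃ W, IsOpen W ∧ fiber (hatMk G z) ⊆ W ∧ IsSaturated G W ∧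
        ∀ w ∈ W ∩ G, hatMk G' (f w) ∈ U := by
  have hp := fiber_mem_complComponents hz
  set p := fiber (hatMk G z)
  -- neighbourhoods avoiding a compact subset of the target
  have avoid : ∀ C ⊆ G', IsCompact C → IsOpen (g '' C)ᶜ ∧ p ⊆ (g '' C)ᶜ ∧
      ∀ w ∈ (g '' C)ᶜ ∩ G, f w ∉ C := by
    intro C hC hCc
    refine ⟨(hCc.image_of_continuousOn (hg.mono hC)).isClosed.isOpen_compl, ?_, ?_⟩
    · rintro x hx ⟨c, hc, rfl⟩
      exact subset_compl_of_mem_complComponents hp hx (hgm (hC hc))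
    · rintro w ⟨hw, hwG⟩ hfw
      exact hw ⟨f w, hfw, hgf w hwG⟩
  let ι := {W : Set (OnePoint ℂ) // IsOpen W ∧ p ⊆ W ∧ IsSaturated G W ∧ IsConnected (W ∩ G)}
  have nhd : ∀ V : Set (OnePoint ℂ), IsOpen V → p ⊆ V → ∃ W : ι, W.1 ⊆ V := by
    intro V hV hpV
    obtain ⟨W, h1, h2, h3, h4, h5⟩ := exists_connected_nhd hG hp hV hpV
    exact ⟨⟨W, h1, h2, h4, h5⟩, h3⟩
  have hne : Nonempty ι := ⟨(nhd univ isOpen_univ (subset_univ _)).choose⟩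
  -- The cluster set of the images along connected neighbourhoods; compactness of the quotient makes
  -- it non-empty.
  let T : ι → Set (Hat G') := fun W => closure ((fun w => hatMk G' (f w)) '' (W.1 ∩ G))
  have := t2Space_hat hG'.1
  obtain ⟨y, hy⟩ : (⋂ W, T W).Nonempty := by
    refine IsCompact.nonempty_iInter_of_directed_nonempty_isCompact_isClosed T ?_ ?_
      (fun W => isClosed_closure.isCompact) (fun W => isClosed_closure)
    · intro A B
      obtain ⟨W, hW⟩ := nhd (A.1 ∩ B.1) (A.2.1.inter B.2.1) (subset_inter A.2.2.1 B.2.2.1)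
      refine ⟨W, closure_mono (image_mono ?_), closure_mono (image_mono ?_)⟩
      · exact inter_subset_inter_left _ (hW.trans inter_subset_left)
      · exact inter_subset_inter_left _ (hW.trans inter_subset_right)
    · intro W
      exact (W.2.2.2.2.nonempty.image _).closure
  obtain ⟨v, rfl⟩ := hatMk_surjective y
  have clus : ∀ (W : ι) (O : Set (Hat G')), IsOpen O → hatMk G' v ∈ O →
      ∃ w ∈ W.1 ∩ G, hatMk G' (f w) ∈ O := by
    intro W O hO hvO
    obtain ⟨-, h, w, hw, rfl⟩ := mem_closure_iff.1 (mem_iInter.1 hy W) O hO hvO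
    exact ⟨w, hw, h⟩
  -- A compact neighbourhood of `v` in `G'` has a compact image under `g`, which a small
  -- neighbourhood of `p` avoids.
  have hv : v ∉ G' := by
    intro hv
    obtain ⟨N, hN, hNG, hNc⟩ := local_compact_nhds (hG'.1.mem_nhds hv)
    obtain ⟨ha1, ha2, ha3⟩ := avoid N hNG hNc
    obtain ⟨W, hW⟩ := nhd _ ha1 ha2
    have hsat : IsSaturated G' (interior N) :=
      isSaturated_of_subset (interior_subset.trans hNG)
    obtain ⟨w, hw, hwN⟩ := clus W _ (isOpen_image_hatMk hsat isOpen_interior)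
      ⟨v, mem_interior_iff_mem_nhds.2 hN, rfl⟩
    have hwN' : f w ∈ hatMk G' ⁻¹' (hatMk G' '' interior N) := hwN
    rw [hsat.preimage_image] at hwN'
    exact ha3 w ⟨hW hw.1, hw.2⟩ (interior_subset hwN')
  have hp' := fiber_mem_complComponents hv
  refine ⟨hatMk G' v, fun U hU hvU => ?_⟩
  obtain ⟨W0, hW0, hpW0, hW0U, hW0s, hW0c⟩ := exists_saturated_nhd hG'.1 hp'
    (hU.preimage continuous_hatMk) (fiber_subset_iff hvU rfl)
  have hMc : IsClosed (G'ᶜ ∩ W0ᶜ) := hG'.1.isClosed_compl.inter hW0.isClosed_compl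
  obtain ⟨OL, OM, hOL, hOM, hLs, hMs, hd⟩ := normal_separation hW0c hMc (by
    rw [Set.disjoint_left]
    exact fun x h1 h2 => h2.2 h1.1)
  -- Outside a compact subset of `G'` the target splits into two disjoint open sets. The connected
  -- image of `W ∩ G` lies in one of them, and the cluster point decides which.
  obtain ⟨hav1, hav2, hav3⟩ := avoid ((OL ∩ W0) ∪ OM)ᶜ (by
      intro x hx
      by_contra hxG
      refine hx ?_
      by_cases hxW : x ∈ W0
      · exact Or.inl ⟨hLs ⟨hxW, hxG⟩, hxW⟩
      · exact Or.inr (hMs ⟨hxG, hxW⟩))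
    ((hOL.inter hW0).union hOM).isClosed_compl.isCompact
  obtain ⟨W, hW⟩ := nhd _ hav1 hav2
  have hcov : f '' (W.1 ∩ G) ⊆ (OL ∩ W0) ∪ OM := by
    rintro - ⟨w, hw, rfl⟩
    exact not_not.1 (hav3 w ⟨hW hw.1, hw.2⟩)
  have hconn : IsPreconnected (f '' (W.1 ∩ G)) :=
    W.2.2.2.2.isPreconnected.image f (hf.mono inter_subset_right)
  obtain ⟨w0, hw0, hw0'⟩ := clus W {q | fiber q ⊆ OL ∩ W0}
    (isOpen_fiber_subset hG'.1 (hOL.inter hW0)) (by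
      intro x hx
      exact ⟨hLs ⟨hpW0 hx, subset_compl_of_mem_complComponents hp' hx⟩, hpW0 hx⟩)
  have hsub : f '' (W.1 ∩ G) ⊆ OL ∩ W0 := hconn.subset_left_of_subset_union (hOL.inter hW0) hOM
    (hd.mono_left inter_subset_left) hcov ⟨f w0, ⟨w0, hw0, rfl⟩, hw0' (mem_fiber_hatMk _)⟩
  exact ⟨W.1, W.2.1, W.2.2.1, W.2.2.2.1, fun w hw => hW0U (hsub ⟨w, hw, rfl⟩).2⟩

/-- Continuous extension from the dense image of `G`: limits exist at all points, at complementary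
components by `exists_tendsto_hat`. -/
theorem exists_continuous_hat_extension (hG : IsSphereDomain G) (hG' : IsSphereDomain G')
    {f g : OnePoint ℂ → OnePoint ℂ} (hf : ContinuousOn f G) (hg : ContinuousOn g G')
    (hgm : MapsTo g G' G) (hgf : ∀ z ∈ G, g (f z) = z) :
    ∃ F : Hat G → Hat G', Continuous F ∧ ∀ z ∈ G, F (hatMk G z) = hatMk G' (f z) := by
  have := t2Space_hat hG'.1
  have := t2Space_hat hG.1
  let φ : Hat G → Hat G' := fun q => hatMk G' (f (Quotient.out q))
  have hout : ∀ z ∈ G, Quotient.out (hatMk G z) = z := by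
    intro z hz
    have : Quotient.out (hatMk G z) ∈ fiber (hatMk G z) := Quotient.out_eq _
    rwa [fiber_hatMk_of_mem hz] at this
  have hφ : ∀ z ∈ G, φ (hatMk G z) = hatMk G' (f z) := fun z hz => by
    simp only [φ, hout z hz]
  have lim : ∀ q, ∃ y, Filter.Tendsto φ (𝓝[hatMk G '' G] q) (𝓝 y) := by
    intro q
    obtain ⟨z, rfl⟩ := hatMk_surjective q
    by_cases hz : z ∈ G
    · refine ⟨hatMk G' (f z), ?_⟩
      rw [tendsto_nhds]
      intro U hU hzU
      have hW : IsOpen (G ∩ f ⁻¹' (hatMk G' ⁻¹' U)) :=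
        hf.isOpen_inter_preimage hG.1 (hU.preimage continuous_hatMk)
      refine mem_nhdsWithin_of_mem_nhds (Filter.mem_of_superset ((isOpen_image_hatMk
        (isSaturated_of_subset inter_subset_left) hW).mem_nhds ⟨z, ⟨hz, hzU⟩, rfl⟩) ?_)
      rintro - ⟨w, hw, rfl⟩
      rw [mem_preimage, hφ w hw.1]
      exact hw.2
    · obtain ⟨y, hy⟩ := exists_tendsto_hat hG hG' hf hg hgm hgf hz
      refine ⟨y, ?_⟩
      rw [tendsto_nhds]
      intro U hU hyU
      obtain ⟨W, hWo, hpW, hWs, hW⟩ := hy U hU hyU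
      rw [mem_nhdsWithin]
      refine ⟨_, isOpen_image_hatMk hWs hWo, ⟨z, hpW (mem_fiber_hatMk z), rfl⟩, ?_⟩
      rintro - ⟨⟨w, hw, rfl⟩, ⟨x, hx, hxw⟩⟩
      have hwx : w = x := by
        have : w ∈ fiber (hatMk G x) := hxw.symm
        rwa [fiber_hatMk_of_mem hx] at this
      subst hwx
      rw [mem_preimage, hφ w hx]
      exact hW w ⟨hw, hx⟩
  refine ⟨extendFrom (hatMk G '' G) φ, continuous_extendFrom (dense_image_hatMk hG) lim, ?_⟩
  intro z hz
  rw [← hφ z hz]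
  refine extendFrom_eq (dense_image_hatMk hG _) ?_
  obtain ⟨y, hy⟩ := lim (hatMk G z)
  have hle : pure (hatMk G z) ≤ 𝓝[hatMk G '' G] (hatMk G z) :=
    pure_le_nhdsWithin ⟨z, hz, rfl⟩
  rw [tendsto_nhds_unique (tendsto_pure_nhds φ (hatMk G z)) (hy.mono_left hle)]
  exact hy

/-- A homeomorphism between domains extends to a homeomorphism of the quotient spaces. -/
theorem exists_homeomorph_hat_extension (hG : IsSphereDomain G) (hG' : IsSphereDomain G')
    {f g : OnePoint ℂ → OnePoint ℂ} (hf : ContinuousOn f G) (hg : ContinuousOn g G')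
    (hfm : MapsTo f G G') (hgm : MapsTo g G' G) (hgf : ∀ z ∈ G, g (f z) = z)
    (hfg : ∀ w ∈ G', f (g w) = w) :
    ∃ F : Hat G ≃ₜ Hat G', IsHatExtension f F := by
  obtain ⟨F, hF, hFf⟩ := exists_continuous_hat_extension hG hG' hf hg hgm hgf
  obtain ⟨E, hE, hEg⟩ := exists_continuous_hat_extension hG' hG hg hf hfm hfg
  have := t2Space_hat hG'.1
  have := t2Space_hat hG.1
  have h1 : E ∘ F = id := (hE.comp hF).ext_on (dense_image_hatMk hG) continuous_id (by
    rintro - ⟨z, hz, rfl⟩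
    simp only [Function.comp, hFf z hz, hEg _ (hfm hz), hgf z hz, id])
  have h2 : F ∘ E = id := (hF.comp hE).ext_on (dense_image_hatMk hG') continuous_id (by
    rintro - ⟨z, hz, rfl⟩
    simp only [Function.comp, hEg z hz, hFf _ (hgm hz), hfg z hz, id])
  exact ⟨⟨⟨F, E, congrFun h1, congrFun h2⟩, hF, hE⟩, hFf⟩

end

section

/-! ### Labels of the nodes of the binary tree

The nodes are numbered `1, 2, 3, …` in heap order: the children of `m` are `2 * m` and
`2 * m + 1`. -/

/-- The position of a node in the infix order of the binary tree, as a dyadic number. -/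
def label (m : ℕ) : ℝ := (2 * m + 1) / 2 ^ (Nat.log 2 m + 1) - 1

theorem log_two_mul_add {m c : ℕ} (hm : 1 ≤ m) (hc : c = 2 * m ∨ c = 2 * m + 1) :
    Nat.log 2 c = Nat.log 2 m + 1 := by
  rw [Nat.log_of_one_lt_of_le (by norm_num) (by omega)]
  congr 2; omega

theorem label_pos {m : ℕ} (hm : 1 ≤ m) : 0 < label m := by
  have h : (2 : ℝ) ^ Nat.log 2 m ≤ m := by exact_mod_cast Nat.pow_log_le_self 2 (by omega)
  rw [label, sub_pos, lt_div_iff₀ (by positivity), pow_succ]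
  linarith

theorem label_lt_one {m : ℕ} : label m < 1 := by
  have h : (m : ℝ) + 1 ≤ (2 : ℝ) ^ (Nat.log 2 m + 1) := by
    exact_mod_cast Nat.lt_pow_succ_log_self (by norm_num : 1 < 2) m
  rw [label, sub_lt_iff_lt_add, div_lt_iff₀ (by positivity)]
  linarith

/-- Labels plus one have odd numerator over a power of two, so the numerator is determined by the
value. -/
theorem label_injective {i j : ℕ} (h : label i = label j) : i = j := by
  have h1 : ((2 * i + 1 : ℕ) : ℝ) * 2 ^ (Nat.log 2 j) = ((2 * j + 1 : ℕ) : ℝ) * 2 ^ (Nat.log 2 i) := by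
    rw [label, label, sub_left_inj, div_eq_div_iff (by positivity) (by positivity), pow_succ,
      pow_succ] at h
    push_cast
    linarith
  have h2 : (2 * i + 1) * 2 ^ (Nat.log 2 j) = (2 * j + 1) * 2 ^ (Nat.log 2 i) := by
    exact_mod_cast h1
  have h3 : ∀ a b k l : ℕ, (2 * a + 1) * 2 ^ k = (2 * b + 1) * 2 ^ l → k ≤ l → a = b := by
    intro a b k l h hkl
    obtain ⟨d, rfl⟩ := Nat.exists_eq_add_of_le hkl
    rw [pow_add, mul_comm (2 ^ k), ← mul_assoc] at h
    have h := Nat.eq_of_mul_eq_mul_right (by positivity) h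
    rcases d with _ | d
    · omega
    · rw [pow_succ, ← mul_assoc] at h; omega
  rcases le_total (Nat.log 2 j) (Nat.log 2 i) with hl | hl
  · exact h3 _ _ _ _ h2 hl
  · exact (h3 _ _ _ _ h2.symm hl).symm

/-- The distance halves at each level; this is the geometric decay of the connecting arcs. -/
theorem abs_label_sub_child {m c : ℕ} (hm : 1 ≤ m) (hc : c = 2 * m ∨ c = 2 * m + 1) :
    |label c - label m| = 1 / 2 ^ (Nat.log 2 m + 2) := by
  have h2 : (2 : ℝ) ^ (Nat.log 2 m + 2) = 2 * 2 ^ (Nat.log 2 m + 1) := by ring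
  have hp : (0 : ℝ) < 2 ^ (Nat.log 2 m + 1) := by positivity
  rw [label, label, log_two_mul_add hm hc, show Nat.log 2 m + 1 + 1 = Nat.log 2 m + 2 from rfl, h2]
  rcases hc with rfl | rfl
  · rw [abs_of_neg] <;> push_cast <;> field_simp <;> ring_nf <;> norm_num
  · rw [abs_of_pos] <;> push_cast <;> field_simp <;> ring_nf <;> norm_num

/-- No label of a node of small index lies strictly between the labels of a node and of one of
its children. -/
theorem label_notMem_between {m c j : ℕ} (hm : 1 ≤ m) (hc : c = 2 * m ∨ c = 2 * m + 1)
    (hj : j ≤ 2 * m + 1) :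
    ¬ (label m < label j ∧ label j < label c) ∧ ¬ (label c < label j ∧ label j < label m) := by
  -- The node `j` is no deeper in the tree than the children of `m`.
  have hlog : Nat.log 2 j ≤ Nat.log 2 m + 1 := by
    rw [← log_two_mul_add hm (Or.inr rfl)]
    exact Nat.log_mono_right hj
  obtain ⟨d, hd⟩ := Nat.exists_eq_add_of_le hlog
  -- Over the common denominator `P` the three labels become integers, and those of `m` and `c` are
  -- consecutive.
  set P : ℝ := 2 ^ (Nat.log 2 m + 2) with hP
  have hPp : 0 < P := by positivity
  have e1 : label m = ((4 * m + 2 : ℕ) : ℝ) / P - 1 := by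
    rw [label, hP, pow_succ _ (Nat.log 2 m + 1)]; push_cast; field_simp; ring
  have e2 : label c = ((2 * c + 1 : ℕ) : ℝ) / P - 1 := by
    rw [label, log_two_mul_add hm hc, hP]; push_cast; rfl
  have e3 : label j = (((2 * j + 1) * 2 ^ d : ℕ) : ℝ) / P - 1 := by
    rw [label, hP, show Nat.log 2 m + 2 = Nat.log 2 j + 1 + d by omega, pow_add _ _ d]
    push_cast
    rw [mul_div_mul_right _ _ (by positivity)]
  rw [e1, e2, e3]
  simp only [sub_lt_sub_iff_right, div_lt_div_iff_of_pos_right hPp, Nat.cast_lt]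
  constructor <;> rintro ⟨h1, h2⟩ <;> rcases hc with rfl | rfl <;> omega

/-! ### The angle functions -/

/-- A tent function supported in `[-1/3, 1/3]`. -/
def bump (u : ℝ) : ℝ := max 0 (1 - 3 * |u|) / 2

theorem bump_nonneg (u : ℝ) : 0 ≤ bump u := by unfold bump; positivity

theorem bump_le (u : ℝ) : bump u ≤ 1 / 2 := by
  unfold bump
  have : max 0 (1 - 3 * |u|) ≤ 1 := max_le zero_le_one (by linarith [abs_nonneg u])
  linarith

/-- The angle of the long leg of the tripod `m` at the radius `exp (-t)`. Near an integer `k`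
the legs are spread to both sides of the angle of the tripod `k`. -/
def ang (m : ℕ) (t : ℝ) : ℝ :=
  label m + bump (t - round t) * (SignType.sign (label m - label (round t).toNat) : ℝ)

theorem abs_sign_le (x : ℝ) : |(SignType.sign x : ℝ)| ≤ 1 := by
  rcases lt_trichotomy x 0 with h | h | h <;> simp [h]

theorem abs_ang_sub_label (m : ℕ) (t : ℝ) : |ang m t - label m| ≤ 1 / 2 := by
  rw [ang, add_sub_cancel_left, abs_mul, abs_of_nonneg (bump_nonneg _)]
  nlinarith [bump_nonneg (t - round t), bump_le (t - round t), abs_nonneg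
    (SignType.sign (label m - label (round t).toNat) : ℝ),
    abs_sign_le (label m - label (round t).toNat)]

/-- The displacement is a non-negative multiple of a sign that is monotone in the label, so bending
never lets two legs cross. -/
theorem ang_lt_ang {i j : ℕ} (h : label i < label j) (t : ℝ) : ang i t < ang j t := by
  unfold ang
  have : (SignType.sign (label i - label (round t).toNat) : ℝ) ≤
      SignType.sign (label j - label (round t).toNat) := by
    have hm : (SignType.sign (label i - label (round t).toNat)) ≤
      SignType.sign (label j - label (round t).toNat) := SignType.sign.monotone (by linarith)
    revert hm
    generalize SignType.sign (label i - label (round t).toNat) = a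
    generalize SignType.sign (label j - label (round t).toNat) = b
    intro hm
    cases a <;> cases b <;> first | (exfalso; revert hm; decide) | norm_num
  have := mul_le_mul_of_nonneg_left this (bump_nonneg (t - round t))
  linarith

theorem ang_natCast (m k : ℕ) : ang m k = label m + 1 / 2 * (SignType.sign (label m - label k) : ℝ) := by
  simp [ang, bump]

theorem ang_self (m : ℕ) : ang m m = label m := by simp [ang_natCast]

/-- The middle third between two integers is free of bending; the connecting arcs are placed there.
-/
theorem ang_of_fract {m k : ℕ} {t : ℝ} (h1 : k + 1 / 3 ≤ t) (h2 : t ≤ k + 2 / 3) :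
    ang m t = label m := by
  have : bump (t - round t) = 0 := by
    have h3 : 1 / 3 ≤ |t - round t| := by
      rcases le_or_gt (round t) (k : ℤ) with h | h
      · have : (round t : ℝ) ≤ k := by exact_mod_cast h
        exact le_trans (by linarith) (le_abs_self _)
      · have : (k : ℝ) + 1 ≤ round t := by exact_mod_cast h
        exact le_trans (by linarith) (neg_le_abs _)
    rw [bump, max_eq_left (by linarith), zero_div]
  rw [ang, this, zero_mul, add_zero]

theorem bump_lipschitz (u v : ℝ) : |bump u - bump v| ≤ 3 / 2 * |u - v| := by
  unfold bump
  have h1 := abs_max_sub_max_le_abs (1 - 3 * |u|) (1 - 3 * |v|) 0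
  rw [max_comm _ (0 : ℝ), max_comm _ (0 : ℝ)] at h1
  have h2 := abs_abs_sub_abs_le_abs_sub u v
  rw [← sub_div, abs_div, abs_of_pos (by norm_num : (0 : ℝ) < 2)]
  have h3 : |1 - 3 * |u| - (1 - 3 * |v|)| = 3 * |(|u| - |v|)| := by
    rw [show 1 - 3 * |u| - (1 - 3 * |v|) = -(3 * (|u| - |v|)) by ring, abs_neg, abs_mul]
    norm_num
  linarith

theorem ang_lipschitz (m : ℕ) (s t : ℝ) : |ang m s - ang m t| ≤ 3 / 2 * |s - t| := by
  have hs := abs_sub_round s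
  have ht := abs_sub_round t
  by_cases h : round s = round t
  · rw [ang, ang, h, add_sub_add_left_eq_sub, ← sub_mul, abs_mul]
    have h1 := bump_lipschitz (s - round t) (t - round t)
    rw [sub_sub_sub_cancel_right] at h1
    calc _ ≤ |bump (s - round t) - bump (t - round t)| * 1 := by
          gcongr; exact abs_sign_le _
      _ ≤ _ := by rw [mul_one]; exact h1
  -- When the nearest integers differ the sign may flip, but then `s` and `t` are separated enough
  -- for their distance to control both bumps.
  · have hd : 1 ≤ |(round s : ℝ) - round t| := by
      have : 1 ≤ |round s - round t| := Int.one_le_abs (sub_ne_zero.2 h)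
      exact_mod_cast this
    have h1 : 1 - |s - round s| - |t - round t| ≤ |s - t| := by
      have e : (round s : ℝ) - round t = (s - t) + -(s - round s) + (t - round t) := by ring
      have := abs_add_three (s - t) (-(s - round s)) (t - round t)
      rw [← e, abs_neg] at this
      linarith
    have h2 : |ang m s - ang m t| ≤ bump (s - round s) + bump (t - round t) := by
      rw [ang, ang, add_sub_add_left_eq_sub]
      refine (abs_sub _ _).trans ?_
      rw [abs_mul, abs_mul, abs_of_nonneg (bump_nonneg _), abs_of_nonneg (bump_nonneg _)]
      have a1 := mul_le_mul_of_nonneg_left (abs_sign_le (label m - label (round s).toNat))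
        (bump_nonneg (s - round s))
      have a2 := mul_le_mul_of_nonneg_left (abs_sign_le (label m - label (round t).toNat))
        (bump_nonneg (t - round t))
      linarith
    refine h2.trans (le_trans ?_ (mul_le_mul_of_nonneg_left h1 (by norm_num)))
    unfold bump
    rcases max_choice 0 (1 - 3 * |s - round s|) with e1 | e1 <;>
    rcases max_choice 0 (1 - 3 * |t - round t|) with e2 | e2 <;> rw [e1, e2] <;> linarith

theorem continuous_ang (m : ℕ) : Continuous (ang m) := by
  have : LipschitzWith (3 / 2) (ang m) := LipschitzWith.of_dist_le_mul fun s t => by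
    simpa [Real.dist_eq] using ang_lipschitz m s t
  exact this.continuous

/-! ### The tripods -/

/-- The point with polar coordinates `(exp (-t), φ)`. -/
def pol (t φ : ℝ) : ℂ := Real.exp (-t) * Complex.exp (φ * Complex.I)

theorem norm_pol (t φ : ℝ) : ‖pol t φ‖ = Real.exp (-t) := by
  rw [pol, norm_mul, Complex.norm_exp_ofReal_mul_I, mul_one, Complex.norm_real, Real.norm_eq_abs,
    abs_of_pos (Real.exp_pos _)]

theorem continuous_pol : Continuous (fun p : ℝ × ℝ => pol p.1 p.2) := by
  unfold pol; fun_prop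

theorem pol_ne_zero (t φ : ℝ) : pol t φ ≠ 0 := by
  rw [← norm_pos_iff, norm_pol]; exact Real.exp_pos _

theorem pol_inj {t t' φ φ' : ℝ} (h : pol t φ = pol t' φ') (hφ : φ ∈ Ioc (-Real.pi) Real.pi)
    (hφ' : φ' ∈ Ioc (-Real.pi) Real.pi) : t = t' ∧ φ = φ' := by
  constructor
  · have := congrArg norm h
    rw [norm_pol, norm_pol] at this
    linarith [Real.exp_injective this]
  · have := congrArg Complex.arg h
    rwa [pol, pol, Complex.exp_mul_I, Complex.exp_mul_I,
      Complex.arg_mul_cos_add_sin_mul_I (Real.exp_pos _) hφ,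
      Complex.arg_mul_cos_add_sin_mul_I (Real.exp_pos _) hφ'] at this

theorem exists_pol {z : ℂ} (hz : z ≠ 0) : ∃ t, ∃ φ ∈ Ioc (-Real.pi) Real.pi, z = pol t φ := by
  refine ⟨-Real.log ‖z‖, z.arg, Complex.arg_mem_Ioc z, ?_⟩
  rw [pol, neg_neg, Real.exp_log (norm_pos_iff.2 hz), Complex.norm_mul_exp_arg_mul_I]

/-- The angles of the points of the tripod `m` on the circle of radius `exp (-t)`. -/
def slice (m : ℕ) (t : ℝ) : Set ℝ :=
  {φ | (m ≤ t ∧ t ≤ 4 * m ∧ φ = ang m t) ∨ (t = m ∧ |φ - label m| ≤ 1 / 4)}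

/-- The tripod `m`: a long leg, crossing the circles of radius `exp (-t)`, `m ≤ t ≤ 4 m`, and a
circular head of radius `exp (-m)`. -/
def tripod (m : ℕ) : Set ℂ := {z | ∃ t φ, φ ∈ slice m t ∧ z = pol t φ}

/-- The angles stay away from `± π`, so polar coordinates are unique on the tripods and the negative
real axis is free. -/
theorem slice_bounds {m : ℕ} (hm : 1 ≤ m) {t φ : ℝ} (h : φ ∈ slice m t) : -1 < φ ∧ φ < 2 := by
  have h1 := label_pos hm
  have h2 := label_lt_one (m := m)
  rcases h with ⟨-, -, rfl⟩ | ⟨-, h⟩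
  · have := abs_le.1 (abs_ang_sub_label m t); constructor <;> linarith
  · have := abs_le.1 h; constructor <;> linarith

theorem slice_mem_Ioo {m : ℕ} (hm : 1 ≤ m) {t φ : ℝ} (h : φ ∈ slice m t) :
    φ ∈ Ioo (-Real.pi) Real.pi := by
  have := slice_bounds hm h
  have := Real.pi_gt_three
  constructor <;> linarith

/-- At the radius of a head all other legs are displaced by `1 / 2`, whereas the head has half-width
`1 / 4`. So the order of the labels is the angular order at every radius. -/
theorem slice_lt_slice {i j : ℕ} (h : label i < label j) {t φ ψ : ℝ} (hφ : φ ∈ slice i t)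
    (hψ : ψ ∈ slice j t) : φ < ψ := by
  rcases hφ with ⟨-, -, rfl⟩ | ⟨rfl, h1⟩ <;> rcases hψ with ⟨-, -, rfl⟩ | ⟨ht, h2⟩
  · exact ang_lt_ang h t
  · rw [ht, ang_natCast, sign_neg (by linarith)]
    have := abs_le.1 h2
    simp only [SignType.coe_neg, SignType.coe_one]
    linarith
  · rw [ang_natCast, sign_pos (by linarith)]
    have := abs_le.1 h1
    simp only [SignType.coe_one]
    linarith
  · have : i = j := by exact_mod_cast ht
    subst this
    exact absurd h (lt_irrefl _)

theorem mem_tripod_iff {m : ℕ} (hm : 1 ≤ m) {t φ : ℝ} (hφ : φ ∈ Ioc (-Real.pi) Real.pi) :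
    pol t φ ∈ tripod m ↔ φ ∈ slice m t := by
  constructor
  · rintro ⟨t', φ', h, he⟩
    obtain ⟨rfl, rfl⟩ := pol_inj he hφ (Ioo_subset_Ioc_self (slice_mem_Ioo hm h))
    exact h
  · exact fun h => ⟨t, φ, h, rfl⟩

theorem disjoint_tripod {i j : ℕ} (hi : 1 ≤ i) (hj : 1 ≤ j) (hij : i ≠ j) :
    Disjoint (tripod i) (tripod j) := by
  rw [Set.disjoint_left]
  rintro - ⟨t, φ, h, rfl⟩ h'
  rw [mem_tripod_iff hj (Ioo_subset_Ioc_self (slice_mem_Ioo hi h))] at h'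
  rcases lt_trichotomy (label i) (label j) with hl | hl | hl
  · exact lt_irrefl _ (slice_lt_slice hl h h')
  · exact hij (label_injective hl)
  · exact lt_irrefl _ (slice_lt_slice hl h' h)

theorem tripod_eq (m : ℕ) : tripod m =
    (fun t => pol t (ang m t)) '' Icc (m : ℝ) (4 * m) ∪
      (fun φ => pol m φ) '' Icc (label m - 1 / 4) (label m + 1 / 4) := by
  ext z
  simp only [tripod, slice, mem_ofPred_eq, mem_union, mem_image, mem_Icc]
  constructor
  · rintro ⟨t, φ, ⟨h1, h2, rfl⟩ | ⟨rfl, h⟩, rfl⟩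
    · exact Or.inl ⟨t, ⟨h1, h2⟩, rfl⟩
    · rw [abs_le] at h
      exact Or.inr ⟨φ, ⟨by linarith, by linarith⟩, rfl⟩
  · rintro (⟨t, h, rfl⟩ | ⟨φ, h, rfl⟩)
    · exact ⟨t, _, Or.inl ⟨h.1, h.2, rfl⟩, rfl⟩
    · exact ⟨m, φ, Or.inr ⟨rfl, abs_le.2 ⟨by linarith, by linarith⟩⟩, rfl⟩

theorem continuous_leg (m : ℕ) : Continuous fun t => pol t (ang m t) :=
  continuous_pol.comp (continuous_id.prodMk (continuous_ang m))

theorem isCompact_tripod (m : ℕ) : IsCompact (tripod m) := by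
  rw [tripod_eq]
  exact (isCompact_Icc.image (continuous_leg m)).union
    (isCompact_Icc.image (continuous_pol.comp (by fun_prop : Continuous fun φ : ℝ => ((m : ℝ), φ))))

theorem isConnected_tripod (m : ℕ) : IsConnected (tripod m) := by
  rw [tripod_eq]
  refine IsConnected.union ⟨pol m (label m), ⟨m, ⟨le_rfl, ?_⟩, ?_⟩, ⟨label m, ⟨?_, ?_⟩, rfl⟩⟩ ?_ ?_
  · linarith [(Nat.cast_nonneg m : (0 : ℝ) ≤ m)]
  · simp only [ang_self]
  · linarith
  · linarith
  · refine (isConnected_Icc ?_).image _ (continuous_leg m).continuousOn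
    linarith [(Nat.cast_nonneg m : (0 : ℝ) ≤ m)]
  · exact (isConnected_Icc (by linarith)).image _
      (continuous_pol.comp (by fun_prop : Continuous fun φ : ℝ => ((m : ℝ), φ))).continuousOn

theorem norm_le_of_mem_tripod {m : ℕ} {z : ℂ} (hz : z ∈ tripod m) :
    ‖z‖ ≤ Real.exp (-m) := by
  obtain ⟨t, φ, h, rfl⟩ := hz
  rw [norm_pol, Real.exp_le_exp, neg_le_neg_iff]
  rcases h with ⟨h, -, -⟩ | ⟨rfl, -⟩
  · exact h
  · exact le_rfl

theorem zero_notMem_tripod {m : ℕ} : (0 : ℂ) ∉ tripod m := by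
  rintro ⟨t, φ, -, h⟩
  exact pol_ne_zero t φ h.symm

end

section

/-! ### The domain -/

/-- The union of the tripods with index in `S`, together with the origin. -/
def tripods (S : Set ℕ) : Set ℂ := {z | z = 0 ∨ ∃ m ∈ S, z ∈ tripod m}

/-- Tripod `m` lies in the disk of radius `exp (-m)`, so the family is locally finite away from the
origin. -/
theorem isCompact_tripods {S : Set ℕ} : IsCompact (tripods S) := by
  refine Metric.isCompact_of_isClosed_isBounded ?_ ?_
  · rw [← isOpen_compl_iff, isOpen_iff_mem_nhds]
    intro z hz
    have hz0 : z ≠ 0 := fun h => hz (Or.inl h)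
    obtain ⟨M, hM⟩ := exists_nat_gt (-Real.log ‖z‖)
    have hM' : Real.exp (-M) < ‖z‖ := by
      rw [← Real.lt_log_iff_exp_lt (norm_pos_iff.2 hz0)]; linarith
    have h1 : IsClosed (⋃ m ∈ S ∩ Iio M, tripod m) :=
      ((finite_Iio M).subset inter_subset_right).isClosed_biUnion
        fun m _ => (isCompact_tripod m).isClosed
    have h2 : z ∈ (⋃ m ∈ S ∩ Iio M, tripod m)ᶜ := by
      simp only [mem_compl_iff, mem_iUnion, not_exists]
      exact fun m hm hzm => hz (Or.inr ⟨m, hm.1, hzm⟩)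
    filter_upwards [h1.isOpen_compl.mem_nhds h2,
      (isOpen_lt continuous_const continuous_norm).mem_nhds hM'] with w hw hw'
    rintro (rfl | ⟨m, hm, hwm⟩)
    · rw [norm_zero] at hw'
      exact (Real.exp_pos _).not_gt hw'
    · rcases lt_or_ge m M with h | h
      · exact hw (mem_biUnion (⟨hm, h⟩ : m ∈ S ∩ Iio M) hwm)
      · have := norm_le_of_mem_tripod hwm
        have h3 : Real.exp (-(m : ℝ)) ≤ Real.exp (-M) := by
          rw [Real.exp_le_exp, neg_le_neg_iff]; exact_mod_cast h
        linarith
  · refine (Metric.isBounded_closedBall (x := (0 : ℂ)) (r := 1)).subset ?_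
    rintro z (rfl | ⟨m, -, hz⟩)
    · simp
    · rw [mem_closedBall_zero_iff]
      refine (norm_le_of_mem_tripod hz).trans ?_
      rw [Real.exp_le_one_iff, neg_nonpos]
      positivity

/-- The domain: the complement of the tripods and the origin. -/
def Om : Set (OnePoint ℂ) := ((fun z : ℂ => (z : OnePoint ℂ)) '' tripods (Ici 1))ᶜ

/-- The tripod `m` as a subset of the sphere. -/
def tri (m : ℕ) : Set (OnePoint ℂ) := (fun z : ℂ => (z : OnePoint ℂ)) '' tripod m

theorem isOpen_Om : IsOpen Om :=
  OnePoint.isOpen_compl_image_coe.2 ⟨isCompact_tripods.isClosed, isCompact_tripods⟩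

theorem infty_mem_Om : OnePoint.infty ∈ Om := by simp [Om]

theorem coe_mem_Om {z : ℂ} : (z : OnePoint ℂ) ∈ Om ↔ z ≠ 0 ∧ ∀ m, 1 ≤ m → z ∉ tripod m := by
  have : (z : OnePoint ℂ) ∈ Om ↔ z ∉ tripods (Ici 1) := by
    rw [Om, mem_compl_iff, not_iff_not]
    exact Function.Injective.mem_set_image OnePoint.coe_injective
  rw [this]
  simp [tripods]

theorem Om_compl : Omᶜ = {((0 : ℂ) : OnePoint ℂ)} ∪ ⋃ m ∈ Ici 1, tri m := by
  rw [Om, compl_compl]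
  ext x
  simp only [mem_image, tripods, mem_ofPred_eq, tri, mem_union, mem_singleton_iff, mem_iUnion,
    exists_prop]
  constructor
  · rintro ⟨z, rfl | ⟨m, hm, hz⟩, rfl⟩
    · exact Or.inl rfl
    · exact Or.inr ⟨m, hm, z, hz, rfl⟩
  · rintro (rfl | ⟨m, hm, z, hz, rfl⟩)
    · exact ⟨0, Or.inl rfl, rfl⟩
    · exact ⟨z, Or.inr ⟨m, hm, hz⟩, rfl⟩

theorem tri_subset {m : ℕ} (hm : 1 ≤ m) : tri m ⊆ Omᶜ := by
  rw [Om_compl]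
  exact fun x hx => Or.inr (mem_biUnion (show m ∈ Ici 1 from hm) hx)

theorem isClosed_image_coe {C : Set ℂ} (hC : IsCompact C) :
    IsClosed ((fun z : ℂ => (z : OnePoint ℂ)) '' C) :=
  (hC.image OnePoint.continuous_coe).isClosed

theorem isClosed_tri (m : ℕ) : IsClosed (tri m) := isClosed_image_coe (isCompact_tripod m)

theorem isConnected_tri (m : ℕ) : IsConnected (tri m) :=
  (isConnected_tripod m).image _ OnePoint.continuous_coe.continuousOn

theorem zero_notMem_tri {m : ℕ} : ((0 : ℂ) : OnePoint ℂ) ∉ tri m := by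
  rintro ⟨z, hz, h⟩
  rw [OnePoint.coe_eq_coe] at h
  exact zero_notMem_tripod (h ▸ hz)

theorem disjoint_tri {i j : ℕ} (hi : 1 ≤ i) (hj : 1 ≤ j) (hij : i ≠ j) :
    Disjoint (tri i) (tri j) :=
  (disjoint_image_iff OnePoint.coe_injective).2 (disjoint_tripod hi hj hij)

/-- The complement of the domain without the tripod `m`. -/
def rest (m : ℕ) : Set (OnePoint ℂ) :=
  (fun z : ℂ => (z : OnePoint ℂ)) '' tripods {j | 1 ≤ j ∧ j ≠ m}

theorem isClosed_rest (m : ℕ) : IsClosed (rest m) := isClosed_image_coe isCompact_tripods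

theorem disjoint_tri_rest {m : ℕ} (hm : 1 ≤ m) : Disjoint (tri m) (rest m) := by
  rw [tri, rest, disjoint_image_iff OnePoint.coe_injective, Set.disjoint_left]
  rintro z hz (rfl | ⟨j, ⟨hj, hjm⟩, hzj⟩)
  · exact zero_notMem_tripod hz
  · exact (disjoint_tripod hj hm hjm).le_bot ⟨hzj, hz⟩

theorem Om_compl_eq_union {m : ℕ} (hm : 1 ≤ m) : Omᶜ = tri m ∪ rest m := by
  rw [Om, compl_compl, tri, rest, ← image_union]
  congr 1
  ext z
  simp only [tripods, mem_ofPred_eq, mem_union, mem_Ici]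
  constructor
  · rintro (h | ⟨j, hj, hz⟩)
    · exact Or.inr (Or.inl h)
    · rcases eq_or_ne j m with rfl | hjm
      · exact Or.inl hz
      · exact Or.inr (Or.inr ⟨j, ⟨hj, hjm⟩, hz⟩)
  · rintro (h | h | ⟨j, ⟨hj, -⟩, hz⟩)
    · exact Or.inr ⟨m, hm, h⟩
    · exact Or.inl h
    · exact Or.inr ⟨j, hj, hz⟩

/-- The tripod is connected, and it and the rest of the complement, origin included, are disjoint
closed sets. -/
theorem connectedComponentIn_of_mem_tri {m : ℕ} (hm : 1 ≤ m) {x : OnePoint ℂ} (hx : x ∈ tri m) :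
    connectedComponentIn Omᶜ x = tri m := by
  refine subset_antisymm ?_ ((isConnected_tri m).isPreconnected.subset_connectedComponentIn hx
    (tri_subset hm))
  refine subset_left_of_isClosed isPreconnected_connectedComponentIn (isClosed_tri m)
    (isClosed_rest m) (disjoint_tri_rest hm) ?_ ⟨x, mem_connectedComponentIn (tri_subset hm hx), hx⟩
  rw [← Om_compl_eq_union hm]
  exact connectedComponentIn_subset _ _

theorem zero_mem_Om_compl : ((0 : ℂ) : OnePoint ℂ) ∈ Omᶜ := by rw [Om_compl]; exact Or.inl rfl

theorem connectedComponentIn_zero :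
    connectedComponentIn Omᶜ ((0 : ℂ) : OnePoint ℂ) = {((0 : ℂ) : OnePoint ℂ)} := by
  refine subset_antisymm ?_ (singleton_subset_iff.2 (mem_connectedComponentIn zero_mem_Om_compl))
  intro x hx
  have hx' := connectedComponentIn_subset _ _ hx
  rw [Om_compl] at hx'
  rcases hx' with h | h
  · exact h
  · simp only [mem_iUnion] at h
    obtain ⟨m, hm, hxm⟩ := h
    have h0 := mem_connectedComponentIn zero_mem_Om_compl
    rw [connectedComponentIn_eq hx, connectedComponentIn_of_mem_tri hm hxm] at h0
    exact absurd h0 zero_notMem_tri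

theorem complComponents_Om :
    complComponents Om = insert {((0 : ℂ) : OnePoint ℂ)} (tri '' Ici 1) := by
  ext p
  constructor
  · rintro ⟨x, hx, rfl⟩
    rw [Om_compl] at hx
    rcases hx with rfl | hx
    · exact Or.inl connectedComponentIn_zero
    · simp only [mem_iUnion] at hx
      obtain ⟨m, hm, hxm⟩ := hx
      exact Or.inr ⟨m, hm, (connectedComponentIn_of_mem_tri hm hxm).symm⟩
  · rintro (rfl | ⟨m, hm, rfl⟩)
    · exact ⟨_, zero_mem_Om_compl, connectedComponentIn_zero.symm⟩
    · obtain ⟨x, hx⟩ := (isConnected_tri m).nonempty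
      exact ⟨x, tri_subset hm hx, (connectedComponentIn_of_mem_tri hm hx).symm⟩

theorem tri_mem_complComponents {m : ℕ} (hm : 1 ≤ m) : tri m ∈ complComponents Om := by
  rw [complComponents_Om]; exact Or.inr ⟨m, hm, rfl⟩

theorem countable_complComponents_Om : (complComponents Om).Countable := by
  rw [complComponents_Om]
  exact ((to_countable _).image _).insert _

/-! ### Connectedness -/

theorem isPreconnected_compl_image_coe {C : Set ℂ} (hC : IsCompact C) (h : IsPreconnected Cᶜ) :
    IsPreconnected ((fun z : ℂ => (z : OnePoint ℂ)) '' C)ᶜ := by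
  refine (h.image _ OnePoint.continuous_coe.continuousOn).subset_closure ?_ ?_
  · rintro - ⟨z, hz, rfl⟩ ⟨w, hw, hwz⟩
    rw [OnePoint.coe_eq_coe] at hwz
    exact hz (hwz ▸ hw)
  · refine (OnePoint.denseRange_coe.open_subset_closure_inter
      (isClosed_image_coe hC).isOpen_compl).trans (closure_mono ?_)
    rintro - ⟨hx, z, rfl⟩
    exact ⟨z, fun hz => hx ⟨z, hz, rfl⟩, rfl⟩

/-- Each slice is empty, a point or an interval, so a point outside it can be rotated away in one
direction. -/
theorem lt_or_gt_slice {m : ℕ} {t φ : ℝ} (hφ : φ ∉ slice m t) :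
    (∀ ψ ∈ slice m t, ψ < φ) ∨ (∀ ψ ∈ slice m t, φ < ψ) := by
  by_cases ht : t = m
  · subst ht
    have hs : ∀ ψ, ψ ∈ slice m m ↔ |ψ - label m| ≤ 1 / 4 := by
      intro ψ
      simp only [slice, mem_ofPred_eq, true_and]
      refine ⟨?_, Or.inr⟩
      rintro (⟨-, -, rfl⟩ | h)
      · rw [ang_self, sub_self, abs_zero]; norm_num
      · exact h
    rw [hs, abs_le, not_and_or] at hφ
    simp only [hs, abs_le]
    rcases hφ with h | h
    · exact Or.inr fun ψ hψ => by linarith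
    · exact Or.inl fun ψ hψ => by linarith
  · have hs : ∀ ψ ∈ slice m t, ψ = ang m t ∧ ang m t ∈ slice m t := by
      rintro ψ (⟨h1, h2, rfl⟩ | h)
      · exact ⟨rfl, Or.inl ⟨h1, h2, rfl⟩⟩
      · exact absurd h.1 ht
    rcases lt_trichotomy φ (ang m t) with h | h | h
    · exact Or.inr fun ψ hψ => (hs ψ hψ).1 ▸ h
    · exact Or.inl fun ψ hψ => absurd (h ▸ (hs ψ hψ).2) hφ
    · exact Or.inl fun ψ hψ => (hs ψ hψ).1 ▸ h

theorem pol_pi (t : ℝ) : pol t Real.pi = -Real.exp (-t) := by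
  rw [pol, Complex.exp_pi_mul_I]; simp

theorem pol_neg_pi (t : ℝ) : pol t (-Real.pi) = -Real.exp (-t) := by
  rw [pol, Complex.ofReal_neg, neg_mul, Complex.exp_neg_pi_mul_I]; simp

/-- Each point off the tripod is joined, by rotation on its circle, to the negative real axis, which
is connected and disjoint from the tripod. -/
theorem isPreconnected_compl_tripod {m : ℕ} (hm : 1 ≤ m) : IsPreconnected (tripod m)ᶜ := by
  -- the closed negative axis
  set N : Set ℂ := (fun r : ℝ => (-(r : ℂ))) '' Ici 0
  have hN : IsPreconnected N := isPreconnected_Ici.image _ (by fun_prop)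
  have hNpol : ∀ t, pol t Real.pi ∈ N := fun t => by
    rw [pol_pi]; exact ⟨_, (Real.exp_pos _).le, rfl⟩
  have hpi := Real.pi_pos
  have hNT : N ⊆ (tripod m)ᶜ := by
    rintro - ⟨r, hr, rfl⟩ h
    rcases (mem_Ici.1 hr).eq_or_lt with rfl | hr
    · simp only [Complex.ofReal_zero, neg_zero] at h
      exact zero_notMem_tripod h
    · have e : -(r : ℂ) = pol (-Real.log r) Real.pi := by
        rw [pol_pi, neg_neg, Real.exp_log hr]
      dsimp only at h
      rw [e, mem_tripod_iff hm ⟨by linarith, le_rfl⟩] at h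
      exact absurd (slice_mem_Ioo hm h).2 (lt_irrefl _)
  refine isPreconnected_of_forall 0 fun z hz => ?_
  have h0 : (0 : ℂ) ∈ N := ⟨0, self_mem_Ici, by simp⟩
  by_cases hz0 : z = 0
  · exact ⟨N, hNT, h0, hz0 ▸ h0, hN⟩
  obtain ⟨t, φ, hφ, rfl⟩ := exists_pol hz0
  rw [mem_compl_iff, mem_tripod_iff hm hφ] at hz
  have hcont : Continuous (fun ψ => pol t ψ) :=
    continuous_pol.comp (by fun_prop : Continuous fun φ : ℝ => (t, φ))
  rcases lt_or_gt_slice hz with h | h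
  · refine ⟨N ∪ (fun ψ => pol t ψ) '' Icc φ Real.pi, union_subset hNT ?_, Or.inl h0,
      Or.inr ⟨φ, ⟨le_rfl, hφ.2⟩, rfl⟩, hN.union (pol t Real.pi) (hNpol t)
        ⟨Real.pi, ⟨hφ.2, le_rfl⟩, rfl⟩ (isPreconnected_Icc.image _ hcont.continuousOn)⟩
    rintro - ⟨ψ, hψ, rfl⟩ hT
    dsimp only at hT
    rw [mem_tripod_iff hm ⟨hφ.1.trans_le hψ.1, hψ.2⟩] at hT
    exact (h ψ hT).not_ge hψ.1
  · refine ⟨N ∪ (fun ψ => pol t ψ) '' Icc (-Real.pi) φ, union_subset hNT ?_, Or.inl h0,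
      Or.inr ⟨φ, ⟨hφ.1.le, le_rfl⟩, rfl⟩, hN.union (pol t Real.pi) (hNpol t)
        ⟨-Real.pi, ⟨le_rfl, hφ.1.le⟩, ?_⟩ (isPreconnected_Icc.image _ hcont.continuousOn)⟩
    · rintro - ⟨ψ, hψ, rfl⟩ hT
      dsimp only at hT
      rcases hψ.1.eq_or_lt with rfl | hlt
      · rw [pol_neg_pi, ← pol_pi] at hT
        exact hNT (hNpol t) hT
      · rw [mem_tripod_iff hm ⟨hlt, hψ.2.trans hφ.2⟩] at hT
        exact (h ψ hT).not_ge hψ.2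
    · simp only [pol_neg_pi, pol_pi]

theorem isSphereDomain_compl_tri {m : ℕ} (hm : 1 ≤ m) : IsSphereDomain (tri m)ᶜ :=
  ⟨(isClosed_tri m).isOpen_compl, ⟨_, zero_notMem_tri⟩,
    isPreconnected_compl_image_coe (isCompact_tripod m) (isPreconnected_compl_tripod hm)⟩

/-- The punctured neighbourhood of a tripod is connected, so in a separation of `Om` it belongs to
one piece. Adding each tripod to its piece gives a separation of the sphere minus the origin, which
is impossible. -/
theorem isSphereDomain_Om : IsSphereDomain Om := by
  refine ⟨isOpen_Om, ⟨_, infty_mem_Om⟩, ?_⟩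
  -- neighbourhoods of the tripods
  have hW : ∀ m, 1 ≤ m → ∃ W, IsOpen W ∧ tri m ⊆ W ∧ W \ tri m ⊆ Om ∧ IsConnected (W \ tri m) := by
    intro m hm
    have hp : tri m ∈ complComponents (tri m)ᶜ := by
      obtain ⟨x, hx⟩ := (isConnected_tri m).nonempty
      refine ⟨x, by rwa [compl_compl], ?_⟩
      rw [compl_compl]
      exact ((isConnected_tri m).isPreconnected.connectedComponentIn hx).symm
    obtain ⟨W, h1, h2, h3, -, h5⟩ := exists_connected_nhd (isSphereDomain_compl_tri hm) hp
      (isClosed_rest m).isOpen_compl (disjoint_tri_rest hm).subset_compl_right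
    refine ⟨W, h1, h2, ?_, h5⟩
    rintro x ⟨hx, hxm⟩
    by_contra hxO
    have : x ∈ Omᶜ := hxO
    rw [Om_compl_eq_union hm] at this
    exact this.elim hxm (h3 hx)
  choose! W hWo hTW hWOm hWc using hW
  have h0c : IsPreconnected ({((0 : ℂ) : OnePoint ℂ)} : Set (OnePoint ℂ))ᶜ := by
    have := isPreconnected_compl_image_coe (isCompact_singleton (x := (0 : ℂ)))
      (isConnected_compl_singleton_of_one_lt_rank (by simp) 0).isPreconnected
    rwa [image_singleton] at this
  intro u v hu hv hcov hne1 hne2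
  by_contra hcon
  rw [not_nonempty_iff_eq_empty] at hcon
  have hO := isOpen_Om
  -- extend an open piece of the domain across the tripods
  let E : Set (OnePoint ℂ) → Set (OnePoint ℂ) := fun A =>
    A ∪ ⋃ m ∈ {m | 1 ≤ m ∧ W m \ tri m ⊆ A}, tri m
  have hEo : ∀ A, IsOpen A → IsOpen (E A) := by
    intro A hA
    have : E A = A ∪ ⋃ m ∈ {m | 1 ≤ m ∧ W m \ tri m ⊆ A}, W m := by
      refine subset_antisymm (union_subset_union_right _ (biUnion_mono subset_rfl
        fun m hm => hTW m hm.1)) (union_subset subset_union_left (iUnion₂_subset fun m hm => ?_))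
      intro x hx
      by_cases hxm : x ∈ tri m
      · exact Or.inr (mem_biUnion hm hxm)
      · exact Or.inl (hm.2 ⟨hx, hxm⟩)
    rw [this]
    exact hA.union (isOpen_biUnion fun m hm => hWo m hm.1)
  have hdis : Disjoint (Om ∩ u) (Om ∩ v) := by
    rw [Set.disjoint_left]
    rintro x ⟨h1, h2⟩ ⟨-, h3⟩
    exact (hcon ▸ (⟨h1, h2, h3⟩ : x ∈ Om ∩ (u ∩ v)) : x ∈ (∅ : Set (OnePoint ℂ)))
  have htri : ∀ A ⊆ Om, ∀ m, 1 ≤ m → ∀ x ∈ tri m, x ∈ E A → W m \ tri m ⊆ A := by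
    rintro A hA m hm x hx (h | h)
    · exact absurd (hA h) (tri_subset hm hx)
    · simp only [mem_iUnion] at h
      obtain ⟨j, hj, hxj⟩ := h
      rcases eq_or_ne j m with rfl | hjm
      · exact hj.2
      · exact absurd hx fun h => (disjoint_tri hj.1 hm hjm).le_bot ⟨hxj, h⟩
  have hE0 : ∀ A ⊆ Om, E A ⊆ {((0 : ℂ) : OnePoint ℂ)}ᶜ := by
    rintro A hA x (h | h) rfl
    · exact zero_mem_Om_compl (hA h)
    · simp only [mem_iUnion] at h
      obtain ⟨j, -, hj⟩ := h
      exact zero_notMem_tri hj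
  have hcov' : {((0 : ℂ) : OnePoint ℂ)}ᶜ ⊆ E (Om ∩ u) ∪ E (Om ∩ v) := by
    intro x hx
    by_cases hxO : x ∈ Om
    · exact (hcov hxO).imp (fun h => Or.inl ⟨hxO, h⟩) (fun h => Or.inl ⟨hxO, h⟩)
    · have hxK : x ∈ Omᶜ := hxO
      rw [Om_compl] at hxK
      simp only [mem_union, mem_iUnion] at hxK
      obtain ⟨m, hm, hxm⟩ := hxK.resolve_left hx
      have hsub := (hWc m hm).isPreconnected.subset_or_subset (hO.inter hu) (hO.inter hv) hdis
        (fun y hy => (hcov (hWOm m hm hy)).imp (fun h => ⟨hWOm m hm hy, h⟩)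
          (fun h => ⟨hWOm m hm hy, h⟩))
      exact hsub.imp (fun h => Or.inr (mem_biUnion (show m ∈ {m | 1 ≤ m ∧ _} from ⟨hm, h⟩) hxm))
        (fun h => Or.inr (mem_biUnion (show m ∈ {m | 1 ≤ m ∧ _} from ⟨hm, h⟩) hxm))
  obtain ⟨y, hy⟩ := hne1
  obtain ⟨y', hy'⟩ := hne2
  obtain ⟨x, hx0, hx1, hx2⟩ := h0c (E (Om ∩ u)) (E (Om ∩ v)) (hEo _ (hO.inter hu))
    (hEo _ (hO.inter hv)) hcov' ⟨y, hE0 _ inter_subset_left (Or.inl hy), Or.inl hy⟩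
    ⟨y', hE0 _ inter_subset_left (Or.inl hy'), Or.inl hy'⟩
  by_cases hxO : x ∈ Om
  · have hOE : ∀ A ⊆ Om, x ∈ E A → x ∈ A := by
      rintro A - (h | h)
      · exact h
      · simp only [mem_iUnion] at h
        obtain ⟨j, hj, hxj⟩ := h
        exact absurd hxO (tri_subset hj.1 hxj)
    exact hdis.le_bot ⟨hOE _ inter_subset_left hx1, hOE _ inter_subset_left hx2⟩
  · have hxK : x ∈ Omᶜ := hxO
    rw [Om_compl] at hxK
    rcases hxK with h | h
    · exact hx0 h
    · simp only [mem_iUnion] at h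
      obtain ⟨m, hm, hxm⟩ := h
      obtain ⟨y, hy⟩ := (hWc m hm).nonempty
      exact hdis.le_bot ⟨htri _ inter_subset_left m hm x hxm hx1 hy,
        htri _ inter_subset_left m hm x hxm hx2 hy⟩

end

section

/-! ### Bi-Lipschitz tripods -/

/-- The direction of a leg of the standard tripod. -/
def legDir (j : Fin 3) : ℂ := Complex.exp (Complex.I * (2 * (j : ℕ) * Real.pi / 3))

theorem norm_legDir (j : Fin 3) : ‖legDir j‖ = 1 := by
  rw [legDir, show Complex.I * (2 * (j : ℕ) * Real.pi / 3) =
    ((2 * (j : ℕ) * Real.pi / 3 : ℝ) : ℂ) * Complex.I by push_cast; ring,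
    Complex.norm_exp_ofReal_mul_I]

theorem mem_standardTripod {z : ℂ} :
    z ∈ standardTripod ↔ ∃ j : Fin 3, ∃ s ∈ Icc (0 : ℝ) 1, z = s * legDir j := by
  simp only [standardTripod, mem_iUnion, segment_eq_image, mem_image, smul_zero, zero_add,
    Complex.real_smul, legDir]
  constructor
  · rintro ⟨j, s, hs, rfl⟩; exact ⟨j, s, hs, rfl⟩
  · rintro ⟨j, s, hs, rfl⟩; exact ⟨j, s, hs, rfl⟩

theorem inner_legDir {i j : Fin 3} (hij : i ≠ j) :
    (legDir i).re * (legDir j).re + (legDir i).im * (legDir j).im = -1 / 2 := by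
  have h : ∀ k : Fin 3, legDir k = ((Real.cos (2 * (k : ℕ) * Real.pi / 3) : ℝ) : ℂ) +
      ((Real.sin (2 * (k : ℕ) * Real.pi / 3) : ℝ) : ℂ) * Complex.I := by
    intro k
    rw [legDir, show Complex.I * (2 * (k : ℕ) * Real.pi / 3) =
      ((2 * (k : ℕ) * Real.pi / 3 : ℝ) : ℂ) * Complex.I by push_cast; ring, Complex.exp_mul_I]
    push_cast; rfl
  have hre : ∀ k : Fin 3, (legDir k).re = Real.cos (2 * (k : ℕ) * Real.pi / 3) := fun k => by
    rw [h]
    simp only [Complex.add_re, Complex.ofReal_re, Complex.re_ofReal_mul, Complex.I_re, mul_zero,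
      add_zero]
  have him : ∀ k : Fin 3, (legDir k).im = Real.sin (2 * (k : ℕ) * Real.pi / 3) := fun k => by
    rw [h]
    simp only [Complex.add_im, Complex.ofReal_im, Complex.im_ofReal_mul, Complex.I_im, mul_one,
      zero_add]
  have e1c : Real.cos (2 * Real.pi / 3) = -1 / 2 := by
    rw [show 2 * Real.pi / 3 = Real.pi - Real.pi / 3 by ring, Real.cos_pi_sub, Real.cos_pi_div_three]
    norm_num
  have key : ∀ a b : ℕ, Real.cos (2 * a * Real.pi / 3) * Real.cos (2 * b * Real.pi / 3) +
      Real.sin (2 * a * Real.pi / 3) * Real.sin (2 * b * Real.pi / 3) =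
      Real.cos (2 * ((b : ℝ) - a) * Real.pi / 3) := by
    intro a b
    rw [show 2 * ((b : ℝ) - a) * Real.pi / 3 = 2 * b * Real.pi / 3 - 2 * a * Real.pi / 3 by ring,
      Real.cos_sub]
    ring
  have e2c : Real.cos (2 * 2 * Real.pi / 3) = -1 / 2 := by
    rw [show 2 * 2 * Real.pi / 3 = Real.pi / 3 + Real.pi by ring, Real.cos_add_pi,
      Real.cos_pi_div_three]
    norm_num
  have hcos : ∀ x : ℝ, x = 1 ∨ x = -1 ∨ x = 2 ∨ x = -2 →
      Real.cos (2 * x * Real.pi / 3) = -1 / 2 := by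
    rintro x (rfl | rfl | rfl | rfl)
    · rw [mul_one, e1c]
    · rw [← e1c, ← Real.cos_neg]; congr 1; ring
    · exact e2c
    · rw [← e2c, ← Real.cos_neg]; congr 1; ring
  rw [hre, hre, him, him, key]
  refine hcos _ ?_
  fin_cases i <;> fin_cases j <;> first | exact absurd rfl hij | norm_num

/-- Two legs meet at angle `2 π / 3`, so the squared distance is `s ^ 2 + s' ^ 2 + s s'`. -/
theorem norm_sub_legDir {i j : Fin 3} (hij : i ≠ j) (s s' : ℝ) :
    (s + s') / 2 ≤ ‖(s : ℂ) * legDir i - s' * legDir j‖ := by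
  have hi : (legDir i).re ^ 2 + (legDir i).im ^ 2 = 1 := by
    have := Complex.sq_norm (legDir i)
    rw [norm_legDir, Complex.normSq_apply] at this; linarith
  have hj : (legDir j).re ^ 2 + (legDir j).im ^ 2 = 1 := by
    have := Complex.sq_norm (legDir j)
    rw [norm_legDir, Complex.normSq_apply] at this; linarith
  have hij' := inner_legDir hij
  refine abs_le_of_sq_le_sq' ?_ (norm_nonneg _) |>.2
  rw [Complex.sq_norm, Complex.normSq_apply]
  simp only [Complex.sub_re, Complex.mul_re, Complex.ofReal_re, Complex.ofReal_im, Complex.sub_im,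
    Complex.mul_im, zero_mul, sub_zero, add_zero]
  have : (s * (legDir i).re - s' * (legDir j).re) * (s * (legDir i).re - s' * (legDir j).re) +
      (s * (legDir i).im - s' * (legDir j).im) * (s * (legDir i).im - s' * (legDir j).im) =
      s ^ 2 + s' ^ 2 + s * s' := by
    linear_combination s ^ 2 * hi + s' ^ 2 * hj - 2 * s * s' * hij'
  rw [this]
  nlinarith [sq_nonneg (s - s')]

/-- Three curves with a common starting point whose mutual distances are comparable to those of
the legs of a tripod form a bi-Lipschitz tripod. -/
theorem isBilipschitzTripod_of_legs {L a b c : ℝ} {P : ℂ} (γ : Fin 3 → ℝ → ℂ) (hc : 0 < c)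
    (ha : 0 < a) (hb : 0 ≤ b) (hLa : L⁻¹ ≤ a) (hLb : 2 * b ≤ L) (hP : ∀ j, γ j 0 = P)
    (hup : ∀ j, ∀ s ∈ Icc (0 : ℝ) 1, ∀ s' ∈ Icc (0 : ℝ) 1, ‖γ j s - γ j s'‖ ≤ b * c * |s - s'|)
    (hlo : ∀ j, ∀ s ∈ Icc (0 : ℝ) 1, ∀ s' ∈ Icc (0 : ℝ) 1, a * c * |s - s'| ≤ ‖γ j s - γ j s'‖)
    (hlo2 : ∀ i j, i ≠ j → ∀ s ∈ Icc (0 : ℝ) 1, ∀ s' ∈ Icc (0 : ℝ) 1,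
      a * c * (s + s') ≤ ‖γ i s - γ j s'‖) {T : Set ℂ}
    (hT : T = ⋃ j, γ j '' Icc 0 1) :
    IsBilipschitzTripod L ((fun z : ℂ => (z : OnePoint ℂ)) '' T) := by
  classical
  -- The choice of a leg and a parameter is harmless: only the centre has several representations,
  -- and all curves start at `P`.
  let φ : ℂ → ℂ := fun z => if h : ∃ q : Fin 3 × ℝ, q.2 ∈ Icc (0 : ℝ) 1 ∧
    z = c * (q.2 * legDir q.1) then γ h.choose.1 h.choose.2 else 0
  have hφ : ∀ j, ∀ s ∈ Icc (0 : ℝ) 1, φ (c * (s * legDir j)) = γ j s := by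
    intro j s hs
    have h : ∃ q : Fin 3 × ℝ, q.2 ∈ Icc (0 : ℝ) 1 ∧
      (c : ℂ) * (s * legDir j) = c * (q.2 * legDir q.1) := ⟨(j, s), hs, rfl⟩
    simp only [φ, dif_pos h]
    obtain ⟨h1, h2⟩ := h.choose_spec
    generalize h.choose = q at h1 h2 ⊢
    have h2 := mul_left_cancel₀ (Complex.ofReal_ne_zero.2 hc.ne') h2
    by_cases hij : j = q.1
    · rw [← hij] at h2 ⊢
      have hne : legDir j ≠ 0 := by rw [← norm_pos_iff, norm_legDir]; exact one_pos
      rw [Complex.ofReal_inj.1 (mul_right_cancel₀ hne h2)]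
    · have h3 := norm_sub_legDir hij s q.2
      rw [h2, sub_self, norm_zero] at h3
      have e1 : s = 0 := by linarith [hs.1, h1.1]
      have e2 : q.2 = 0 := by linarith [hs.1, h1.1]
      rw [e1, e2, hP, hP]
  have hL : 0 ≤ L := by linarith
  refine ⟨c, φ, hc, ?_, ?_⟩
  · rintro - ⟨z, hz, rfl⟩ - ⟨w, hw, rfl⟩
    obtain ⟨i, s, hs, rfl⟩ := mem_standardTripod.1 hz
    obtain ⟨j, s', hs', rfl⟩ := mem_standardTripod.1 hw
    dsimp only
    rw [hφ i s hs, hφ j s' hs', ← mul_sub, norm_mul, Complex.norm_real, Real.norm_eq_abs,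
      abs_of_pos hc]
    rcases eq_or_ne i j with rfl | hij
    · rw [← sub_mul, norm_mul, norm_legDir, mul_one, ← Complex.ofReal_sub, Complex.norm_real,
        Real.norm_eq_abs]
      have h1 := hup i s hs s' hs'
      have h2 := hlo i s hs s' hs'
      have h3 : 0 ≤ c * |s - s'| := by positivity
      constructor
      · refine le_trans ?_ h2
        rw [mul_assoc]; gcongr
      · refine h1.trans ?_
        rw [mul_assoc]; gcongr; linarith
    -- On different legs the upper bound goes through the centre and gives `b c (s + s')`. Comparing
    -- `s + s'` with the distance on the standard tripod costs the factor `2` of `hLb`.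
    · have h1 := hup i s hs 0 (by simp)
      have h1' := hup j s' hs' 0 (by simp)
      rw [hP, sub_zero, abs_of_nonneg hs.1] at h1
      rw [hP, sub_zero, abs_of_nonneg hs'.1] at h1'
      have h2 := hlo2 i j hij s hs s' hs'
      have h3 := norm_sub_legDir hij s s'
      have h4 : ‖(s : ℂ) * legDir i - s' * legDir j‖ ≤ s + s' := by
        refine (norm_sub_le _ _).trans ?_
        rw [norm_mul, norm_mul, norm_legDir, norm_legDir, Complex.norm_real, Complex.norm_real,
          Real.norm_eq_abs, Real.norm_eq_abs, abs_of_nonneg hs.1, abs_of_nonneg hs'.1]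
        linarith
      have h5 : ‖γ i s - γ j s'‖ ≤ b * c * (s + s') := by
        have := norm_sub_le_norm_sub_add_norm_sub (γ i s) P (γ j s')
        rw [norm_sub_rev P] at this
        linarith
      constructor
      · refine le_trans ?_ h2
        rw [mul_assoc]
        gcongr
      · refine h5.trans ?_
        have h6 : b * c * (s + s') ≤ b * c * (2 * ‖(s : ℂ) * legDir i - s' * legDir j‖) := by
          gcongr; linarith
        refine h6.trans ?_
        have : b * c * (2 * ‖(s : ℂ) * legDir i - s' * legDir j‖) =
          (2 * b) * (c * ‖(s : ℂ) * legDir i - s' * legDir j‖) := by ring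
        rw [this]; gcongr
  · congr 1
    rw [hT]
    ext w
    simp only [mem_iUnion, mem_image]
    constructor
    · rintro ⟨j, s, hs, rfl⟩
      exact ⟨_, ⟨_, mem_standardTripod.2 ⟨j, s, hs, rfl⟩, rfl⟩, hφ j s hs⟩
    · rintro ⟨-, ⟨z, hz, rfl⟩, rfl⟩
      obtain ⟨j, s, hs, rfl⟩ := mem_standardTripod.1 hz
      exact ⟨j, s, hs, (hφ j s hs).symm⟩

/-- The quasisymmetry constant is the quotient of the upper and lower bi-Lipschitz constants; the
scale `c` cancels. -/
theorem IsBilipschitzTripod.exists_isQuasitripod {L : ℝ} (hL : 0 < L) {p : Set (OnePoint ℂ)}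
    (hp : IsBilipschitzTripod L p) :
    ∃ T : Set ℂ, IsQuasitripod (L ^ 2) T ∧ p = (fun z : ℂ => (z : OnePoint ℂ)) '' T := by
  obtain ⟨c, φ, hc, hφ, rfl⟩ := hp
  refine ⟨_, ⟨fun z => φ (c * z), ?_, ?_⟩, rfl⟩
  · have hb : ∀ z ∈ standardTripod, ∀ w ∈ standardTripod,
        L⁻¹ * (c * ‖z - w‖) ≤ ‖φ (c * z) - φ (c * w)‖ ∧
          ‖φ (c * z) - φ (c * w)‖ ≤ L * (c * ‖z - w‖) := by
      intro z hz w hw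
      have := hφ _ ⟨z, hz, rfl⟩ _ ⟨w, hw, rfl⟩
      dsimp only at this
      rwa [← mul_sub, norm_mul, Complex.norm_real, Real.norm_eq_abs, abs_of_pos hc] at this
    have hinj : InjOn (fun z => φ (c * z)) standardTripod := by
      intro z hz w hw h
      have h1 := (hb z hz w hw).1
      dsimp only at h
      rw [h, sub_self, norm_zero] at h1
      have h2 : 0 < L⁻¹ * c := by positivity
      have h3 : ‖z - w‖ ≤ 0 := by
        by_contra hcon
        push Not at hcon
        nlinarith [mul_pos h2 hcon]
      exact sub_eq_zero.1 (norm_le_zero_iff.1 h3)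
    have himg : φ '' ((fun x : ℂ => (c : ℂ) * x) '' standardTripod) =
        (fun z => φ (c * z)) '' standardTripod := by rw [image_image]
    have hbij : BijOn (fun z => φ (c * z)) standardTripod
        (φ '' ((fun x : ℂ => (c : ℂ) * x) '' standardTripod)) := by
      rw [himg]; exact hinj.bijOn_image
    refine ⟨hbij, ?_, ?_⟩
    · have : LipschitzOnWith (L * c).toNNReal (fun z => φ (c * z)) standardTripod := by
        refine LipschitzOnWith.of_dist_le_mul fun z hz w hw => ?_
        rw [dist_eq_norm, dist_eq_norm, Real.coe_toNNReal _ (by positivity), mul_assoc]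
        exact (hb z hz w hw).2
      exact this.continuousOn
    · have : LipschitzOnWith (L * c⁻¹).toNNReal
          (Function.invFunOn (fun z => φ (c * z)) standardTripod)
          (φ '' ((fun x : ℂ => (c : ℂ) * x) '' standardTripod)) := by
        refine LipschitzOnWith.of_dist_le_mul fun z hz w hw => ?_
        rw [himg] at hz hw
        obtain ⟨z, hz, rfl⟩ := hz
        obtain ⟨w, hw, rfl⟩ := hw
        have e1 := hinj.leftInvOn_invFunOn hz
        have e2 := hinj.leftInvOn_invFunOn hw
        rw [e1, e2, dist_eq_norm, dist_eq_norm, Real.coe_toNNReal _ (by positivity)]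
        have := mul_le_mul_of_nonneg_left (hb z hz w hw).1 (by positivity : 0 ≤ L * c⁻¹)
        refine le_trans (le_of_eq ?_) this
        field_simp
      exact this.continuousOn
  · intro z₁ h₁ z₂ h₂ z₃ h₃ hle
    have a1 := (hφ _ ⟨z₂, h₂, rfl⟩ _ ⟨z₁, h₁, rfl⟩).2
    have a2 := (hφ _ ⟨z₃, h₃, rfl⟩ _ ⟨z₁, h₁, rfl⟩).1
    dsimp only at a1 a2
    rw [← mul_sub, norm_mul] at a1 a2
    calc ‖φ (c * z₂) - φ (c * z₁)‖ ≤ L * (‖(c : ℂ)‖ * ‖z₂ - z₁‖) := a1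
      _ ≤ L * (‖(c : ℂ)‖ * ‖z₃ - z₁‖) := by gcongr
      _ = L ^ 2 * (L⁻¹ * (‖(c : ℂ)‖ * ‖z₃ - z₁‖)) := by field_simp
      _ ≤ L ^ 2 * ‖φ (c * z₃) - φ (c * z₁)‖ := by gcongr

/-! ### Distances in polar coordinates and the shape of the tripods. -/

theorem norm_pol_sub_pol (t φ ψ : ℝ) :
    ‖pol t φ - pol t ψ‖ = Real.exp (-t) * |2 * Real.sin ((φ - ψ) / 2)| := by
  have : pol t φ - pol t ψ = Real.exp (-t) * (Complex.exp (ψ * Complex.I) *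
      (Complex.exp (Complex.I * ((φ - ψ : ℝ) : ℂ)) - 1)) := by
    rw [mul_sub, ← Complex.exp_add, mul_one, pol, pol, mul_sub]
    congr 3
    push_cast; ring
  rw [this, norm_mul, norm_mul, Complex.norm_exp_ofReal_mul_I, one_mul,
    Complex.norm_exp_I_mul_ofReal_sub_one, Complex.norm_real, Real.norm_eq_abs,
    abs_of_pos (Real.exp_pos _), Real.norm_eq_abs]

theorem norm_pol_sub_pol_le (t φ ψ : ℝ) : ‖pol t φ - pol t ψ‖ ≤ Real.exp (-t) * |φ - ψ| := by
  rw [norm_pol_sub_pol]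
  refine mul_le_mul_of_nonneg_left ?_ (Real.exp_pos _).le
  have := Real.abs_sin_le_abs (x := (φ - ψ) / 2)
  rw [abs_div, abs_of_pos (by norm_num : (0 : ℝ) < 2)] at this
  rw [abs_mul, abs_of_pos (by norm_num : (0 : ℝ) < 2)]
  linarith

theorem le_norm_pol_sub_pol {t φ ψ : ℝ} (h : |φ - ψ| ≤ 1) :
    Real.exp (-t) * (|φ - ψ| / 2) ≤ ‖pol t φ - pol t ψ‖ := by
  rw [norm_pol_sub_pol]
  gcongr
  have key : ∀ x : ℝ, 0 ≤ x → x ≤ 1 → x / 2 ≤ |2 * Real.sin (x / 2)| := by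
    intro x h0 h1
    have h2 := Real.mul_le_sin (x := x / 2) (by linarith) (by linarith [Real.pi_gt_three])
    have h3 : 1 / 2 ≤ 2 / Real.pi := by
      rw [div_le_div_iff₀ (by norm_num) Real.pi_pos]; linarith [Real.pi_le_four]
    refine le_trans ?_ (le_abs_self _)
    nlinarith
  rcases le_total 0 (φ - ψ) with h0 | h0
  · rw [abs_of_nonneg h0] at h ⊢
    exact key _ h0 h
  · rw [abs_of_nonpos h0] at h ⊢
    have := key _ (by linarith) h
    rwa [neg_div (2 : ℝ) (φ - ψ), Real.sin_neg, mul_neg, abs_neg, ← neg_div] at this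

theorem le_norm_pol_sub_pol' (t t' φ φ' : ℝ) :
    |Real.exp (-t) - Real.exp (-t')| ≤ ‖pol t φ - pol t' φ'‖ := by
  have := abs_norm_sub_norm_le (pol t φ) (pol t' φ')
  rwa [norm_pol, norm_pol] at this

/-- The constant is `1` for the radial change plus the Lipschitz constant `3 / 2` of the angle,
since `exp (-t) * (t - t')` is at most the change of radius. -/
theorem norm_leg_sub_leg_le (m : ℕ) (t t' : ℝ) :
    ‖pol t (ang m t) - pol t' (ang m t')‖ ≤ 5 / 2 * |Real.exp (-t) - Real.exp (-t')| := by
  wlog h : t' ≤ t generalizing t t'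
  · rw [norm_sub_rev, abs_sub_comm]
    exact this t' t (by linarith)
  have h1 : ‖pol t (ang m t) - pol t (ang m t')‖ ≤ Real.exp (-t) * (3 / 2 * (t - t')) := by
    refine (norm_pol_sub_pol_le _ _ _).trans ?_
    gcongr
    have := ang_lipschitz m t t'
    rwa [abs_of_nonneg (by linarith : 0 ≤ t - t')] at this
  have h2 : ‖pol t (ang m t') - pol t' (ang m t')‖ = |Real.exp (-t) - Real.exp (-t')| := by
    rw [pol, pol, ← sub_mul, norm_mul, Complex.norm_exp_ofReal_mul_I, mul_one,
      ← Complex.ofReal_sub, Complex.norm_real, Real.norm_eq_abs]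
  have h3 : Real.exp (-t) * (t - t') ≤ Real.exp (-t') - Real.exp (-t) := by
    have := mul_le_mul_of_nonneg_left (Real.add_one_le_exp (t - t')) (Real.exp_pos (-t)).le
    rw [← Real.exp_add, show -t + (t - t') = -t' by ring] at this
    linarith
  have h4 := neg_le_abs (Real.exp (-t) - Real.exp (-t'))
  have h5 := norm_sub_le_norm_sub_add_norm_sub (pol t (ang m t)) (pol t (ang m t'))
    (pol t' (ang m t'))
  linarith

/-- The relative length of the long leg of the tripod `m`. -/
def legLength (m : ℕ) : ℝ := 1 - Real.exp (-(3 * m))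

theorem legLength_bounds {m : ℕ} (hm : 1 ≤ m) : 1 / 2 ≤ legLength m ∧ legLength m < 1 := by
  have hm' : (1 : ℝ) ≤ m := by exact_mod_cast hm
  have h1 := Real.add_one_le_exp (3 * m : ℝ)
  have h2 := Real.exp_pos (-(3 * m : ℝ))
  have h3 : Real.exp (-(3 * m : ℝ)) ≤ 1 / 2 := by
    rw [Real.exp_neg, inv_le_comm₀ (Real.exp_pos _) (by norm_num)]
    norm_num
    linarith
  constructor <;> unfold legLength <;> linarith

/-- The parameter of a point of the long leg of the tripod `m`. -/
def legTime (m : ℕ) (s : ℝ) : ℝ := m - Real.log (1 - legLength m * s)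

/-- The parametrisation makes the radius affine in `s`, so radial differences along the leg are
exact multiples of `|s - s'|`. -/
theorem exp_neg_legTime {m : ℕ} (hm : 1 ≤ m) {s : ℝ} (hs : s ∈ Icc (0 : ℝ) 1) :
    Real.exp (-legTime m s) = Real.exp (-m) * (1 - legLength m * s) := by
  have h := legLength_bounds hm
  have : 0 < 1 - legLength m * s := by nlinarith [hs.1, hs.2]
  rw [legTime, neg_sub, sub_eq_add_neg, Real.exp_add, Real.exp_log this, mul_comm]

theorem image_leg {m : ℕ} (hm : 1 ≤ m) :
    (fun s => pol (legTime m s) (ang m (legTime m s))) '' Icc 0 1 =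
      (fun t => pol t (ang m t)) '' Icc (m : ℝ) (4 * m) := by
  have h := legLength_bounds hm
  ext z
  constructor
  · rintro ⟨s, hs, rfl⟩
    refine ⟨legTime m s, ?_, rfl⟩
    have e := exp_neg_legTime hm hs
    constructor
    · rw [← neg_le_neg_iff, ← Real.exp_le_exp, e]
      nlinarith [Real.exp_pos (-(m : ℝ)), hs.1, hs.2, mul_nonneg (by linarith : 0 ≤ legLength m) hs.1]
    · rw [← neg_le_neg_iff, ← Real.exp_le_exp, e, show -(4 * m : ℝ) = -m + -(3 * m) by ring,
        Real.exp_add]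
      refine mul_le_mul_of_nonneg_left ?_ (Real.exp_pos _).le
      have : Real.exp (-(3 * m : ℝ)) = 1 - legLength m := by unfold legLength; ring
      rw [this]
      nlinarith [hs.2]
  · rintro ⟨t, ht, rfl⟩
    have hs : (1 - Real.exp (m - t)) / legLength m ∈ Icc (0 : ℝ) 1 := by
      constructor
      · refine div_nonneg ?_ (by linarith)
        rw [sub_nonneg, Real.exp_le_one_iff]; linarith [ht.1]
      · rw [div_le_one (by linarith), legLength]
        have : Real.exp (-(3 * m : ℝ)) ≤ Real.exp (m - t) := Real.exp_le_exp.2 (by linarith [ht.2])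
        linarith
    refine ⟨_, hs, ?_⟩
    have : legTime m ((1 - Real.exp (m - t)) / legLength m) = t := by
      rw [legTime, mul_div_cancel₀ _ (by linarith), sub_sub_cancel, Real.log_exp]
      ring
    simp only [this]

/-- The three legs are the two halves of the head and the long leg, all of size comparable to `exp
(-m)`. They leave the branch point in tangential and radial directions, which gives the lower
bounds. -/
theorem isBilipschitzTripod_tri {m : ℕ} (hm : 1 ≤ m) : IsBilipschitzTripod (10 ^ 6) (tri m) := by
  have hκ := legLength_bounds hm
  set κ := legLength m
  set c := Real.exp (-(m : ℝ)) with hc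
  have hcp : 0 < c := Real.exp_pos _
  -- a head and the leg, with the sign `σ`
  let A : ℝ → ℝ → ℂ := fun σ s => pol m (label m + σ * s / 4)
  let B : ℝ → ℂ := fun s => pol (legTime m s) (ang m (legTime m s))
  have hB0 : B 0 = pol m (label m) := by simp [B, legTime, ang_self]
  have hA0 : ∀ σ, A σ 0 = pol m (label m) := fun σ => by simp [A]
  have hAA : ∀ σ σ' s s', ‖A σ s - A σ' s'‖ ≤ c * (|σ * s - σ' * s'| / 4) := by
    intro σ σ' s s'
    refine (norm_pol_sub_pol_le _ _ _).trans (le_of_eq ?_)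
    rw [show label m + σ * s / 4 - (label m + σ' * s' / 4) = (σ * s - σ' * s') / 4 by ring, abs_div,
      abs_of_pos (by norm_num : (0 : ℝ) < 4)]
  have hAA' : ∀ σ σ' s s', |σ * s - σ' * s'| ≤ 2 →
      c * (|σ * s - σ' * s'| / 8) ≤ ‖A σ s - A σ' s'‖ := by
    intro σ σ' s s' h
    have e : |label m + σ * s / 4 - (label m + σ' * s' / 4)| = |σ * s - σ' * s'| / 4 := by
      rw [show label m + σ * s / 4 - (label m + σ' * s' / 4) = (σ * s - σ' * s') / 4 by ring,
        abs_div, abs_of_pos (by norm_num : (0 : ℝ) < 4)]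
    have := le_norm_pol_sub_pol (t := m) (φ := label m + σ * s / 4) (ψ := label m + σ' * s' / 4)
      (by rw [e]; linarith)
    rw [e] at this
    refine le_trans (le_of_eq ?_) this
    ring
  have hexp : ∀ s ∈ Icc (0 : ℝ) 1, ∀ s' ∈ Icc (0 : ℝ) 1,
      |Real.exp (-legTime m s) - Real.exp (-legTime m s')| = c * κ * |s - s'| := by
    intro s hs s' hs'
    rw [exp_neg_legTime hm hs, exp_neg_legTime hm hs', show c * (1 - κ * s) - c * (1 - κ * s') =
      -(c * κ * (s - s')) by ring, abs_neg, abs_mul, abs_of_pos (mul_pos hcp (by linarith))]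
  have hBB : ∀ s ∈ Icc (0 : ℝ) 1, ∀ s' ∈ Icc (0 : ℝ) 1,
      ‖B s - B s'‖ ≤ 5 / 2 * (c * κ * |s - s'|) := by
    intro s hs s' hs'
    rw [← hexp s hs s' hs']
    exact norm_leg_sub_leg_le _ _ _
  have hBB' : ∀ s ∈ Icc (0 : ℝ) 1, ∀ s' ∈ Icc (0 : ℝ) 1, c * κ * |s - s'| ≤ ‖B s - B s'‖ := by
    intro s hs s' hs'
    rw [← hexp s hs s' hs']
    exact le_norm_pol_sub_pol' _ _ _ _
  -- Let `d` be the distance. The radii give `c s' ≤ 2 d`; the triangle inequality through the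
  -- branch point gives `c s / 8 ≤ d + 5 / 2 * d`, that is `c s ≤ 28 d`. The sum is the constant
  -- `30`.
  have hAB : ∀ σ, |σ| = 1 → ∀ s ∈ Icc (0 : ℝ) 1, ∀ s' ∈ Icc (0 : ℝ) 1,
      1 / 30 * c * (s + s') ≤ ‖A σ s - B s'‖ := by
    intro σ hσ s hs s' hs'
    have h1 : c * κ * s' ≤ ‖A σ s - B s'‖ := by
      have := le_norm_pol_sub_pol' m (legTime m s') (label m + σ * s / 4) (ang m (legTime m s'))
      refine le_trans (le_of_eq ?_) this
      rw [exp_neg_legTime hm hs', show Real.exp (-(m : ℝ)) - Real.exp (-m) * (1 - κ * s') =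
        c * κ * s' by ring, abs_of_nonneg]
      exact mul_nonneg (mul_nonneg hcp.le (by linarith)) hs'.1
    have h2 := hBB 0 (by simp) s' hs'
    have h3 := hAA' σ σ s 0 (by rw [mul_zero, sub_zero, abs_mul, hσ, one_mul, abs_of_nonneg hs.1];
                                linarith [hs.2])
    rw [mul_zero, sub_zero, abs_mul, hσ, one_mul, abs_of_nonneg hs.1, hA0] at h3
    rw [zero_sub, abs_neg, abs_of_nonneg hs'.1, hB0] at h2
    have h4 := norm_sub_le_norm_sub_add_norm_sub (A σ s) (B s') (pol m (label m))
    rw [norm_sub_rev (B s')] at h4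
    have h5 : c * s' ≤ 2 * (c * κ * s') := by nlinarith [mul_nonneg hcp.le hs'.1]
    have h6 : 0 ≤ ‖A σ s - B s'‖ := norm_nonneg _
    linarith
  have hκ1 : ∀ s s' : ℝ, 1 / 30 * c * |s - s'| ≤ c * κ * |s - s'| := by
    intro s s'
    have : 0 ≤ c * |s - s'| := by positivity
    nlinarith
  have hκ2 : ∀ s s' : ℝ, 5 / 2 * (c * κ * |s - s'|) ≤ 5 / 2 * c * |s - s'| := by
    intro s s'
    have : 0 ≤ c * |s - s'| := by positivity
    nlinarith
  have hup : ∀ σ : ℝ, |σ| = 1 → ∀ s s' : ℝ, ‖A σ s - A σ s'‖ ≤ 5 / 2 * c * |s - s'| := by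
    intro σ hσ s s'
    refine (hAA σ σ s s').trans ?_
    rw [← mul_sub, abs_mul, hσ, one_mul]
    nlinarith [mul_nonneg hcp.le (abs_nonneg (s - s'))]
  have hlo : ∀ σ : ℝ, |σ| = 1 → ∀ s ∈ Icc (0 : ℝ) 1, ∀ s' ∈ Icc (0 : ℝ) 1,
      1 / 30 * c * |s - s'| ≤ ‖A σ s - A σ s'‖ := by
    intro σ hσ s hs s' hs'
    have e : |σ * s - σ * s'| = |s - s'| := by rw [← mul_sub, abs_mul, hσ, one_mul]
    have h := hAA' σ σ s s' (by rw [e, abs_le]; constructor <;> linarith [hs.1, hs.2, hs'.1, hs'.2])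
    rw [e] at h
    nlinarith [mul_nonneg hcp.le (abs_nonneg (s - s'))]
  have hpm : ∀ σ σ' : ℝ, |σ| = 1 → σ' = -σ → ∀ s ∈ Icc (0 : ℝ) 1, ∀ s' ∈ Icc (0 : ℝ) 1,
      1 / 30 * c * (s + s') ≤ ‖A σ s - A σ' s'‖ := by
    rintro σ - hσ rfl s hs s' hs'
    have e : |σ * s - -σ * s'| = s + s' := by
      rw [show σ * s - -σ * s' = σ * (s + s') by ring, abs_mul, hσ, one_mul,
        abs_of_nonneg (by linarith [hs.1, hs'.1])]
    have h := hAA' σ (-σ) s s' (by rw [e]; linarith [hs.2, hs'.2])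
    rw [e] at h
    nlinarith [mul_nonneg hcp.le (by linarith [hs.1, hs'.1] : 0 ≤ s + s')]
  refine isBilipschitzTripod_of_legs (a := 1 / 30) (b := 5 / 2) (c := c) (P := pol m (label m))
    ![A 1, A (-1), B] hcp (by norm_num) (by norm_num) (by norm_num) (by norm_num) ?_ ?_ ?_ ?_ ?_
  · intro j; fin_cases j
    exacts [hA0 _, hA0 _, hB0]
  · intro j s hs s' hs'; fin_cases j
    exacts [hup 1 (by norm_num) s s', hup (-1) (by norm_num) s s',
      (hBB s hs s' hs').trans (hκ2 s s')]
  · intro j s hs s' hs'; fin_cases j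
    exacts [hlo 1 (by norm_num) s hs s' hs', hlo (-1) (by norm_num) s hs s' hs',
      (hκ1 s s').trans (hBB' s hs s' hs')]
  · intro i j hij s hs s' hs'
    have hBA : ∀ σ, |σ| = 1 → 1 / 30 * c * (s + s') ≤ ‖B s - A σ s'‖ := fun σ hσ => by
      rw [norm_sub_rev, add_comm]; exact hAB σ hσ s' hs' s hs
    fin_cases i <;> fin_cases j <;> first | exact absurd rfl hij | skip
    exacts [hpm 1 (-1) (by norm_num) rfl s hs s' hs', hAB 1 (by norm_num) s hs s' hs',
      hpm (-1) 1 (by norm_num) (by norm_num) s hs s' hs', hAB (-1) (by norm_num) s hs s' hs',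
      hBA 1 (by norm_num), hBA (-1) (by norm_num)]
  · rw [tripod_eq, ← image_leg hm]
    ext z
    simp only [mem_union, mem_iUnion, Fin.exists_fin_succ, IsEmpty.exists_iff, or_false]
    have hh : z ∈ (fun φ => pol m φ) '' Icc (label m - 1 / 4) (label m + 1 / 4) ↔
        z ∈ A 1 '' Icc 0 1 ∨ z ∈ A (-1) '' Icc 0 1 := by
      constructor
      · rintro ⟨φ, hφ, rfl⟩
        rcases le_total (label m) φ with h | h
        · exact Or.inl ⟨4 * (φ - label m), ⟨by linarith, by linarith [hφ.2]⟩, by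
            simp only [A]; congr 1; ring⟩
        · exact Or.inr ⟨4 * (label m - φ), ⟨by linarith, by linarith [hφ.1]⟩, by
            simp only [A]; congr 1; ring⟩
      · rintro (⟨s, hs, rfl⟩ | ⟨s, hs, rfl⟩)
        · exact ⟨_, ⟨by linarith [hs.1, hs.2], by linarith [hs.1, hs.2]⟩, rfl⟩
        · exact ⟨_, ⟨by linarith [hs.1, hs.2], by linarith [hs.1, hs.2]⟩, rfl⟩
    rw [hh]
    change z ∈ B '' Icc 0 1 ∨ _ ↔ z ∈ A 1 '' Icc 0 1 ∨ z ∈ A (-1) '' Icc 0 1 ∨ z ∈ B '' Icc 0 1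
    tauto

/-! ### The non-trivial components -/

theorem planeDiam_image_coe (T : Set ℂ) :
    planeDiam ((fun z : ℂ => (z : OnePoint ℂ)) '' T) = Metric.ediam T := by
  rw [planeDiam, preimage_image_eq _ OnePoint.coe_injective]

theorem planeDiam_tri {m : ℕ} {r : ℝ} (hr : r ≤ Real.exp (-m) * legLength m) :
    ENNReal.ofReal r ≤ planeDiam (tri m) := by
  rw [tri, planeDiam_image_coe]
  have h1 : pol m (ang m m) ∈ tripod m := by
    rw [tripod_eq]
    exact Or.inl ⟨m, ⟨le_rfl, by linarith [(Nat.cast_nonneg m : (0 : ℝ) ≤ m)]⟩, rfl⟩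
  have h2 : pol (4 * m) (ang m (4 * m)) ∈ tripod m := by
    rw [tripod_eq]
    exact Or.inl ⟨4 * m, ⟨by linarith [(Nat.cast_nonneg m : (0 : ℝ) ≤ m)], le_rfl⟩, rfl⟩
  refine le_trans ?_ (Metric.edist_le_ediam_of_mem h1 h2)
  rw [edist_dist, dist_eq_norm]
  refine ENNReal.ofReal_le_ofReal (hr.trans (le_trans ?_ (le_norm_pol_sub_pol' _ _ _ _)))
  refine le_trans (le_of_eq ?_) (le_abs_self _)
  rw [legLength, mul_sub, mul_one, ← Real.exp_add]
  congr 2; ring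

theorem planeDiam_tri_pos {m : ℕ} (hm : 1 ≤ m) : 0 < planeDiam (tri m) :=
  (ENNReal.ofReal_pos.2 (mul_pos (Real.exp_pos _) (by linarith [(legLength_bounds hm).1]))).trans_le
    (planeDiam_tri le_rfl)

theorem planeDiam_zero : planeDiam {((0 : ℂ) : OnePoint ℂ)} = 0 := by
  have : {((0 : ℂ) : OnePoint ℂ)} = (fun z : ℂ => (z : OnePoint ℂ)) '' {0} := by
    rw [image_singleton]
  rw [this, planeDiam_image_coe, Metric.ediam_singleton]

theorem nonpointComponents_Om : nonpointComponents Om = tri '' Ici 1 := by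
  ext p
  simp only [nonpointComponents, mem_ofPred_eq, complComponents_Om]
  constructor
  · rintro ⟨rfl | h, h2⟩
    · rw [planeDiam_zero] at h2; exact absurd h2 (lt_irrefl _)
    · exact h
  · rintro ⟨m, hm, rfl⟩
    exact ⟨Or.inr ⟨m, hm, rfl⟩, planeDiam_tri_pos hm⟩

theorem pointComponents_Om : pointComponents Om = {{((0 : ℂ) : OnePoint ℂ)}} := by
  ext p
  simp only [pointComponents, mem_ofPred_eq, complComponents_Om, mem_singleton_iff]
  constructor
  · rintro ⟨rfl | ⟨m, hm, rfl⟩, h2⟩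
    · rfl
    · exact absurd (planeDiam_tri_pos hm) h2
  · rintro rfl
    exact ⟨Or.inl rfl, by rw [planeDiam_zero]; exact lt_irrefl _⟩

theorem quasitripodCondition_Om : QuasitripodCondition (10 ^ 12) Om := by
  intro p hp
  rw [nonpointComponents_Om] at hp
  obtain ⟨m, hm, rfl⟩ := hp
  obtain ⟨T, hT, hTm⟩ := (isBilipschitzTripod_tri hm).exists_isQuasitripod (by norm_num)
  rw [show ((10 : ℝ) ^ 6) ^ 2 = 10 ^ 12 by norm_num] at hT
  refine ⟨T, hT, hTm.ge, ?_⟩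
  rw [hTm, planeDiam_image_coe]
  refine ENNReal.div_le_of_le_mul ?_
  refine le_mul_of_one_le_right' ?_
  rw [ENNReal.one_le_ofReal]
  norm_num

/-- The `N + 1` tripods with `N + 1 ≤ j < 2 (N + 1)` all have diameter at least `exp (-2 (N + 1))`,
and their legs end at radius `exp (-4 j)`, inside the disk of that radius. -/
theorem not_packingCondition_Om (N : ℕ) : ¬ PackingCondition N Om := by
  intro h
  specialize h 0 (Real.exp (-(2 * (N + 1 : ℕ)))) (Real.exp_pos _)
  have hsub : tri '' (Finset.Ico (N + 1) (2 * (N + 1)) : Finset ℕ) ⊆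
      {p | p ∈ nonpointComponents Om ∧
        ENNReal.ofReal (Real.exp (-(2 * (N + 1 : ℕ)))) ≤ planeDiam p ∧
      (p ∩ (fun z : ℂ => (z : OnePoint ℂ)) ''
        Metric.ball 0 (Real.exp (-(2 * (N + 1 : ℕ))))).Nonempty} := by
    rintro - ⟨j, hj, rfl⟩
    rw [Finset.mem_coe, Finset.mem_Ico] at hj
    have hj1 : 1 ≤ j := by omega
    have hjr : (N + 1 : ℕ) ≤ (j : ℝ) := by exact_mod_cast hj.1
    have hjr2 : (j : ℝ) + 1 ≤ 2 * (N + 1 : ℕ) := by exact_mod_cast hj.2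
    refine ⟨?_, planeDiam_tri ?_, ?_⟩
    · rw [nonpointComponents_Om]; exact ⟨j, hj1, rfl⟩
    · have h1 : Real.exp (-(2 * (N + 1 : ℕ))) ≤ Real.exp (-j) * Real.exp (-1) := by
        rw [← Real.exp_add, Real.exp_le_exp]; linarith
      have h2 : Real.exp (-1) ≤ 1 / 2 := by
        rw [Real.exp_neg, inv_le_comm₀ (Real.exp_pos _) (by norm_num)]
        linarith [Real.add_one_le_exp (1 : ℝ)]
      have h3 := (legLength_bounds hj1).1
      exact h1.trans (mul_le_mul_of_nonneg_left (h2.trans h3) (Real.exp_pos _).le)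
    · refine ⟨_, ⟨pol (4 * j) (ang j (4 * j)), ?_, rfl⟩, ⟨_, ?_, rfl⟩⟩
      · rw [tripod_eq]
        exact Or.inl ⟨4 * j, ⟨by linarith [(Nat.cast_nonneg j : (0 : ℝ) ≤ j)], le_rfl⟩, rfl⟩
      · rw [mem_ball_zero_iff, norm_pol, Real.exp_lt_exp]
        have : (0 : ℝ) < (N + 1 : ℕ) := by positivity
        linarith
  have hinj : InjOn tri (Finset.Ico (N + 1) (2 * (N + 1)) : Finset ℕ) := by
    intro i hi j hj hij
    rw [Finset.mem_coe, Finset.mem_Ico] at hi hj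
    by_contra hne
    have hd := disjoint_tri (by omega) (by omega) hne
    rw [hij, disjoint_self] at hd
    exact (isConnected_tri j).nonempty.ne_empty hd
  have h2 := (encard_le_encard hsub).trans h
  rw [hinj.encard_image, encard_coe_eq_coe_finsetCard, Nat.card_Ico] at h2
  have : 2 * (N + 1) - (N + 1) ≤ N := by exact_mod_cast h2
  omega

end

section

/-! ### Cheap rays of the tree -/

open MeasureTheory

/-- The open interval of angles between the long legs of two tripods. -/
def gap (m c : ℕ) : Set ℝ := Ioo (min (label m) (label c)) (max (label m) (label c))

/-- The trace of a domain in the finite plane. -/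
def planePart (G : Set (OnePoint ℂ)) : Set ℂ := (fun z : ℂ => (z : OnePoint ℂ)) ⁻¹' G

/-- The line integral of `ρ` over the arc of radius `exp (-t)` between two tripods. -/
def arcCost (ρ : ℂ → ℝ≥0∞) (m c : ℕ) (t : ℝ) : ℝ≥0∞ :=
  ∫⁻ φ in gap m c, ρ (pol t φ) * ENNReal.ofReal (Real.exp (-t))

theorem gap_subset {m c : ℕ} (hm : 1 ≤ m) (hc : 1 ≤ c) : gap m c ⊆ Ioo 0 1 := by
  rintro φ ⟨h1, h2⟩
  exact ⟨(le_min (label_pos hm).le (label_pos hc).le).trans_lt h1,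
    h2.trans_le (max_le label_lt_one.le label_lt_one.le)⟩

/-- At these radii only tripods of index at most `2 m + 1` can occur, there are no heads, and legs
sit at their labels. None of these labels lies strictly between those of `m` and its child. -/
theorem pol_mem_Om {m c : ℕ} (hm : 1 ≤ m) (hc : c = 2 * m ∨ c = 2 * m + 1) {t φ : ℝ}
    (ht : t ∈ Icc ((2 * m + 1 : ℕ) + 1 / 3 : ℝ) ((2 * m + 1 : ℕ) + 2 / 3)) (hφ : φ ∈ gap m c) :
    ((pol t φ : ℂ) : OnePoint ℂ) ∈ Om := by
  rw [coe_mem_Om]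
  refine ⟨pol_ne_zero _ _, fun j hj h => ?_⟩
  have hφ1 := gap_subset hm (by omega) hφ
  have hpi := Real.pi_gt_three
  rw [mem_tripod_iff hj ⟨by linarith [hφ1.1], by linarith [hφ1.2]⟩] at h
  have hjt : (j : ℝ) ≤ t := by
    rcases h with h | h
    · exact h.1
    · exact h.1.ge
  have hj2 : j ≤ 2 * m + 1 := by
    have : (j : ℝ) < (2 * m + 1 : ℕ) + 1 := by linarith [ht.2]
    exact_mod_cast Nat.lt_succ_iff.1 (by exact_mod_cast this)
  rcases h with ⟨-, -, rfl⟩ | ⟨rfl, -⟩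
  · rw [ang_of_fract ht.1 ht.2] at hφ
    obtain ⟨h1, h2⟩ := label_notMem_between hm hc hj2
    rcases le_total (label m) (label c) with hle | hle
    · rw [gap, min_eq_left hle, max_eq_right hle] at hφ; exact h1 hφ
    · rw [gap, min_eq_right hle, max_eq_left hle] at hφ; exact h2 hφ
  · have : (j : ℝ) ≤ (2 * m + 1 : ℕ) := by exact_mod_cast hj2
    linarith [ht.1]

theorem volume_gap {m c : ℕ} (hm : 1 ≤ m) (hc : c = 2 * m ∨ c = 2 * m + 1) :
    volume (gap m c) = ENNReal.ofReal (1 / 2 ^ (Nat.log 2 m + 2)) := by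
  rw [gap, Real.volume_Ioo, max_sub_min_eq_abs, abs_label_sub_child hm hc]

/-- Plays the role of the Cauchy–Schwarz inequality: costs are traded for energy, with a free
parameter `θ` chosen level by level. -/
theorem le_add_sq_div (x θ : ℝ≥0∞) (h0 : θ ≠ 0) (h1 : θ ≠ ⊤) : x ≤ θ + x ^ 2 / θ := by
  rcases le_total x θ with h | h
  · exact h.trans le_self_add
  · refine le_add_left ?_
    rw [ENNReal.le_div_iff_mul_le (Or.inl h0) (Or.inl h1), sq]
    gcongr

theorem lintegral_polar_le {ρ : ℂ → ℝ≥0∞} (hρ : Measurable ρ) {J I : Set ℝ} {S : Set ℂ}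
    (hJ : MeasurableSet J) (hI : MeasurableSet I) (hS : MeasurableSet S) (hJ0 : J ⊆ Ioi 0)
    (hIπ : I ⊆ Ioo (-Real.pi) Real.pi)
    (hsub : ∀ r ∈ J, ∀ φ ∈ I, (r : ℂ) * Complex.exp (φ * Complex.I) ∈ S) :
    ∫⁻ r in J, ENNReal.ofReal r * ∫⁻ φ in I, ρ (r * Complex.exp (φ * Complex.I)) ≤
      ∫⁻ z in S, ρ z := by
  have hpol : ∀ p : ℝ × ℝ, Complex.polarCoord.symm p = (p.1 : ℂ) * Complex.exp (p.2 * Complex.I) := by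
    intro p
    rw [Complex.polarCoord_symm_apply, Complex.exp_mul_I]
    push_cast; rfl
  have hmeas : Measurable fun p : ℝ × ℝ => ρ ((p.1 : ℂ) * Complex.exp (p.2 * Complex.I)) :=
    hρ.comp (by fun_prop)
  calc ∫⁻ r in J, ENNReal.ofReal r * ∫⁻ φ in I, ρ (r * Complex.exp (φ * Complex.I))
      = ∫⁻ r in J, ∫⁻ φ in I, ENNReal.ofReal r * ρ (r * Complex.exp (φ * Complex.I)) := by
        refine lintegral_congr fun r => ?_
        rw [lintegral_const_mul]
        exact hρ.comp (by fun_prop)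
    _ = ∫⁻ p in J ×ˢ I, ENNReal.ofReal p.1 * ρ ((p.1 : ℂ) * Complex.exp (p.2 * Complex.I)) := by
        rw [Measure.volume_eq_prod, setLIntegral_prod]
        exact (Measurable.mul (by fun_prop) hmeas).aemeasurable
    _ = ∫⁻ p in J ×ˢ I, ENNReal.ofReal p.1 •
          S.indicator ρ (Complex.polarCoord.symm p) := by
        refine setLIntegral_congr_fun (hJ.prod hI) fun p hp => ?_
        simp only [hpol, indicator_of_mem (hsub p.1 hp.1 p.2 hp.2), smul_eq_mul]
    _ ≤ ∫⁻ p in polarCoord.target, ENNReal.ofReal p.1 •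
          S.indicator ρ (Complex.polarCoord.symm p) := by
        refine lintegral_mono_set ?_
        rw [polarCoord_target]
        exact prod_mono hJ0 hIπ
    _ = ∫⁻ z in S, ρ z := by
        rw [Complex.lintegral_comp_polarCoord_symm, lintegral_indicator hS]

theorem measurableSet_planePart {G : Set (OnePoint ℂ)} (hG : IsOpen G) :
    MeasurableSet (planePart G) := (hG.preimage OnePoint.continuous_coe).measurableSet

/-- Between a tripod and one of its children there is a cheap arc. -/
theorem exists_cheap_arc {ρ : ℂ → ℝ≥0∞} (hρ : Measurable ρ) {ε : ℝ≥0∞}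
    (hE : ∫⁻ z in planePart Om, ρ z ^ 2 ≤ ε) {m c : ℕ} (hm : 1 ≤ m)
    (hc : c = 2 * m ∨ c = 2 * m + 1) {θ : ℝ≥0∞} (h0 : θ ≠ 0) (h1 : θ ≠ ⊤) :
    ∃ t ∈ Icc ((2 * m + 1 : ℕ) + 1 / 3 : ℝ) ((2 * m + 1 : ℕ) + 2 / 3),
      arcCost ρ m c t ≤ θ * ENNReal.ofReal (1 / 2 ^ (Nat.log 2 m + 2)) + 4 * ε / θ := by
  set t₁ : ℝ := (2 * m + 1 : ℕ) + 1 / 3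
  set t₂ : ℝ := (2 * m + 1 : ℕ) + 2 / 3 with ht₂
  have ht12 : t₂ = t₁ + 1 / 3 := by simp only [t₁, t₂]; ring
  set J : Set ℝ := Icc (Real.exp (-t₂)) (Real.exp (-t₁))
  have hJpos : ∀ r ∈ J, 0 < r := fun r hr => (Real.exp_pos _).trans_le hr.1
  -- The radii range over a factor `exp (1 / 3) ≥ 4 / 3`, so the length of `J` is at least a quarter
  -- of its right end point. This is the `4` in the estimate.
  have hlen : Real.exp (-t₁) ≤ 4 * (Real.exp (-t₁) - Real.exp (-t₂)) := by
    have e : Real.exp (-t₁) = Real.exp (-t₂) * Real.exp (1 / 3) := by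
      rw [← Real.exp_add, ht12]; congr 1; ring
    have := Real.add_one_le_exp (1 / 3 : ℝ)
    nlinarith [Real.exp_pos (-t₂)]
  have hJt : ∀ r ∈ J, -Real.log r ∈ Icc t₁ t₂ ∧ Real.exp (-(-Real.log r)) = r := by
    intro r hr
    refine ⟨⟨?_, ?_⟩, by rw [neg_neg, Real.exp_log (hJpos r hr)]⟩
    · rw [le_neg, Real.log_le_iff_le_exp (hJpos r hr)]; exact hr.2
    · rw [neg_le, Real.le_log_iff_exp_le (hJpos r hr)]; exact hr.1
  have hpolr : ∀ r ∈ J, ∀ φ : ℝ, pol (-Real.log r) φ = r * Complex.exp (φ * Complex.I) := by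
    intro r hr φ
    rw [pol, (hJt r hr).2]
  have hc1 : 1 ≤ c := by omega
  have hpi := Real.pi_gt_three
  have hρ2 : Measurable fun z => ρ z ^ 2 := hρ.pow_const 2
  have hpolar := lintegral_polar_le hρ2 (J := J) (I := gap m c) measurableSet_Icc measurableSet_Ioo
    (measurableSet_planePart isOpen_Om) hJpos
    (fun φ hφ => ⟨by linarith [(gap_subset hm hc1 hφ).1], by linarith [(gap_subset hm hc1 hφ).2]⟩)
    (fun r hr φ hφ => by
      rw [← hpolr r hr]
      exact pol_mem_Om hm hc (hJt r hr).1 hφ)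
  set F : ℝ → ℝ≥0∞ := fun r => ENNReal.ofReal r *
    ∫⁻ φ in gap m c, ρ (r * Complex.exp (φ * Complex.I)) ^ 2
  have hFm : Measurable F := by
    refine Measurable.mul (by fun_prop) (Measurable.lintegral_prod_right'
      (f := fun p : ℝ × ℝ => ρ ((p.1 : ℂ) * Complex.exp (p.2 * Complex.I)) ^ 2) ?_)
    exact hρ2.comp (by fun_prop)
  have hvol : volume J = ENNReal.ofReal (Real.exp (-t₁) - Real.exp (-t₂)) := Real.volume_Icc
  have hvpos : 0 < Real.exp (-t₁) - Real.exp (-t₂) := by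
    have := Real.exp_pos (-t₁); linarith
  obtain ⟨r, hr, hFr⟩ := exists_le_setLAverage (μ := volume) (s := J) (f := F)
    (by rw [hvol]; exact (ENNReal.ofReal_pos.2 hvpos).ne') (by rw [hvol]; exact ENNReal.ofReal_ne_top)
    hFm.aemeasurable
  rw [setLAverage_eq, hvol] at hFr
  -- At a radius where `F` is at most its mean, `r * F r` is the angular integral of `(ρ r) ^ 2`.
  have hr2 : ENNReal.ofReal r * F r ≤ 4 * ε := by
    have hr1 : ENNReal.ofReal r ≤ 4 * ENNReal.ofReal (Real.exp (-t₁) - Real.exp (-t₂)) := by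
      rw [show (4 : ℝ≥0∞) = ENNReal.ofReal 4 by simp, ← ENNReal.ofReal_mul (by norm_num)]
      exact ENNReal.ofReal_le_ofReal (hr.2.trans hlen)
    calc ENNReal.ofReal r * F r ≤ (4 * ENNReal.ofReal (Real.exp (-t₁) - Real.exp (-t₂))) *
          (ε / ENNReal.ofReal (Real.exp (-t₁) - Real.exp (-t₂))) := by
          gcongr
          exact hFr.trans (by gcongr; exact hpolar.trans hE)
      _ = 4 * ε := by
          rw [mul_assoc, ENNReal.mul_div_cancel (ENNReal.ofReal_pos.2 hvpos).ne'
            ENNReal.ofReal_ne_top]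
  refine ⟨-Real.log r, (hJt r hr).1, ?_⟩
  have hm1 : Measurable fun φ : ℝ => ρ (pol (-Real.log r) φ) :=
    hρ.comp (continuous_pol.comp (by fun_prop : Continuous fun φ : ℝ => (-Real.log r, φ))).measurable
  calc arcCost ρ m c (-Real.log r)
      ≤ ∫⁻ φ in gap m c, (θ + (ρ (pol (-Real.log r) φ) * ENNReal.ofReal r) ^ 2 / θ) := by
        rw [arcCost, (hJt r hr).2]
        exact lintegral_mono fun φ => le_add_sq_div _ _ h0 h1
    _ = θ * volume (gap m c) + (ENNReal.ofReal r * F r) / θ := by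
        rw [lintegral_add_left measurable_const, setLIntegral_const]
        congr 1
        simp only [ENNReal.div_eq_inv_mul, F, hpolr r hr, mul_pow]
        rw [lintegral_const_mul _ (by
          simp only [← hpolr r hr]; exact (hm1.pow_const 2).mul_const _), lintegral_mul_const _ (by
          simp only [← hpolr r hr]; exact (hm1.pow_const 2))]
        ring
    _ ≤ _ := by
        rw [volume_gap hm hc]
        gcongr

/-- The expected value of the sum of `w` over a random ray of the tree starting at `m`. -/
def rayMean (w : ℕ → ℝ≥0∞) (m : ℕ) : ℝ≥0∞ :=
  ∑' k : ℕ, (2 ^ k)⁻¹ * ∑ i ∈ Finset.range (2 ^ k), w (2 ^ k * m + i)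

/-- A random ray continues in either subtree with probability `1 / 2`: descendants of `m` split into
those of its children. -/
theorem rayMean_eq (w : ℕ → ℝ≥0∞) (m : ℕ) :
    rayMean w m = w m + (2⁻¹ * rayMean w (2 * m) + 2⁻¹ * rayMean w (2 * m + 1)) := by
  rw [rayMean, tsum_eq_zero_add' ENNReal.summable]
  congr 1
  · simp
  · rw [rayMean, rayMean, ← ENNReal.tsum_mul_left, ← ENNReal.tsum_mul_left, ← ENNReal.tsum_add]
    refine tsum_congr fun k => ?_
    rw [← mul_assoc (2⁻¹ : ℝ≥0∞), ← mul_assoc (2⁻¹ : ℝ≥0∞), ← mul_add, ← ENNReal.mul_inv (by simp) (by simp), ← pow_succ']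
    congr 1
    rw [pow_succ, mul_two, Finset.sum_range_add]
    congr 1
    · refine Finset.sum_congr rfl fun i _ => ?_
      congr 1; ring
    · refine Finset.sum_congr rfl fun i _ => ?_
      congr 1; ring

/-- A ray of the tree, following the child with the smaller mean. -/
def greedyRay (w : ℕ → ℝ≥0∞) : ℕ → ℕ
  | 0 => 1
  | k + 1 => if rayMean w (2 * greedyRay w k) ≤ rayMean w (2 * greedyRay w k + 1) then
      2 * greedyRay w k else 2 * greedyRay w k + 1

theorem greedyRay_succ (w : ℕ → ℝ≥0∞) (k : ℕ) :
    greedyRay w (k + 1) = 2 * greedyRay w k ∨ greedyRay w (k + 1) = 2 * greedyRay w k + 1 := by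
  rw [greedyRay]; split_ifs <;> simp

/-- The smaller of two means is at most their average, so the weight paid plus the remaining mean
never increases along the ray. -/
theorem tsum_greedyRay_le (w : ℕ → ℝ≥0∞) : ∑' k, w (greedyRay w k) ≤ rayMean w 1 := by
  have step : ∀ k, w (greedyRay w k) + rayMean w (greedyRay w (k + 1)) ≤
      rayMean w (greedyRay w k) := by
    intro k
    rw [rayMean_eq w (greedyRay w k)]
    refine add_le_add le_rfl ?_
    have half : ∀ x : ℝ≥0∞, x = 2⁻¹ * x + 2⁻¹ * x := fun x => by
      rw [← add_mul, ENNReal.inv_two_add_inv_two, one_mul]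
    rw [greedyRay]
    split_ifs with h
    · conv_lhs => rw [half (rayMean w _)]
      gcongr
    · conv_lhs => rw [half (rayMean w _)]
      gcongr
      exact (not_le.1 h).le
  have hsum : ∀ k, ∑ i ∈ Finset.range k, w (greedyRay w i) + rayMean w (greedyRay w k) ≤
      rayMean w 1 := by
    intro k
    induction k with
    | zero => simp [greedyRay]
    | succ k ih =>
      rw [Finset.sum_range_succ, add_assoc]
      exact (add_le_add le_rfl (step k)).trans ih
  exact ENNReal.tsum_le_of_sum_range_le fun k => le_self_add.trans (hsum k)

theorem log_ray {n : ℕ → ℕ} (h0 : n 0 = 1) (hs : ∀ k, n (k + 1) = 2 * n k ∨ n (k + 1) = 2 * n k + 1)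
    (k : ℕ) : 1 ≤ n k ∧ Nat.log 2 (n k) = k := by
  induction k with
  | zero => simp [h0]
  | succ k ih =>
    refine ⟨?_, by rw [log_two_mul_add ih.1 (hs k), ih.2]⟩
    rcases hs k with h | h <;> omega

theorem tsum_ofReal_geometric {a r : ℝ} (ha : 0 ≤ a) (h0 : 0 ≤ r) (h1 : r < 1) :
    ∑' k : ℕ, ENNReal.ofReal (a * r ^ k) = ENNReal.ofReal (a / (1 - r)) := by
  rw [← ENNReal.ofReal_tsum_of_nonneg (fun k => by positivity)
    ((summable_geometric_of_lt_one h0 h1).mul_left a), tsum_mul_left,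
    tsum_geometric_of_lt_one h0 h1, div_eq_mul_inv]

/-- The parameter `(3 / 4) ^ k / 64` at level `k` is summable, and dividing it into `2 ^ (-k)`
leaves the ratio `2 / 3`. The two series sum to `4 / 64` and `3 / 64`. -/
theorem rayMean_le {w : ℕ → ℝ≥0∞} (hE : ∑' m, w m ^ 2 ≤ ENNReal.ofReal (1 / 4096)) :
    rayMean w 1 ≤ ENNReal.ofReal (7 / 64) := by
  have hterm : ∀ k : ℕ, (2 ^ k)⁻¹ * ∑ i ∈ Finset.range (2 ^ k), w (2 ^ k * 1 + i) ≤
      ENNReal.ofReal (1 / 64 * (3 / 4) ^ k) + ENNReal.ofReal (1 / 64 * (2 / 3) ^ k) := by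
    intro k
    set θ := ENNReal.ofReal (1 / 64 * (3 / 4) ^ k) with hθ
    have h0 : θ ≠ 0 := (ENNReal.ofReal_pos.2 (by positivity)).ne'
    have h1 : θ ≠ ⊤ := ENNReal.ofReal_ne_top
    have hsq : ∑ i ∈ Finset.range (2 ^ k), w (2 ^ k * 1 + i) ^ 2 ≤ ENNReal.ofReal (1 / 4096) := by
      refine le_trans ?_ hE
      rw [← Finset.sum_image (f := fun m => w m ^ 2) (g := fun i => 2 ^ k * 1 + i)
        (fun a _ b _ h => by simpa using h)]
      exact ENNReal.sum_le_tsum _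
    calc (2 ^ k)⁻¹ * ∑ i ∈ Finset.range (2 ^ k), w (2 ^ k * 1 + i)
        ≤ (2 ^ k)⁻¹ * ∑ i ∈ Finset.range (2 ^ k), (θ + w (2 ^ k * 1 + i) ^ 2 / θ) := by
          gcongr; exact le_add_sq_div _ _ h0 h1
      _ = θ + (2 ^ k)⁻¹ * ((∑ i ∈ Finset.range (2 ^ k), w (2 ^ k * 1 + i) ^ 2) / θ) := by
          rw [Finset.sum_add_distrib, Finset.sum_const, Finset.card_range, nsmul_eq_mul, mul_add,
            ← mul_assoc, Nat.cast_pow, Nat.cast_ofNat, ENNReal.inv_mul_cancel (by simp) (by simp),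
            one_mul]
          simp only [div_eq_mul_inv, Finset.sum_mul]
      _ ≤ θ + (2 ^ k)⁻¹ * (ENNReal.ofReal (1 / 4096) / θ) := by gcongr
      _ = _ := by
          congr 1
          rw [show (2 : ℝ≥0∞) ^ k = ENNReal.ofReal (2 ^ k) by
              rw [ENNReal.ofReal_pow (by norm_num)]; simp,
            ← ENNReal.ofReal_inv_of_pos (by positivity), hθ,
            ← ENNReal.ofReal_div_of_pos (by positivity), ← ENNReal.ofReal_mul (by positivity)]
          congr 1
          rw [div_pow, div_pow, show (4 : ℝ) = 2 * 2 by norm_num, mul_pow]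
          field_simp
          norm_num
  calc rayMean w 1 ≤ ∑' k : ℕ, (ENNReal.ofReal (1 / 64 * (3 / 4) ^ k) +
        ENNReal.ofReal (1 / 64 * (2 / 3) ^ k)) := ENNReal.tsum_le_tsum hterm
    _ = _ := by
        rw [ENNReal.tsum_add, tsum_ofReal_geometric (by norm_num) (by norm_num) (by norm_num),
          tsum_ofReal_geometric (by norm_num) (by norm_num) (by norm_num),
          ← ENNReal.ofReal_add (by norm_num) (by norm_num)]
        norm_num

/-- If the energy is small there is a ray of the tree, and arcs joining its consecutive tripods,
of small total cost. -/
theorem exists_cheap_ray {ρ : ℂ → ℝ≥0∞} (hρ : Measurable ρ) {w : ℕ → ℝ≥0∞}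
    (hE : ∫⁻ z in planePart Om, ρ z ^ 2 ≤ ENNReal.ofReal (1 / 4096))
    (hw : ∑' m, w m ^ 2 ≤ ENNReal.ofReal (1 / 4096)) :
    ∃ (n : ℕ → ℕ) (t : ℕ → ℝ), n 0 = 1 ∧ (∀ k, n (k + 1) = 2 * n k ∨ n (k + 1) = 2 * n k + 1) ∧
      (∀ k, t k ∈ Icc ((2 * n k + 1 : ℕ) + 1 / 3 : ℝ) ((2 * n k + 1 : ℕ) + 2 / 3)) ∧
      ∑' k, arcCost ρ (n k) (n (k + 1)) (t k) + ∑' k, w (n k) ≤ ENNReal.ofReal (1 / 2) := by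
  set n := greedyRay w
  have hlog := log_ray (n := n) rfl (greedyRay_succ w)
  have harc : ∀ k, ∃ t ∈ Icc ((2 * n k + 1 : ℕ) + 1 / 3 : ℝ) ((2 * n k + 1 : ℕ) + 2 / 3),
      arcCost ρ (n k) (n (k + 1)) t ≤
        ENNReal.ofReal (1 / 256 * (3 / 4) ^ k) + ENNReal.ofReal (4 / 64 * (2 / 3) ^ k) := by
    intro k
    -- A parameter growing with ratio between `1` and `2` suits both terms: against the arc length
    -- `2 ^ (-(k + 2))` it leaves ratio `3 / 4`, and in the denominator of the energy term ratio `2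
    -- / 3`. The sums are `1 / 64` and `12 / 64`.
    have hθ : 0 < (1 / 64 * (3 / 2) ^ k : ℝ) := by positivity
    obtain ⟨t, ht, h⟩ := exists_cheap_arc hρ hE (hlog k).1 (greedyRay_succ w k)
      (θ := ENNReal.ofReal (1 / 64 * (3 / 2) ^ k)) (ENNReal.ofReal_pos.2 hθ).ne'
      ENNReal.ofReal_ne_top
    refine ⟨t, ht, h.trans (le_of_eq ?_)⟩
    rw [(hlog k).2, ← ENNReal.ofReal_mul hθ.le, show (4 : ℝ≥0∞) = ENNReal.ofReal 4 by simp,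
      ← ENNReal.ofReal_mul (by norm_num), ← ENNReal.ofReal_div_of_pos hθ]
    congr 2
    · rw [div_pow, div_pow, show (4 : ℝ) = 2 * 2 by norm_num, mul_pow]
      field_simp
      ring
    · rw [div_pow, div_pow]
      field_simp
      norm_num
  choose t ht hcost using harc
  refine ⟨n, t, rfl, greedyRay_succ w, ht, ?_⟩
  have h1 : ∑' k, arcCost ρ (n k) (n (k + 1)) (t k) ≤ ENNReal.ofReal (13 / 64) := by
    refine (ENNReal.tsum_le_tsum hcost).trans (le_of_eq ?_)
    rw [ENNReal.tsum_add, tsum_ofReal_geometric (by norm_num) (by norm_num) (by norm_num),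
      tsum_ofReal_geometric (by norm_num) (by norm_num) (by norm_num),
      ← ENNReal.ofReal_add (by norm_num) (by norm_num)]
    norm_num
  have h2 := (tsum_greedyRay_le w).trans (rayMean_le hw)
  refine (add_le_add h1 h2).trans ?_
  rw [← ENNReal.ofReal_add (by norm_num) (by norm_num)]
  exact ENNReal.ofReal_le_ofReal (by norm_num)

end

section

open MeasureTheory

/-! ### Line integrals over circular arcs -/

theorem sin_chord_tendsto (d : ℝ) :
    Filter.Tendsto (fun n : ℕ => (n : ℝ) * (2 * Real.sin (d / n / 2))) Filter.atTop (𝓝 d) := by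
  have h1 : Filter.Tendsto (fun n : ℕ => d / n / 2) Filter.atTop (𝓝 0) := by
    have := (tendsto_const_div_atTop_nhds_zero_nat d).div_const 2
    rwa [zero_div] at this
  have h2 : Filter.Tendsto (fun n : ℕ => d * Real.sinc (d / n / 2)) Filter.atTop (𝓝 d) := by
    have := (Real.continuous_sinc.tendsto 0).comp h1
    rw [Real.sinc_zero] at this
    simpa using this.const_mul d
  refine h2.congr' ?_
  filter_upwards [Filter.eventually_gt_atTop 0] with n hn
  have hn' : (n : ℝ) ≠ 0 := by exact_mod_cast hn.ne'
  rcases eq_or_ne d 0 with rfl | hd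
  · simp
  · rw [Real.sinc_of_ne_zero (by positivity)]
    field_simp

/-- The upper bound is the Lipschitz estimate; the lower bound comes from inscribed polygons with
`n` equal chords. -/
theorem eVariationOn_pol (t : ℝ) {α β : ℝ} (h : α ≤ β) :
    eVariationOn (pol t) (Icc α β) = ENNReal.ofReal (Real.exp (-t) * (β - α)) := by
  have hr := Real.exp_pos (-t)
  refine le_antisymm ?_ ?_
  · have hlip : LipschitzOnWith (Real.exp (-t)).toNNReal (pol t) univ :=
      LipschitzOnWith.of_dist_le_mul fun x _ y _ => by
        rw [dist_eq_norm, Real.dist_eq, Real.coe_toNNReal _ hr.le]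
        exact norm_pol_sub_pol_le t x y
    have h1 := hlip.comp_eVariationOn_le (g := id) (s := Icc α β) (mapsTo_univ _ _)
    rw [Function.comp_id] at h1
    refine h1.trans ?_
    rw [ENNReal.ofReal_mul hr.le]
    refine mul_le_mul' le_rfl ?_
    have := ((monotoneOn_id (s := Icc α β)).eVariationOn_eq (left_mem_Icc.2 h) (right_mem_Icc.2 h)).le
    rwa [inter_self] at this
  · have hlim : Filter.Tendsto (fun n : ℕ => ENNReal.ofReal (Real.exp (-t) *
        ((n : ℝ) * (2 * Real.sin ((β - α) / n / 2))))) Filter.atTop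
        (𝓝 (ENNReal.ofReal (Real.exp (-t) * (β - α)))) :=
      ENNReal.tendsto_ofReal ((sin_chord_tendsto (β - α)).const_mul _)
    refine le_of_tendsto hlim ?_
    filter_upwards [Filter.eventually_gt_atTop 0] with n hn
    have hn' : (0 : ℝ) < n := by exact_mod_cast hn
    set u : ℕ → ℝ := fun i => α + i * ((β - α) / n)
    have hstep : 0 ≤ (β - α) / n := div_nonneg (by linarith) hn'.le
    have hu : MonotoneOn u (Iic n) := fun i _ j _ hij => by
      have : (i : ℝ) ≤ j := by exact_mod_cast hij
      simp only [u]; gcongr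
    have hus : ∀ i ≤ n, u i ∈ Icc α β := by
      intro i hi
      have : (i : ℝ) ≤ n := by exact_mod_cast hi
      constructor
      · simp only [u]
        have : 0 ≤ (i : ℝ) * ((β - α) / n) := by positivity
        linarith
      · have : (i : ℝ) * ((β - α) / n) ≤ n * ((β - α) / n) := by gcongr
        rw [mul_div_cancel₀ _ hn'.ne'] at this
        simp only [u]; linarith
    refine le_trans ?_ (eVariationOn.sum_le_of_monotoneOn_Iic (f := pol t) hu hus)
    have hterm : ∀ i ∈ Finset.range n, edist (pol t (u (i + 1))) (pol t (u i)) =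
        ENNReal.ofReal (Real.exp (-t) * |2 * Real.sin ((β - α) / n / 2)|) := by
      intro i _
      rw [edist_dist, dist_eq_norm, norm_pol_sub_pol]
      congr 5
      simp only [u]; push_cast; ring
    rw [Finset.sum_congr rfl hterm, Finset.sum_const, Finset.card_range, nsmul_eq_mul,
      ← ENNReal.ofReal_natCast, ← ENNReal.ofReal_mul hn'.le]
    refine ENNReal.ofReal_le_ofReal ?_
    rw [mul_left_comm]
    gcongr
    exact le_abs_self _

theorem image_eq_uIcc {ψ : ℝ → ℝ} {a x : ℝ} (hax : a ≤ x) (hc : ContinuousOn ψ (Icc a x))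
    (hm : MonotoneOn ψ (Icc a x) ∨ AntitoneOn ψ (Icc a x)) :
    ψ '' Icc a x = uIcc (ψ a) (ψ x) := by
  refine subset_antisymm ?_ (by
    have := intermediate_value_uIcc (a := a) (b := x) (f := ψ) (by rwa [uIcc_of_le hax])
    rwa [uIcc_of_le hax] at this)
  rintro - ⟨y, hy, rfl⟩
  have ha : a ∈ Icc a x := left_mem_Icc.2 hax
  have hx : x ∈ Icc a x := right_mem_Icc.2 hax
  rcases hm with hm | hm
  · exact mem_uIcc.2 (Or.inl ⟨hm ha hy hy.1, hm hy hx hy.2⟩)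
  · exact mem_uIcc.2 (Or.inr ⟨hm hy hx hy.2, hm ha hy hy.1⟩)

theorem eVariationOn_arc {t a x : ℝ} {ψ : ℝ → ℝ} {σ : ℝ → ℂ} (hax : a ≤ x)
    (hc : ContinuousOn ψ (Icc a x)) (hm : MonotoneOn ψ (Icc a x) ∨ AntitoneOn ψ (Icc a x))
    (hσ : EqOn σ (fun y => pol t (ψ y)) (Icc a x)) :
    eVariationOn σ (Icc a x) = ENNReal.ofReal (Real.exp (-t) * |ψ x - ψ a|) := by
  rw [eVariationOn.eq_of_eqOn hσ]
  have : eVariationOn (fun y => pol t (ψ y)) (Icc a x) = eVariationOn (pol t) (ψ '' Icc a x) := by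
    rcases hm with hm | hm
    · exact eVariationOn.comp_eq_of_monotoneOn (pol t) ψ hm
    · exact eVariationOn.comp_eq_of_antitoneOn (pol t) ψ hm
  rw [this, image_eq_uIcc hax hc hm, uIcc, eVariationOn_pol t min_le_max, max_sub_min_eq_abs]

/-- The line integral over a circular arc, traversed monotonically. -/
theorem arcIntegral_le {t a b : ℝ} {ψ : ℝ → ℝ} {σ : ℝ → ℂ} (hab : a ≤ b)
    (hc : ContinuousOn ψ (Icc a b)) (hm : MonotoneOn ψ (Icc a b) ∨ AntitoneOn ψ (Icc a b))
    (hσ : EqOn σ (fun y => pol t (ψ y)) (Icc a b)) {I : Set ℝ} (hI : ψ '' Icc a b ⊆ I)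
    (ρ : ℂ → ℝ≥0∞) :
    arcIntegral ρ σ a b ≤ ∫⁻ φ in I, ρ (pol t φ) * ENNReal.ofReal (Real.exp (-t)) := by
  have hr := Real.exp_pos (-t)
  have sub : ∀ x ∈ Icc a b, Icc a x ⊆ Icc a b := fun x hx => Icc_subset_Icc_right hx.2
  have hm' : ∀ x ∈ Icc a b, MonotoneOn ψ (Icc a x) ∨ AntitoneOn ψ (Icc a x) := fun x hx =>
    hm.imp (fun h => h.mono (sub x hx)) (fun h => h.mono (sub x hx))
  have hV : ∀ x ∈ Icc a b, eVariationOn σ (Icc a x) =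
      ENNReal.ofReal (Real.exp (-t) * |ψ x - ψ a|) := fun x hx =>
    eVariationOn_arc hx.1 (hc.mono (sub x hx)) (hm' x hx) (hσ.mono (sub x hx))
  have hbv : LocallyBoundedVariationOn σ (Icc a b) := by
    refine BoundedVariationOn.locallyBoundedVariationOn ?_
    rw [BoundedVariationOn, hV b (right_mem_Icc.2 hab)]
    exact ENNReal.ofReal_ne_top
  have hfrom : ∀ x ∈ Icc a b, variationOnFromTo σ (Icc a b) a x =
      Real.exp (-t) * |ψ x - ψ a| := by
    intro x hx
    rw [variationOnFromTo.eq_of_le _ _ hx.1, inter_eq_right.2 (sub x hx), hV x hx,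
      ENNReal.toReal_ofReal (by positivity)]
  have hnat : ∀ x ∈ Icc a b, naturalParameterization σ (Icc a b) a
      (Real.exp (-t) * |ψ x - ψ a|) = pol t (ψ x) := by
    intro x hx
    have := edist_naturalParameterization_eq_zero hbv (left_mem_Icc.2 hab) hx
    rw [hfrom x hx, edist_eq_zero, hσ hx] at this
    exact this
  -- The sign `e` is the orientation. With it, arc length becomes an affine function `f` of the
  -- angle, and the integral is a change of variables.
  obtain ⟨e, he, hee⟩ : ∃ e : ℝ, |e| = 1 ∧ ∀ x ∈ Icc a b, e * (ψ x - ψ a) = |ψ x - ψ a| := by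
    rcases hm with hm | hm
    · refine ⟨1, by simp, fun x hx => ?_⟩
      rw [one_mul, abs_of_nonneg]
      linarith [hm (left_mem_Icc.2 hab) hx hx.1]
    · refine ⟨-1, by simp, fun x hx => ?_⟩
      rw [abs_of_nonpos]
      · ring
      linarith [hm (left_mem_Icc.2 hab) hx hx.1]
  set f : ℝ → ℝ := fun φ => Real.exp (-t) * (e * (φ - ψ a))
  have hfψ : ∀ x ∈ Icc a b, f (ψ x) = Real.exp (-t) * |ψ x - ψ a| := fun x hx => by
    simp only [f, hee x hx]
  have himg : ψ '' Icc a b = uIcc (ψ a) (ψ b) := image_eq_uIcc hab hc hm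
  have hcov : Icc 0 (eVariationOn σ (Icc a b)).toReal ⊆ f '' (ψ '' Icc a b) := by
    rw [hV b (right_mem_Icc.2 hab), ENNReal.toReal_ofReal (by positivity)]
    have h1 : f (ψ a) = 0 := by simp [f]
    have h2 := hfψ b (right_mem_Icc.2 hab)
    have hfc : ContinuousOn f (uIcc (ψ a) (ψ b)) := by fun_prop
    have := intermediate_value_uIcc hfc
    rw [h1, h2, uIcc_of_le (by positivity)] at this
    rwa [himg]
  have hderiv : ∀ φ, HasDerivAt f (Real.exp (-t) * e) φ := by
    intro φ
    have := (((hasDerivAt_id φ).sub_const (ψ a)).const_mul e).const_mul (Real.exp (-t))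
    simpa using this
  have hinj : InjOn f (ψ '' Icc a b) := by
    intro x _ y _ hxy
    have he0 : e ≠ 0 := by rw [← abs_pos, he]; exact one_pos
    have := mul_left_cancel₀ he0 (mul_left_cancel₀ hr.ne' hxy)
    linarith
  have hmeas : MeasurableSet (ψ '' Icc a b) := by rw [himg]; exact measurableSet_uIcc
  calc arcIntegral ρ σ a b ≤ ∫⁻ s in f '' (ψ '' Icc a b),
        ρ (naturalParameterization σ (Icc a b) a s) := lintegral_mono_set hcov
    _ = ∫⁻ φ in ψ '' Icc a b, ENNReal.ofReal |Real.exp (-t) * e| *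
          ρ (naturalParameterization σ (Icc a b) a (f φ)) :=
        lintegral_image_eq_lintegral_abs_deriv_mul hmeas
          (fun φ _ => (hderiv φ).hasDerivWithinAt) hinj _
    _ = ∫⁻ φ in ψ '' Icc a b, ρ (pol t φ) * ENNReal.ofReal (Real.exp (-t)) := by
        refine setLIntegral_congr_fun hmeas ?_
        rintro - ⟨x, hx, rfl⟩
        dsimp only
        rw [hfψ x hx, hnat x hx, abs_mul, he, mul_one, abs_of_pos hr, mul_comm]
    _ ≤ _ := lintegral_mono_set hI

/-! ### The path of a ray -/

/-- A ray of the tree together with radii of arcs joining its consecutive tripods. -/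
structure IsRay (n : ℕ → ℕ) (t : ℕ → ℝ) : Prop where
  zero : n 0 = 1
  succ : ∀ k, n (k + 1) = 2 * n k ∨ n (k + 1) = 2 * n k + 1
  time : ∀ k, t k ∈ Icc ((2 * n k + 1 : ℕ) + 1 / 3 : ℝ) ((2 * n k + 1 : ℕ) + 2 / 3)

variable {n : ℕ → ℕ} {t : ℕ → ℝ}

/-- A point of the tripod `m`. -/
def node (m : ℕ) : Hat Om := hatMk Om ((pol m (label m) : ℂ) : OnePoint ℂ)

/-- The origin, as a point of the quotient space. -/
def origin : Hat Om := hatMk Om ((0 : ℂ) : OnePoint ℂ)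

theorem pol_label_mem_tripod (m : ℕ) : pol m (label m) ∈ tripod m :=
  ⟨m, label m, Or.inr ⟨rfl, by rw [sub_self, abs_zero]; norm_num⟩, rfl⟩

theorem hatMk_eq_node {m : ℕ} (hm : 1 ≤ m) {z : ℂ} (hz : z ∈ tripod m) :
    hatMk Om (z : OnePoint ℂ) = node m :=
  hatMk_eq_iff.2 (Or.inr ⟨tri m, tri_mem_complComponents hm, ⟨z, hz, rfl⟩,
    ⟨_, pol_label_mem_tripod m, rfl⟩⟩)

theorem IsRay.one_le (h : IsRay n t) (k : ℕ) : 1 ≤ n k := (log_ray h.zero h.succ k).1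

theorem IsRay.le (h : IsRay n t) (k : ℕ) : k ≤ n k := by
  induction k with
  | zero => exact Nat.zero_le _
  | succ k ih => have := h.one_le k; rcases h.succ k with h' | h' <;> omega

theorem IsRay.le_time (h : IsRay n t) (k : ℕ) : (k : ℝ) ≤ t k := by
  have h1 : (k : ℝ) ≤ n k := by exact_mod_cast h.le k
  have h2 := (h.time k).1
  push_cast at h2
  linarith [(Nat.cast_nonneg (n k) : (0 : ℝ) ≤ n k)]

theorem IsRay.hatMk_left (h : IsRay n t) (k : ℕ) :
    hatMk Om ((pol (t k) (label (n k)) : ℂ) : OnePoint ℂ) = node (n k) := by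
  refine hatMk_eq_node (h.one_le k) ⟨t k, _, Or.inl ⟨?_, ?_, ?_⟩, rfl⟩
  · have h2 := (h.time k).1
    push_cast at h2
    linarith [(Nat.cast_nonneg (n k) : (0 : ℝ) ≤ n k)]
  · have h2 := (h.time k).2
    have : (1 : ℝ) ≤ n k := by exact_mod_cast h.one_le k
    push_cast at h2
    linarith
  · exact (ang_of_fract (h.time k).1 (h.time k).2).symm

theorem IsRay.hatMk_right (h : IsRay n t) (k : ℕ) :
    hatMk Om ((pol (t k) (label (n (k + 1))) : ℂ) : OnePoint ℂ) = node (n (k + 1)) := by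
  have h1 := (h.time k).1
  have h2 := (h.time k).2
  have h3 : (1 : ℝ) ≤ n k := by exact_mod_cast h.one_le k
  have h4 : (n (k + 1) : ℝ) = 2 * n k ∨ (n (k + 1) : ℝ) = 2 * n k + 1 := by exact_mod_cast h.succ k
  push_cast at h1 h2
  refine hatMk_eq_node (h.one_le _) ⟨t k, _, Or.inl ⟨?_, ?_, ?_⟩, rfl⟩
  · rcases h4 with h4 | h4 <;> rw [h4] <;> linarith
  · rcases h4 with h4 | h4 <;> rw [h4] <;> linarith
  · exact (ang_of_fract (h.time k).1 (h.time k).2).symm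

/-- The angle of the path at the time `u` in `[k, k + 1]`. -/
def rayAngle (n : ℕ → ℕ) (k : ℕ) (u : ℝ) : ℝ :=
  label (n k) + (u - k) * (label (n (k + 1)) - label (n k))

theorem rayAngle_mem_gap (h : IsRay n t) {k : ℕ} {u : ℝ} (hu : u ∈ Ioo (k : ℝ) (k + 1)) :
    rayAngle n k u ∈ gap (n k) (n (k + 1)) := by
  have hne : label (n k) ≠ label (n (k + 1)) := fun e => by
    have := label_injective e
    have := h.one_le k
    rcases h.succ k with h' | h' <;> omega
  rw [gap, rayAngle]
  rcases lt_or_gt_of_ne hne with hl | hl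
  · rw [min_eq_left hl.le, max_eq_right hl.le]
    constructor <;> nlinarith [hu.1, hu.2]
  · rw [min_eq_right hl.le, max_eq_left hl.le]
    constructor <;> nlinarith [hu.1, hu.2]

/-- The path of a ray, parametrised by the half-line. -/
def rayMap (n : ℕ → ℕ) (t : ℕ → ℝ) (u : ℝ) : Hat Om :=
  hatMk Om ((pol (t ⌊u⌋₊) (rayAngle n ⌊u⌋₊ u) : ℂ) : OnePoint ℂ)

/-- The closed interval is legitimate: at `u = k + 1` the arc `k` ends and the next one starts at
different points of the plane, but on the same tripod, which the quotient collapses. -/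
theorem rayMap_eq (h : IsRay n t) {k : ℕ} {u : ℝ} (hu : u ∈ Icc (k : ℝ) (k + 1)) :
    rayMap n t u = hatMk Om ((pol (t k) (rayAngle n k u) : ℂ) : OnePoint ℂ) := by
  rcases hu.2.eq_or_lt with rfl | hlt
  · have hfl : ⌊(k : ℝ) + 1⌋₊ = k + 1 := by exact_mod_cast Nat.floor_natCast (k + 1)
    rw [rayMap, hfl]
    have e1 : rayAngle n (k + 1) (k + 1) = label (n (k + 1)) := by simp [rayAngle]
    have e2 : rayAngle n k (k + 1) = label (n (k + 1)) := by simp [rayAngle]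
    rw [e1, e2, h.hatMk_left, h.hatMk_right]
  · have hfl : ⌊u⌋₊ = k := (Nat.floor_eq_iff ((Nat.cast_nonneg k).trans hu.1)).2 ⟨hu.1, hlt⟩
    rw [rayMap, hfl]

theorem continuousOn_rayMap (h : IsRay n t) : ContinuousOn (rayMap n t) (Ici 0) := by
  have hc : Continuous fun u : ℝ => rayMap n t (max u 0) := by
    have hlf : LocallyFinite fun k : ℕ => {u : ℝ | (k : ℝ) ≤ max u 0 ∧ max u 0 ≤ k + 1} := by
      intro x
      refine ⟨Iio (max x 0 + 1), Iio_mem_nhds ((le_max_left x 0).trans_lt (by linarith)),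
        (finite_Iic ⌈max x 0 + 1⌉₊).subset ?_⟩
      rintro k ⟨u, hu, hux⟩
      have h1 : (k : ℝ) ≤ max x 0 + 1 :=
        hu.1.trans (max_le (le_of_lt hux) (by linarith [le_max_right x 0]))
      exact_mod_cast h1.trans (Nat.le_ceil _)
    refine hlf.continuous ?_ ?_ ?_
    · refine eq_univ_of_forall fun u => mem_iUnion.2 ⟨⌊max u 0⌋₊, ?_, ?_⟩
      · exact Nat.floor_le (le_max_right _ _)
      · exact (Nat.lt_floor_add_one _).le
    · intro k
      exact (isClosed_le continuous_const (continuous_id.max continuous_const)).inter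
        (isClosed_le (continuous_id.max continuous_const) continuous_const)
    · intro k
      have : Continuous fun u : ℝ => hatMk Om ((pol (t k) (rayAngle n k (max u 0)) : ℂ) : OnePoint ℂ) := by
        refine continuous_hatMk.comp (OnePoint.continuous_coe.comp ?_)
        refine continuous_pol.comp (continuous_const.prodMk ?_)
        exact continuous_const.add (((continuous_id.max continuous_const).sub
          continuous_const).mul continuous_const)
      exact this.continuousOn.congr fun u hu => rayMap_eq h hu
  refine hc.continuousOn.congr fun u hu => ?_
  simp only [max_eq_left (mem_Ici.1 hu)]

/-- The arc `k` has radius at most `exp (-k)`. -/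
theorem rayMap_tendsto (h : IsRay n t) {U : Set (Hat Om)} (hU : IsOpen U) (h0 : origin ∈ U) :
    ∃ R : ℝ, ∀ u, R ≤ u → rayMap n t u ∈ U := by
  have hV : IsOpen ((fun z : ℂ => hatMk Om (z : OnePoint ℂ)) ⁻¹' U) :=
    hU.preimage (continuous_hatMk.comp OnePoint.continuous_coe)
  obtain ⟨δ, hδ, hball⟩ := Metric.isOpen_iff.1 hV 0 h0
  refine ⟨max 0 (1 - Real.log δ), fun u hu => hball ?_⟩
  have hu0 : 0 ≤ u := (le_max_left _ _).trans hu
  rw [mem_ball_zero_iff, norm_pol, ← Real.lt_log_iff_exp_lt hδ]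
  have h1 := h.le_time ⌊u⌋₊
  have h2 := Nat.lt_floor_add_one u
  have h3 := (le_max_right _ _).trans hu
  linarith

/-- The path of a ray, parametrised by the unit interval. -/
def rayPathFun (n : ℕ → ℕ) (t : ℕ → ℝ) (x : ℝ) : Hat Om :=
  if x < 1 then rayMap n t (x / (1 - x)) else origin

theorem continuousOn_rayPathFun (h : IsRay n t) : ContinuousOn (rayPathFun n t) (Icc 0 1) := by
  intro x hx
  rcases hx.2.eq_or_lt with rfl | hlt
  · rw [ContinuousWithinAt, tendsto_nhds]
    intro U hU h1
    have h0 : origin ∈ U := by simpa [rayPathFun] using h1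
    obtain ⟨R, hR⟩ := rayMap_tendsto h hU h0
    have hR0 : max R 0 / (max R 0 + 1) < 1 := by
      rw [div_lt_one (by positivity)]; linarith
    refine Filter.mem_of_superset (mem_nhdsWithin_of_mem_nhds (Ioi_mem_nhds hR0)) ?_
    intro y hy
    rw [mem_preimage, rayPathFun]
    split_ifs with hy1
    · refine hR _ ((le_max_left R 0).trans ?_)
      rw [mem_Ioi, div_lt_iff₀ (by positivity)] at hy
      rw [le_div_iff₀ (by linarith)]
      linarith
    · exact h0
  · have hc : ContinuousOn (fun y : ℝ => rayMap n t (y / (1 - y))) (Icc 0 1 ∩ Iio 1) := by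
      refine (continuousOn_rayMap h).comp ?_ ?_
      · refine continuousOn_id.div (by fun_prop) fun y hy => ?_
        have : y < 1 := hy.2
        linarith
      · intro y hy
        have : y < 1 := hy.2
        exact div_nonneg hy.1.1 (by linarith)
    have h1 := hc x ⟨hx, hlt⟩
    rw [continuousWithinAt_inter (Iio_mem_nhds hlt)] at h1
    refine h1.congr_of_eventuallyEq ?_ ?_
    · filter_upwards [mem_nhdsWithin_of_mem_nhds (Iio_mem_nhds hlt)] with y hy
      rw [rayPathFun, if_pos (mem_Iio.1 hy)]
    · rw [rayPathFun, if_pos hlt]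

/-- The path of a ray. -/
def rayPath (h : IsRay n t) : HatPath Om :=
  ⟨fun x => rayPathFun n t x, by
    have := (continuousOn_rayPathFun h).domRestrict
    exact this⟩

theorem rayPath_ext (h : IsRay n t) {x : ℝ} (hx : x ∈ Icc (0 : ℝ) 1) :
    (rayPath h).ext x = rayPathFun n t x := by
  rw [HatPath.ext, IccExtend_of_mem _ _ hx]; rfl

end

section

open MeasureTheory

variable {n : ℕ → ℕ} {t : ℕ → ℝ}

/-! ### The modulus of the paths to the origin -/

/-- The times at which the path of a ray runs through the arc `k`. -/
def arcTimes (k : ℕ) : Set ℝ := Ioo ((k : ℝ) / (k + 1)) (((k : ℝ) + 1) / (k + 2))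

/-- The substitution `u = x / (1 - x)` identifies `[0, 1)` with the half-line on which `rayMap` is
used. -/
theorem mem_arcTimes_iff {k : ℕ} {x : ℝ} :
    x ∈ arcTimes k ↔ x < 1 ∧ x / (1 - x) ∈ Ioo (k : ℝ) (k + 1) := by
  have hk : (0 : ℝ) ≤ k := Nat.cast_nonneg k
  rw [arcTimes, mem_Ioo, mem_Ioo, div_lt_iff₀ (by positivity), lt_div_iff₀ (by positivity)]
  constructor
  · rintro ⟨h1, h2⟩
    have h3 : x < 1 := by nlinarith
    refine ⟨h3, ?_, ?_⟩
    · rw [lt_div_iff₀ (by linarith)]; linarith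
    · rw [div_lt_iff₀ (by linarith)]; linarith
  · rintro ⟨h3, h1, h2⟩
    rw [lt_div_iff₀ (by linarith)] at h1
    rw [div_lt_iff₀ (by linarith)] at h2
    constructor <;> linarith

theorem arcTimes_subset (k : ℕ) : arcTimes k ⊆ Ico 0 1 := by
  intro x hx
  have h := (mem_arcTimes_iff.1 hx).1
  exact ⟨((div_nonneg (Nat.cast_nonneg k) (by positivity)).trans_lt hx.1).le, h⟩

theorem disjoint_arcTimes {j k : ℕ} (h : j ≠ k) : Disjoint (arcTimes j) (arcTimes k) := by
  rw [Set.disjoint_left]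
  intro x hj hk
  have h1 := (mem_arcTimes_iff.1 hj).2
  have h2 := (mem_arcTimes_iff.1 hk).2
  apply h
  have h3 : (j : ℝ) < k + 1 := h1.1.trans h2.2
  have h4 : (k : ℝ) < j + 1 := h2.1.trans h1.2
  norm_cast at h3 h4
  omega

theorem rayPathFun_eq (h : IsRay n t) {k : ℕ} {x : ℝ} (hx : x < 1)
    (hu : x / (1 - x) ∈ Icc (k : ℝ) (k + 1)) :
    rayPathFun n t x =
      hatMk Om ((pol (t k) (rayAngle n k (x / (1 - x))) : ℂ) : OnePoint ℂ) := by
  rw [rayPathFun, if_pos hx, rayMap_eq h hu]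

theorem rayPathFun_nat (h : IsRay n t) {k : ℕ} {x : ℝ} (hx : x < 1) (hu : x / (1 - x) = k) :
    rayPathFun n t x = node (n k) := by
  rw [rayPathFun_eq h hx (k := k) (by rw [hu]; exact ⟨le_rfl, by linarith⟩), hu, rayAngle, sub_self,
    zero_mul, add_zero, h.hatMk_left]

theorem rayPathFun_cases (h : IsRay n t) {x : ℝ} (hx : x ∈ Icc (0 : ℝ) 1) :
    rayPathFun n t x = origin ∨ (∃ k, rayPathFun n t x = node (n k)) ∨ ∃ k, x ∈ arcTimes k := by
  rcases hx.2.eq_or_lt with rfl | hlt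
  · left; simp [rayPathFun]
  · right
    have h0 : 0 ≤ x / (1 - x) := div_nonneg hx.1 (by linarith)
    rcases (Nat.floor_le h0).eq_or_lt with he | hl
    · exact Or.inl ⟨_, rayPathFun_nat h hlt he.symm⟩
    · exact Or.inr ⟨_, mem_arcTimes_iff.2 ⟨hlt, hl, Nat.lt_floor_add_one _⟩⟩

theorem pol_rayAngle_mem_Om (h : IsRay n t) {k : ℕ} {u : ℝ} (hu : u ∈ Ioo (k : ℝ) (k + 1)) :
    ((pol (t k) (rayAngle n k u) : ℂ) : OnePoint ℂ) ∈ Om :=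
  pol_mem_Om (h.one_le k) (h.succ k) (h.time k) (rayAngle_mem_gap h hu)

theorem origin_mem_hatComponents : origin ∈ hatComponents Om := ⟨_, zero_mem_Om_compl, rfl⟩

theorem node_mem_hatComponents {m : ℕ} (hm : 1 ≤ m) : node m ∈ hatComponents Om :=
  ⟨_, tri_subset hm ⟨_, pol_label_mem_tripod m, rfl⟩, rfl⟩

theorem hatMk_notMem_hatComponents {G : Set (OnePoint ℂ)} {z : OnePoint ℂ} (hz : z ∈ G) :
    hatMk G z ∉ hatComponents G := by
  rintro ⟨w, hw, h⟩
  have : w ∈ fiber (hatMk G z) := h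
  rw [fiber_hatMk_of_mem hz] at this
  exact hw (this ▸ hz)

theorem fiber_node {m : ℕ} (hm : 1 ≤ m) : fiber (node m) = tri m :=
  fiber_eq_of_mem (tri_mem_complComponents hm) ⟨_, pol_label_mem_tripod m, rfl⟩

theorem node_ne_origin {m : ℕ} (hm : 1 ≤ m) : node m ≠ origin := fun h =>
  zero_notMem_tri (m := m) (by rw [← fiber_node hm, h]; exact mem_fiber_hatMk _)

theorem node_injOn : InjOn node (Ici 1) := by
  intro i hi j hj h
  by_contra hne
  have := disjoint_tri hi hj hne
  rw [← fiber_node hi, ← fiber_node hj, h, disjoint_self] at this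
  exact (isConnected_fiber (node j)).nonempty.ne_empty this

theorem rayPath_regular_subset (h : IsRay n t) : (rayPath h).regular ⊆ ⋃ k, arcTimes k := by
  rintro x ⟨hx, z, hz, hxz⟩
  rw [rayPath_ext h hx] at hxz
  have hn : rayPathFun n t x ∉ hatComponents Om := by
    rw [hxz]; exact hatMk_notMem_hatComponents hz
  rcases rayPathFun_cases h hx with h1 | ⟨k, h1⟩ | h1
  · exact absurd (h1 ▸ origin_mem_hatComponents) hn
  · exact absurd (h1 ▸ node_mem_hatComponents (h.one_le k)) hn
  · exact mem_iUnion.2 h1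

theorem rayPath_ext_arcTimes (h : IsRay n t) {k : ℕ} {x : ℝ} (hx : x ∈ arcTimes k) :
    (rayPath h).ext x =
      hatMk Om ((pol (t k) (rayAngle n k (x / (1 - x))) : ℂ) : OnePoint ℂ) := by
  have h1 := mem_arcTimes_iff.1 hx
  rw [rayPath_ext h (Ico_subset_Icc_self (arcTimes_subset k hx)),
    rayPathFun_eq h h1.1 (Ioo_subset_Icc_self h1.2)]

theorem arcTimes_subset_regular (h : IsRay n t) (k : ℕ) : arcTimes k ⊆ (rayPath h).regular :=
  fun _ hx => ⟨Ico_subset_Icc_self (arcTimes_subset k hx), _,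
    pol_rayAngle_mem_Om h (mem_arcTimes_iff.1 hx).2, rayPath_ext_arcTimes h hx⟩

/-- At all times outside the disjoint open intervals `arcTimes j` the path sits at a collapsed
component, so a connected set of regular times stays in one of them. -/
theorem subset_arcTimes (h : IsRay n t) {S : Set ℝ} (hS : IsPreconnected S)
    (hSr : S ⊆ (rayPath h).regular) {x : ℝ} (hx : x ∈ S) {k : ℕ} (hxk : x ∈ arcTimes k) :
    S ⊆ arcTimes k := by
  refine hS.subset_left_of_subset_union (v := ⋃ j ∈ {j | j ≠ k}, arcTimes j) isOpen_Ioo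
    (isOpen_biUnion fun _ _ => isOpen_Ioo) ?_ ?_ ⟨x, hx, hxk⟩
  · exact disjoint_iUnion₂_right.2 fun j hj => disjoint_arcTimes (Ne.symm hj)
  · intro y hy
    obtain ⟨j, hj⟩ := mem_iUnion.1 (rayPath_regular_subset h (hSr hy))
    rcases eq_or_ne j k with rfl | hne
    · exact Or.inl hj
    · exact Or.inr (mem_biUnion (show j ∈ {j | j ≠ k} from hne) hj)

theorem rayPath_plane (h : IsRay n t) {k : ℕ} {x : ℝ} (hx : x ∈ arcTimes k) :
    (rayPath h).plane x = pol (t k) (rayAngle n k (x / (1 - x))) := by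
  rw [HatPath.plane, rayPath_ext_arcTimes h hx]
  have hz := pol_rayAngle_mem_Om h (mem_arcTimes_iff.1 hx).2
  have : Quotient.out (hatMk Om ((pol (t k) (rayAngle n k (x / (1 - x))) : ℂ) : OnePoint ℂ)) ∈
      fiber (hatMk Om ((pol (t k) (rayAngle n k (x / (1 - x))) : ℂ) : OnePoint ℂ)) :=
    Quotient.out_eq _
  rw [fiber_hatMk_of_mem hz, mem_singleton_iff] at this
  rw [this]; rfl

theorem rayAngle_monotone_or_antitone (n : ℕ → ℕ) (k : ℕ) :
    Monotone (rayAngle n k) ∨ Antitone (rayAngle n k) := by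
  rcases le_total (label (n k)) (label (n (k + 1))) with hl | hl
  · exact Or.inl fun x y hxy => by simp only [rayAngle]; nlinarith
  · exact Or.inr fun x y hxy => by simp only [rayAngle]; nlinarith

theorem monotoneOn_div_one_sub {s : Set ℝ} (hs : s ⊆ Iio 1) :
    MonotoneOn (fun x : ℝ => x / (1 - x)) s := by
  intro x hx y hy hxy
  have h1 : x < 1 := hs hx
  have h2 : y < 1 := hs hy
  simp only
  rw [div_le_div_iff₀ (by linarith) (by linarith)]
  nlinarith

theorem arcTimes_angle {a b : ℝ} {k : ℕ} (hs : Icc a b ⊆ arcTimes k) :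
    ContinuousOn (fun x : ℝ => rayAngle n k (x / (1 - x))) (Icc a b) ∧
    (MonotoneOn (fun x : ℝ => rayAngle n k (x / (1 - x))) (Icc a b) ∨
      AntitoneOn (fun x : ℝ => rayAngle n k (x / (1 - x))) (Icc a b)) := by
  have hs1 : Icc a b ⊆ Iio 1 := fun x hx => (arcTimes_subset k (hs hx)).2
  constructor
  · have : ContinuousOn (fun x : ℝ => x / (1 - x)) (Icc a b) :=
      continuousOn_id.div (by fun_prop) fun x hx => by
        have : x < 1 := hs1 hx
        linarith
    exact continuousOn_const.add ((this.sub continuousOn_const).mul continuousOn_const)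
  · have hm := monotoneOn_div_one_sub hs1
    exact (rayAngle_monotone_or_antitone n k).imp (fun h' => h'.comp_monotoneOn hm)
      (fun h' => h'.comp_monotoneOn hm)

theorem rayPath_locallyRectifiable (h : IsRay n t) : (rayPath h).LocallyRectifiable := by
  intro a b hab
  rcases lt_or_ge b a with hlt | hle
  · rw [Icc_eq_empty hlt.not_ge, eVariationOn.subsingleton _ subsingleton_empty]
    exact ENNReal.zero_ne_top
  · obtain ⟨k, hk⟩ := mem_iUnion.1 (rayPath_regular_subset h (hab (left_mem_Icc.2 hle)))
    have hs := subset_arcTimes h isPreconnected_Icc hab (left_mem_Icc.2 hle) hk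
    obtain ⟨hc, hm⟩ := arcTimes_angle (n := n) hs
    rw [eVariationOn_arc hle hc hm fun x hx => rayPath_plane h (hs hx)]
    exact ENNReal.ofReal_ne_top

theorem rayPath_lineIntegral_le (h : IsRay n t) (ρ : Hat Om → ℝ≥0∞) :
    (rayPath h).lineIntegral ρ ≤
      ∑' k, arcCost (fun z => ρ (hatMk Om (z : OnePoint ℂ))) (n k) (n (k + 1)) (t k) := by
  -- The component in the arc `k` contains a fixed time of that arc, so it is determined by `k`;
  -- this makes the indexing injective.
  have key : ∀ C : {C : Set ℝ // ∃ x ∈ (rayPath h).regular,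
      C = connectedComponentIn (rayPath h).regular x}, ∃ k, C.1 ⊆ arcTimes k ∧
        C.1 = connectedComponentIn (rayPath h).regular (((k : ℝ) + 1 / 2) / ((k : ℝ) + 3 / 2)) := by
    rintro ⟨C, x, hx, rfl⟩
    obtain ⟨k, hk⟩ := mem_iUnion.1 (rayPath_regular_subset h hx)
    refine ⟨k, subset_arcTimes h isPreconnected_connectedComponentIn
      (connectedComponentIn_subset _ _) (mem_connectedComponentIn hx) hk, ?_⟩
    refine connectedComponentIn_eq (isPreconnected_Ioo.subset_connectedComponentIn hk
      (arcTimes_subset_regular h k) ?_)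
    have hk0 : (0 : ℝ) ≤ k := Nat.cast_nonneg k
    constructor
    · rw [div_lt_div_iff₀ (by positivity) (by positivity)]; nlinarith
    · rw [div_lt_div_iff₀ (by positivity) (by positivity)]; nlinarith
  choose κ hκ1 hκ2 using key
  have hinj : Function.Injective κ := fun C C' hCC => Subtype.ext (by rw [hκ2 C, hκ2 C', hCC])
  rw [HatPath.lineIntegral]
  refine le_trans (ENNReal.tsum_le_tsum fun C => ?_)
    (ENNReal.tsum_comp_le_tsum_of_injective hinj _)
  refine iSup₂_le fun a b => iSup₂_le fun hab hC => ?_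
  have hs := hC.trans (hκ1 C)
  obtain ⟨hc, hm⟩ := arcTimes_angle (n := n) hs
  refine arcIntegral_le hab hc hm (fun x hx => rayPath_plane h (hs hx)) ?_ _
  rintro - ⟨x, hx, rfl⟩
  exact rayAngle_mem_gap h (mem_arcTimes_iff.1 (hs hx)).2

theorem rayPath_componentSum_le (h : IsRay n t) (ρ : Hat Om → ℝ≥0∞) :
    (rayPath h).componentSum ρ ≤ ρ origin + ∑' k, ρ (node (n k)) := by
  set g : ℕ → Hat Om := fun i => i.casesOn origin fun k => node (n k) with hg
  have key : ∀ q : {q : Hat Om // q ∈ hatComponents Om ∧ q ∈ range (rayPath h)},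
      ∃ i, g i = q.1 := by
    rintro ⟨-, hq, ⟨x, hx⟩, rfl⟩
    have hq' : rayPathFun n t x ∈ hatComponents Om := hq
    rcases rayPathFun_cases h hx with h1 | ⟨k, h1⟩ | ⟨k, h1⟩
    · exact ⟨0, h1.symm⟩
    · exact ⟨k + 1, h1.symm⟩
    · rw [← rayPath_ext h hx, rayPath_ext_arcTimes h h1] at hq'
      exact absurd hq' (hatMk_notMem_hatComponents
        (pol_rayAngle_mem_Om h (mem_arcTimes_iff.1 h1).2))
  choose κ hκ using key
  have hinj : Function.Injective κ := fun q q' hqq => Subtype.ext (by rw [← hκ q, ← hκ q', hqq])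
  calc (rayPath h).componentSum ρ = ∑' q, ρ (g (κ q)) := by
        rw [HatPath.componentSum]; exact tsum_congr fun q => by rw [hκ]
    _ ≤ ∑' i, ρ (g i) := ENNReal.tsum_comp_le_tsum_of_injective hinj fun i => ρ (g i)
    _ = _ := tsum_eq_zero_add' ENNReal.summable

theorem rayPath_mem_joiningPaths (h : IsRay n t) : rayPath h ∈ joiningPaths (node 1) origin := by
  constructor
  · change rayPathFun n t 0 = node 1
    rw [rayPathFun_nat h (k := 0) one_pos (by simp), h.zero]
  · change rayPathFun n t 1 = origin
    simp [rayPathFun]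

/-- The index `0` gets weight zero because the tree, and hence the family of tripods, starts at `1`.
-/
theorem tsum_node_sq_le (ρ : Hat Om → ℝ≥0∞) :
    ∑' m, (if 1 ≤ m then ρ (node m) else 0) ^ 2 ≤
      ∑' q : {q : Hat Om // q ∈ hatComponents Om}, ρ q.1 ^ 2 := by
  set e : ℕ → {q : Hat Om // q ∈ hatComponents Om} := fun m =>
    ⟨node (m + 1), node_mem_hatComponents (Nat.le_add_left 1 m)⟩ with he
  have hinj : Function.Injective e := fun i j hij => by
    have := node_injOn (Nat.le_add_left 1 i) (Nat.le_add_left 1 j) (congrArg Subtype.val hij)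
    omega
  refine le_trans (le_of_eq ?_) (ENNReal.tsum_comp_le_tsum_of_injective hinj fun q => ρ q.1 ^ 2)
  rw [tsum_eq_zero_add' ENNReal.summable]
  simp [he]

/-- The paths from the first tripod to the origin have positive transboundary modulus. -/
theorem modulus_pos : 0 < transboundaryModulus (joiningPaths (node 1) origin) := by
  refine lt_of_lt_of_le (b := ENNReal.ofReal (1 / 4096)) (by
    rw [ENNReal.ofReal_pos]; norm_num) (le_iInf₂ fun ρ hρ => ?_)
  by_contra! hlt
  rw [energy] at hlt
  have h1 := (le_self_add.trans hlt.le : _ ≤ ENNReal.ofReal (1 / 4096))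
  have h2 := (le_add_self.trans hlt.le : _ ≤ ENNReal.ofReal (1 / 4096))
  have hmeas : Measurable fun z : ℂ => ρ (hatMk Om (z : OnePoint ℂ)) := by
    have hb : @BorelSpace (Hat Om) _ (instMeasurableSpaceHat Om) := ⟨rfl⟩
    exact hρ.1.comp (continuous_hatMk.comp OnePoint.continuous_coe).measurable
  obtain ⟨n, t, h0, hs, ht, hle⟩ := exists_cheap_ray hmeas h1 ((tsum_node_sq_le ρ).trans h2)
  have h : IsRay n t := ⟨h0, hs, ht⟩
  have ho : ρ origin ≤ ENNReal.ofReal (1 / 64) := by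
    have h3 : ρ origin ^ 2 ≤ ENNReal.ofReal (1 / 4096) := le_trans (ENNReal.le_tsum
      (f := fun q : {q : Hat Om // q ∈ hatComponents Om} => ρ q.1 ^ 2)
      ⟨origin, origin_mem_hatComponents⟩) h2
    have h4 : ENNReal.ofReal (1 / 4096) = ENNReal.ofReal (1 / 64) ^ 2 := by
      rw [← ENNReal.ofReal_pow (by norm_num)]; norm_num
    rw [h4] at h3
    exact (ENNReal.pow_le_pow_left_iff two_ne_zero).1 h3
  have h5 := hρ.2 _ (rayPath_mem_joiningPaths h) (rayPath_locallyRectifiable h)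
  have h6 : ∀ k, (if 1 ≤ n k then ρ (node (n k)) else 0) = ρ (node (n k)) := fun k =>
    if_pos (h.one_le k)
  simp only [h6] at hle
  -- The origin is itself a complementary component met by the path, hence the additional `1 / 64`;
  -- the total is still below `1`.
  have h7 : (1 : ℝ≥0∞) ≤ ENNReal.ofReal (1 / 64) + ENNReal.ofReal (1 / 2) :=
    calc (1 : ℝ≥0∞) ≤ _ := h5
      _ ≤ _ + (ρ origin + _) := add_le_add (rayPath_lineIntegral_le h ρ)
          (rayPath_componentSum_le h ρ)
      _ = ρ origin + _ := by rw [add_left_comm]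
      _ ≤ _ := add_le_add ho hle
  rw [← ENNReal.ofReal_add (by norm_num) (by norm_num), ENNReal.one_le_ofReal] at h7
  norm_num at h7

theorem exists_modulus_pos : ∃ q : Hat Om, fiber q ∈ nonpointComponents Om ∧
    0 < transboundaryModulus (joiningPaths q (hatMk Om ((0 : ℂ) : OnePoint ℂ))) :=
  ⟨node 1, by rw [fiber_node le_rfl, nonpointComponents_Om]; exact ⟨1, mem_Ici.2 le_rfl, rfl⟩, modulus_pos⟩

end

section

/-! ### Conformal maps are homeomorphisms -/

theorem toC_coe (z : ℂ) : toC (z : OnePoint ℂ) = z := rfl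

theorem coe_toC {z : OnePoint ℂ} (hz : z ≠ OnePoint.infty) : ((toC z : ℂ) : OnePoint ℂ) = z := by
  obtain ⟨w, rfl⟩ := OnePoint.ne_infty_iff_exists.1 hz
  rfl

theorem sphereInv_infty : sphereInv OnePoint.infty = ((0 : ℂ) : OnePoint ℂ) := if_pos rfl

theorem sphereInv_zero : sphereInv ((0 : ℂ) : OnePoint ℂ) = OnePoint.infty := by
  rw [sphereInv, if_neg (OnePoint.coe_ne_infty _), if_pos rfl]

theorem sphereInv_coe {z : ℂ} (hz : z ≠ 0) :
    sphereInv (z : OnePoint ℂ) = ((z⁻¹ : ℂ) : OnePoint ℂ) := by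
  rw [sphereInv, if_neg (OnePoint.coe_ne_infty _), if_neg (by rwa [OnePoint.coe_eq_coe]), toC_coe]

theorem toC_sphereInv_coe (z : ℂ) : toC (sphereInv (z : OnePoint ℂ)) = z⁻¹ := by
  rcases eq_or_ne z 0 with rfl | hz
  · rw [sphereInv_zero, inv_zero]; rfl
  · rw [sphereInv_coe hz, toC_coe]

theorem sphereInv_involutive : Function.Involutive sphereInv := by
  intro z
  induction z using OnePoint.rec with
  | infty => rw [sphereInv_infty, sphereInv_zero]
  | coe z =>
    rcases eq_or_ne z 0 with rfl | hz
    · rw [sphereInv_zero, sphereInv_infty]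
    · rw [sphereInv_coe hz, sphereInv_coe (inv_ne_zero hz), inv_inv]

theorem continuous_sphereInv : Continuous sphereInv := by
  rw [continuous_iff_continuousAt]
  intro z
  induction z using OnePoint.rec with
  | infty =>
    rw [OnePoint.continuousAt_infty', sphereInv_infty, Filter.coclosedCompact_eq_cocompact,
      ← Metric.cobounded_eq_cocompact]
    refine ((OnePoint.continuous_coe.tendsto (0 : ℂ)).comp
      Filter.tendsto_inv₀_cobounded).congr' ?_
    filter_upwards [Bornology.isBounded_def.1 (Bornology.isBounded_singleton (x := (0 : ℂ)))] with z hz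
    exact (sphereInv_coe hz).symm
  | coe z =>
    rw [OnePoint.continuousAt_coe]
    rcases eq_or_ne z 0 with rfl | hz
    · rw [ContinuousAt, Function.comp_apply, sphereInv_zero, ← nhdsNE_sup_pure, Filter.tendsto_sup]
      constructor
      · have h : Filter.Tendsto (fun z : ℂ => ((z⁻¹ : ℂ) : OnePoint ℂ)) (𝓝[≠] 0)
            (𝓝 OnePoint.infty) := by
          refine OnePoint.tendsto_coe_infty.comp ?_
          rw [Filter.coclosedCompact_eq_cocompact, ← Metric.cobounded_eq_cocompact]
          exact Filter.tendsto_inv₀_nhdsNE_zero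
        refine h.congr' ?_
        filter_upwards [self_mem_nhdsWithin] with z hz
        exact (sphereInv_coe hz).symm
      · rw [Filter.tendsto_pure_left]
        intro s hs
        rw [Function.comp_apply, sphereInv_zero]
        exact mem_of_mem_nhds hs
    · have h : ContinuousAt (fun z : ℂ => ((z⁻¹ : ℂ) : OnePoint ℂ)) z :=
        OnePoint.continuous_coe.continuousAt.comp (continuousAt_inv₀ hz)
      refine h.congr ?_
      filter_upwards [isOpen_ne.mem_nhds hz] with w hw
      exact (sphereInv_coe hw).symm

theorem chart_infty (v : OnePoint ℂ) : chart OnePoint.infty v = toC (sphereInv v) := by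
  rw [chart, if_pos rfl]

theorem chart_of_ne {p : OnePoint ℂ} (hp : p ≠ OnePoint.infty) (v : OnePoint ℂ) :
    chart p v = toC v := by
  rw [chart, if_neg hp]

theorem chartSymm_infty (w : ℂ) : chartSymm OnePoint.infty w = sphereInv (w : OnePoint ℂ) := by
  rw [chartSymm, if_pos rfl]

theorem chartSymm_of_ne {p : OnePoint ℂ} (hp : p ≠ OnePoint.infty) (w : ℂ) :
    chartSymm p w = (w : OnePoint ℂ) := by
  rw [chartSymm, if_neg hp]

theorem chartSymm_chart_self (p : OnePoint ℂ) : chartSymm p (chart p p) = p := by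
  rcases eq_or_ne p OnePoint.infty with rfl | hp
  · rw [chart_infty, chartSymm_infty, sphereInv_infty, toC_coe, sphereInv_zero]
  · rw [chart_of_ne hp, chartSymm_of_ne hp, coe_toC hp]

theorem map_chartSymm_nhds (p : OnePoint ℂ) :
    Filter.map (chartSymm p) (𝓝 (chart p p)) = 𝓝 p := by
  rcases eq_or_ne p OnePoint.infty with rfl | hp
  · have h1 : chartSymm OnePoint.infty = sphereInv ∘ ((↑) : ℂ → OnePoint ℂ) :=
      funext chartSymm_infty
    have h2 := (continuous_sphereInv.homeoOfEquivCompactToT2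
      (f := sphereInv_involutive.toPerm)).map_nhds_eq ((0 : ℂ) : OnePoint ℂ)
    have h3 : Filter.map sphereInv (𝓝 ((0 : ℂ) : OnePoint ℂ)) = 𝓝 (sphereInv ((0 : ℂ) : OnePoint ℂ)) :=
      h2
    rw [chart_infty, sphereInv_infty, toC_coe, h1, ← Filter.map_map, ← OnePoint.nhds_coe_eq, h3,
      sphereInv_zero]
  · have h1 : chartSymm p = ((↑) : ℂ → OnePoint ℂ) := funext (chartSymm_of_ne hp)
    rw [h1, ← OnePoint.nhds_coe_eq, chart_of_ne hp, coe_toC hp]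

theorem eventually_chartSymm_chart (p : OnePoint ℂ) :
    ∀ᶠ v in 𝓝 p, chartSymm p (chart p v) = v := by
  rcases eq_or_ne p OnePoint.infty with rfl | hp
  · filter_upwards [isOpen_ne.mem_nhds (OnePoint.infty_ne_coe (0 : ℂ))] with v hv
    rw [chart_infty, chartSymm_infty, coe_toC, sphereInv_involutive]
    intro h
    exact hv (by rw [← sphereInv_involutive v, h, sphereInv_infty])
  · filter_upwards [isOpen_ne.mem_nhds hp] with v hv
    rw [chart_of_ne hp, chartSymm_of_ne hp, coe_toC hv]

/-! ### Openness of injective holomorphic maps of the sphere. -/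

variable {f : OnePoint ℂ → OnePoint ℂ} {G G' : Set (OnePoint ℂ)}

theorem HolomorphicAtPoint.differentiableAt_toC {a : ℂ} (h : HolomorphicAtPoint f a)
    (ha : f a ≠ OnePoint.infty) : DifferentiableAt ℂ (fun w : ℂ => toC (f w)) a := by
  have := h.2
  simp only [chart_of_ne ha, chart_of_ne (OnePoint.coe_ne_infty a),
    chartSymm_of_ne (OnePoint.coe_ne_infty a), toC_coe] at this
  exact this

theorem HolomorphicAtPoint.differentiableAt_chart {a : ℂ} (h : HolomorphicAtPoint f a)
    (ha : f a ≠ OnePoint.infty) {p : OnePoint ℂ}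
    (hp : p = OnePoint.infty → f a ≠ ((0 : ℂ) : OnePoint ℂ)) :
    DifferentiableAt ℂ (fun w : ℂ => chart p (f w)) a := by
  have hd := h.differentiableAt_toC ha
  rcases eq_or_ne p OnePoint.infty with rfl | hpi
  · have h0 : toC (f a) ≠ 0 := fun h0 => hp rfl (by rw [← coe_toC ha, h0])
    refine (hd.inv h0).congr_of_eventuallyEq ?_
    have hc : ContinuousAt (fun w : ℂ => f w) a := h.1.comp OnePoint.continuous_coe.continuousAt
    filter_upwards [hc.eventually (isOpen_ne.mem_nhds ha)] with w hw
    obtain ⟨v, hv⟩ := OnePoint.ne_infty_iff_exists.1 hw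
    rw [chart_infty, Pi.inv_apply, ← hv, toC_sphereInv_coe, toC_coe]
  · simpa only [chart_of_ne hpi] using hd

/-- `HolomorphicAtPoint` uses at each point that point's own charts; analyticity at `z` needs
differentiability nearby in the fixed charts of `z` and `f z`. Near `z`, injectivity or continuity
keeps finite values finite, and values close to `∞` differ from `0`, where the chart at `∞` has a
default value. -/
theorem eventually_differentiableAt_chart (hG : IsOpen G) (hf : ∀ z ∈ G, HolomorphicAtPoint f z)
    (hi : InjOn f G) {z : OnePoint ℂ} (hz : z ∈ G) :
    ∀ᶠ w in 𝓝 (chart z z),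
      DifferentiableAt ℂ (fun w : ℂ => chart (f z) (f (chartSymm z w))) w := by
  have hcs : Filter.Tendsto (chartSymm z) (𝓝 (chart z z)) (𝓝 z) := (map_chartSymm_nhds z).le
  have h1 : ∀ᶠ w in 𝓝 (chart z z), chartSymm z w ∈ G := hcs.eventually (hG.mem_nhds hz)
  have h2 : ∀ᶠ w in 𝓝 (chart z z), f z ≠ OnePoint.infty → f (chartSymm z w) ≠ OnePoint.infty := by
    by_cases h : f z = OnePoint.infty
    · exact Filter.Eventually.of_forall fun _ h' => absurd h h'
    · filter_upwards [((hf z hz).1.tendsto.comp hcs).eventually (isOpen_ne.mem_nhds h)] with w hw _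
      exact hw
  have h3 : ∀ᶠ w in 𝓝 (chart z z), f z = OnePoint.infty →
      f (chartSymm z w) ≠ ((0 : ℂ) : OnePoint ℂ) := by
    by_cases h : f z = OnePoint.infty
    · have h0 : f z ≠ ((0 : ℂ) : OnePoint ℂ) := h ▸ OnePoint.infty_ne_coe _
      filter_upwards [((hf z hz).1.tendsto.comp hcs).eventually (isOpen_ne.mem_nhds h0)] with w hw _
      exact hw
    · exact Filter.Eventually.of_forall fun _ h' => absurd h' h
  filter_upwards [h1, h2, h3] with w hw1 hw2 hw3
  rcases eq_or_ne w (chart z z) with rfl | hne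
  · exact (hf z hz).2
  rcases eq_or_ne z OnePoint.infty with rfl | hzi
  · rw [chart_infty, sphereInv_infty, toC_coe] at hne
    have e : chartSymm OnePoint.infty w = ((w⁻¹ : ℂ) : OnePoint ℂ) := by
      rw [chartSymm_infty, sphereInv_coe hne]
    rw [e] at hw1 hw2 hw3
    have hfin : f ((w⁻¹ : ℂ) : OnePoint ℂ) ≠ OnePoint.infty := by
      by_cases h : f OnePoint.infty = OnePoint.infty
      · intro h'
        exact OnePoint.coe_ne_infty _ (hi hw1 hz (h'.trans h.symm))
      · exact hw2 h
    have hd := (hf _ hw1).differentiableAt_chart hfin hw3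
    refine (hd.comp w (differentiableAt_inv hne)).congr_of_eventuallyEq ?_
    filter_upwards [isOpen_ne.mem_nhds hne] with v hv
    rw [chartSymm_infty, sphereInv_coe hv]; rfl
  · have e : ∀ w, chartSymm z w = (w : OnePoint ℂ) := chartSymm_of_ne hzi
    simp only [e] at hw1 hw2 hw3 ⊢
    have hfin : f (w : OnePoint ℂ) ≠ OnePoint.infty := by
      by_cases h : f z = OnePoint.infty
      · intro h'
        refine hne ?_
        rw [chart_of_ne hzi, ← hi hw1 hz (h'.trans h.symm), toC_coe]
      · exact hw2 h
    exact (hf _ hw1).differentiableAt_chart hfin hw3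

/-- The open mapping theorem in charts; injectivity rules out the locally constant case because no
point of the sphere is isolated. -/
theorem nhds_le_map_nhds (hG : IsOpen G) (hf : ∀ z ∈ G, HolomorphicAtPoint f z)
    (hi : InjOn f G) {z : OnePoint ℂ} (hz : z ∈ G) : 𝓝 (f z) ≤ Filter.map f (𝓝 z) := by
  set φ : ℂ → ℂ := fun w => chart (f z) (f (chartSymm z w)) with hφ
  have hcs : Filter.Tendsto (chartSymm z) (𝓝 (chart z z)) (𝓝 z) := (map_chartSymm_nhds z).le
  have hev : ∀ᶠ w in 𝓝 (chart z z), chartSymm (f z) (φ w) = f (chartSymm z w) :=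
    ((hf z hz).1.tendsto.comp hcs).eventually (eventually_chartSymm_chart (f z))
  have hφ0 : φ (chart z z) = chart (f z) (f z) := by simp only [hφ, chartSymm_chart_self]
  have han : AnalyticAt ℂ φ (chart z z) :=
    Complex.analyticAt_iff_eventually_differentiableAt.2
      (eventually_differentiableAt_chart hG hf hi hz)
  rcases han.eventually_constant_or_nhds_le_map_nhds with hconst | hle
  · exfalso
    have hcsi : ∀ᶠ w in 𝓝 (chart z z), chartSymm z w = z := by
      filter_upwards [hconst, hev, hcs.eventually (hG.mem_nhds hz)] with w h1 h2 h3
      refine hi h3 hz ?_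
      rw [← h2, h1, hφ0, chartSymm_chart_self]
    have : {z} ∈ 𝓝 z := by
      rw [← map_chartSymm_nhds z]
      exact hcsi
    have hb : (𝓝[≠] z).NeBot := inferInstance
    exact hb.ne (mem_nhds_iff.1 this |>.elim fun t ht => by
      rw [← Filter.empty_mem_iff_bot, mem_nhdsWithin]
      exact ⟨t, ht.2.1, ht.2.2, fun x hx => hx.2 (ht.1 hx.1)⟩)
  · rw [hφ0] at hle
    calc 𝓝 (f z) = Filter.map (chartSymm (f z)) (𝓝 (chart (f z) (f z))) :=
          (map_chartSymm_nhds _).symm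
      _ ≤ Filter.map (chartSymm (f z)) (Filter.map φ (𝓝 (chart z z))) := Filter.map_mono hle
      _ = Filter.map (fun w => f (chartSymm z w)) (𝓝 (chart z z)) := by
          rw [Filter.map_map]; exact Filter.map_congr hev
      _ = Filter.map f (𝓝 z) := by 
          rw [← map_chartSymm_nhds z, Filter.map_map, Function.comp_def]

theorem exists_hatExtension_of_isConformalOnto (hG : IsSphereDomain G) (hG' : IsSphereDomain G')
    (hf : IsConformalOnto f G G') : ∃ F : Hat G ≃ₜ Hat G', IsHatExtension f F := by
  have hinv := hf.1.invOn_invFunOn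
  have hgm : MapsTo (Function.invFunOn f G) G' G := hf.1.surjOn.mapsTo_invFunOn
  refine exists_homeomorph_hat_extension (g := Function.invFunOn f G) hG hG'
    (fun z hz => (hf.2 z hz).1.continuousWithinAt) ?_ hf.1.mapsTo hgm hinv.1 hinv.2
  intro y hy
  rw [ContinuousWithinAt]
  intro N hN
  rw [Filter.mem_map]
  have hz := hgm hy
  have h1 := nhds_le_map_nhds hG.1 hf.2 hf.1.injOn hz
  rw [hinv.2 hy] at h1
  refine mem_nhdsWithin_of_mem_nhds (Filter.mem_of_superset (h1 (Filter.image_mem_map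
    (Filter.inter_mem hN (hG.1.mem_nhds hz)))) ?_)
  rintro - ⟨x, ⟨hxN, hxG⟩, rfl⟩
  rw [mem_preimage, hinv.1 hxG]
  exact hxN

end

section

open MeasureTheory

/-! ### Annuli around a point -/

/-- The closed annulus with radii `R` and `2 R`. -/
def annulus (c : ℂ) (R : ℝ) : Set ℂ := {z | ‖z - c‖ ∈ Icc R (2 * R)}

theorem sphere_meets {c : ℂ} {s : ℝ} {T : Set (OnePoint ℂ)} (hT : IsPreconnected T)
    (h1 : (T ∩ (fun z : ℂ => (z : OnePoint ℂ)) '' Metric.ball c s).Nonempty)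
    (h2 : (T ∩ ((fun z : ℂ => (z : OnePoint ℂ)) '' Metric.closedBall c s)ᶜ).Nonempty) :
    ∃ z : ℂ, ‖z - c‖ = s ∧ (z : OnePoint ℂ) ∈ T := by
  by_contra! hno
  obtain ⟨x, -, ⟨z, hz, rfl⟩, hx⟩ := hT _ _
    (OnePoint.isOpenEmbedding_coe.isOpenMap _ Metric.isOpen_ball)
    (isClosed_image_coe (isCompact_closedBall c s)).isOpen_compl (fun x hx => by
      by_cases h : x ∈ (fun z : ℂ => (z : OnePoint ℂ)) '' Metric.closedBall c s
      · obtain ⟨z, hz, rfl⟩ := h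
        refine Or.inl ⟨z, ?_, rfl⟩
        rw [mem_closedBall_iff_norm] at hz
        exact mem_ball_iff_norm.2 (lt_of_le_of_ne hz fun e => hno z e hx)
      · exact Or.inr h) h1 h2
  exact hx ⟨z, Metric.ball_subset_closedBall hz, rfl⟩

/-- `I R` is the side of the annulus containing `w₀`, and `B R` is that side together with the
annulus. For `w₀ = ∞` the sides are reversed, the annuli are centred at `0` and their radii become
large. -/
theorem exists_annulus_basis (w₀ : OnePoint ℂ) :
    ∃ (c : ℂ) (I B : ℝ → Set (OnePoint ℂ)),
      (∀ R, 0 < R → IsOpen (I R) ∧ w₀ ∈ I R ∧ I R ⊆ B R ∧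
        (∀ z : ℂ, z ∈ annulus c R → (z : OnePoint ℂ) ∈ B R ∧ (z : OnePoint ℂ) ∉ I R) ∧
        ∀ s ∈ Icc R (2 * R), ∀ T, IsPreconnected T → (T ∩ I R).Nonempty →
          (T ∩ (B R)ᶜ).Nonempty → ∃ z : ℂ, ‖z - c‖ = s ∧ (z : OnePoint ℂ) ∈ T) ∧
      ∀ V, IsOpen V → w₀ ∈ V → ∃ R, 0 < R ∧ B R ⊆ V := by
  have hball : ∀ (c : ℂ) R, IsOpen ((fun z : ℂ => (z : OnePoint ℂ)) '' Metric.ball c R) :=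
    fun c R => OnePoint.isOpenEmbedding_coe.isOpenMap _ Metric.isOpen_ball
  induction w₀ using OnePoint.rec with
  | infty =>
    refine ⟨0, fun R => ((fun z : ℂ => (z : OnePoint ℂ)) '' Metric.closedBall 0 (2 * R))ᶜ,
      fun R => ((fun z : ℂ => (z : OnePoint ℂ)) '' Metric.ball 0 R)ᶜ, fun R hR =>
      ⟨(isClosed_image_coe (isCompact_closedBall _ _)).isOpen_compl, ?_, ?_, ?_, ?_⟩, ?_⟩
    · rintro ⟨z, -, hz⟩
      exact OnePoint.coe_ne_infty z hz
    · exact compl_subset_compl.2 (image_mono (Metric.ball_subset_closedBall.trans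
        (Metric.closedBall_subset_closedBall (by linarith))))
    · rintro z ⟨h1, h2⟩
      constructor
      · rintro ⟨w, hw, h⟩
        rw [OnePoint.coe_injective h, mem_ball_iff_norm] at hw
        linarith
      · exact fun h => h ⟨z, mem_closedBall_iff_norm.2 h2, rfl⟩
    · intro s hs T hT h1 h2
      refine sphere_meets hT (h2.mono (inter_subset_inter_right _ ?_))
        (h1.mono (inter_subset_inter_right _ ?_))
      · rw [compl_compl]
        exact image_mono (Metric.ball_subset_ball hs.1)
      · exact compl_subset_compl.2 (image_mono (Metric.closedBall_subset_closedBall hs.2))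
    · intro V hV hVi
      obtain ⟨R, hR⟩ := ((OnePoint.isOpen_iff_of_mem hVi).1 hV).2.isBounded.subset_ball 0
      refine ⟨max R 1, by positivity, ?_⟩
      rw [compl_subset_comm]
      intro x hx
      have hxi : x ≠ OnePoint.infty := fun h => hx (h.symm ▸ hVi)
      obtain ⟨z, rfl⟩ := OnePoint.ne_infty_iff_exists.1 hxi
      exact ⟨z, Metric.ball_subset_ball (le_max_left _ _) (hR hx), rfl⟩
  | coe c =>
    refine ⟨c, fun R => (fun z : ℂ => (z : OnePoint ℂ)) '' Metric.ball c R,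
      fun R => (fun z : ℂ => (z : OnePoint ℂ)) '' Metric.closedBall c (2 * R), fun R hR =>
      ⟨hball c R, ⟨c, Metric.mem_ball_self hR, rfl⟩, ?_, ?_, ?_⟩, ?_⟩
    · exact image_mono (Metric.ball_subset_closedBall.trans
        (Metric.closedBall_subset_closedBall (by linarith)))
    · rintro z ⟨h1, h2⟩
      refine ⟨⟨z, mem_closedBall_iff_norm.2 h2, rfl⟩, ?_⟩
      rintro ⟨w, hw, h⟩
      rw [OnePoint.coe_injective h, mem_ball_iff_norm] at hw
      linarith
    · intro s hs T hT h1 h2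
      refine sphere_meets hT (h1.mono (inter_subset_inter_right _ ?_))
        (h2.mono (inter_subset_inter_right _ ?_))
      · exact image_mono (Metric.ball_subset_ball hs.1)
      · exact compl_subset_compl.2 (image_mono (Metric.closedBall_subset_closedBall hs.2))
    · intro V hV hcV
      obtain ⟨ε, hε, h⟩ := Metric.nhds_basis_closedBall.mem_iff.1
        ((hV.preimage OnePoint.continuous_coe).mem_nhds hcV)
      refine ⟨ε / 2, by positivity, ?_⟩
      rintro - ⟨z, hz, rfl⟩
      rw [mul_div_cancel₀ _ (two_ne_zero' ℝ)] at hz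
      exact h hz

variable {D : Set (OnePoint ℂ)}

/-- Around a point-component there are infinitely many annuli such that no complementary
component meets two of them. -/
theorem exists_annuli (hD : IsOpen D) {w₀ : OnePoint ℂ} (hw : fiber (hatMk D w₀) = {w₀})
    {Q : Set (OnePoint ℂ)} (hQ : IsClosed Q) (hwQ : w₀ ∉ Q) :
    ∃ (c : ℂ) (R : ℕ → ℝ), (∀ j, 0 < R j) ∧
      (∀ i j, i ≠ j → ∀ z ∈ annulus c (R i), ∀ z' ∈ annulus c (R j),
        hatMk D (z : OnePoint ℂ) ≠ hatMk D (z' : OnePoint ℂ)) ∧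
      (∀ j, ∀ z ∈ annulus c (R j), hatMk D (z : OnePoint ℂ) ≠ hatMk D OnePoint.infty ∧
        hatMk D (z : OnePoint ℂ) ≠ hatMk D w₀) ∧
      ∀ j, ∀ s ∈ Icc (R j) (2 * R j), ∀ T, IsPreconnected T → w₀ ∈ T → (T ∩ Q).Nonempty →
        ∃ z : ℂ, ‖z - c‖ = s ∧ (z : OnePoint ℂ) ∈ T := by
  obtain ⟨c, I, B, h, hbasis⟩ := exists_annulus_basis w₀
  -- As `w₀` is a whole fibre, upper semicontinuity gives an annulus so close to `w₀` that every
  -- fibre meeting it stays in `V`.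
  have step : ∀ V : Set (OnePoint ℂ), ∃ R, IsOpen V → w₀ ∈ V →
      0 < R ∧ ∀ z ∈ B R, fiber (hatMk D z) ⊆ V := by
    intro V
    by_cases hV : IsOpen V ∧ w₀ ∈ V
    · obtain ⟨R, hR, hBR⟩ := hbasis (hatMk D ⁻¹' {q | fiber q ⊆ V})
        ((isOpen_fiber_subset hD hV.1).preimage continuous_hatMk) (by
          change fiber (hatMk D w₀) ⊆ V
          rw [hw]
          exact singleton_subset_iff.2 hV.2)
      exact ⟨R, fun _ _ => ⟨hR, fun z hz => hBR hz⟩⟩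
    · exact ⟨0, fun h1 h2 => absurd ⟨h1, h2⟩ hV⟩
  choose r hr using step
  -- Excluding `∞` guarantees that the components meeting the annuli are bounded, hence Euclidean
  -- disks. If `w₀ = ∞` this follows from avoiding `w₀`.
  obtain ⟨C, hC, hwC, hinf⟩ : ∃ C : Set (OnePoint ℂ), IsClosed C ∧ w₀ ∉ C ∧
      (w₀ ≠ OnePoint.infty → OnePoint.infty ∈ C) := by
    by_cases hwi : w₀ = OnePoint.infty
    · exact ⟨∅, isClosed_empty, notMem_empty _, fun h => absurd hwi h⟩
    · refine ⟨{OnePoint.infty}, isClosed_singleton, hwi, fun _ => rfl⟩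
  have hV0 : IsOpen (Q ∪ C)ᶜ := (hQ.union hC).isOpen_compl
  have hwV0 : w₀ ∈ (Q ∪ C)ᶜ := fun h => h.elim hwQ hwC
  -- Each annulus is chosen so that the fibres meeting its `B`-side lie strictly inside the
  -- preceding annulus; thus no fibre meets two.
  let R : ℕ → ℝ := fun j => j.rec (r (Q ∪ C)ᶜ) fun _ x => r (I x)
  have hR0 : 0 < R 0 ∧ ∀ z ∈ B (R 0), fiber (hatMk D z) ⊆ (Q ∪ C)ᶜ := hr _ hV0 hwV0
  have hRs : ∀ j, 0 < R j → 0 < R (j + 1) ∧ ∀ z ∈ B (R (j + 1)), fiber (hatMk D z) ⊆ I (R j) :=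
    fun j hj => hr _ (h _ hj).1 (h _ hj).2.1
  have hR : ∀ j, 0 < R j := fun j => by
    induction j with
    | zero => exact hR0.1
    | succ j ih => exact (hRs j ih).1
  have hanti : ∀ j, B (R (j + 1)) ⊆ B (R j) := fun j z hz =>
    (h _ (hR j)).2.2.1 ((hRs j (hR j)).2 z hz (mem_fiber_hatMk z))
  have hBanti : Antitone fun j => B (R j) := antitone_nat_of_succ_le hanti
  have hlt : ∀ i j, i < j → ∀ z ∈ annulus c (R i), ∀ z' ∈ annulus c (R j),
      hatMk D (z : OnePoint ℂ) ≠ hatMk D (z' : OnePoint ℂ) := by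
    intro i j hij z hz z' hz' heq
    have h1 : (z' : OnePoint ℂ) ∈ B (R (i + 1)) :=
      hBanti (Nat.succ_le_of_lt hij) ((h _ (hR j)).2.2.2.1 z' hz').1
    exact ((h _ (hR i)).2.2.2.1 z hz).2 ((hRs i (hR i)).2 _ h1 heq)
  have hfib0 : ∀ j, ∀ z ∈ annulus c (R j), fiber (hatMk D (z : OnePoint ℂ)) ⊆ (Q ∪ C)ᶜ :=
    fun j z hz => hR0.2 _ (hBanti (Nat.zero_le j) ((h _ (hR j)).2.2.2.1 z hz).1)
  have hnew : ∀ j, ∀ z ∈ annulus c (R j), hatMk D (z : OnePoint ℂ) ≠ hatMk D w₀ := by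
    intro j z hz heq
    have h1 : (z : OnePoint ℂ) ∈ fiber (hatMk D w₀) := heq
    rw [hw, mem_singleton_iff] at h1
    exact ((h _ (hR j)).2.2.2.1 z hz).2 (h1 ▸ (h _ (hR j)).2.1)
  refine ⟨c, R, hR, ?_, fun j z hz => ⟨fun heq => ?_, hnew j z hz⟩, ?_⟩
  · intro i j hij z hz z' hz' heq
    rcases lt_or_gt_of_ne hij with hl | hl
    · exact hlt i j hl z hz z' hz' heq
    · exact hlt j i hl z' hz' z hz heq.symm
  · by_cases hwi : w₀ = OnePoint.infty
    · exact hnew j z hz (hwi ▸ heq)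
    · exact hfib0 j z hz heq.symm (Or.inr (hinf hwi))
  · intro j s hs T hT hwT hTQ
    refine (h _ (hR j)).2.2.2.2 s hs T hT ⟨w₀, hwT, (h _ (hR j)).2.1⟩ ?_
    obtain ⟨x, hxT, hxQ⟩ := hTQ
    exact ⟨x, hxT, fun hxB => hR0.2 x (hBanti (Nat.zero_le j) hxB) (mem_fiber_hatMk x) (Or.inl hxQ)⟩

/-! ### The radial size of complementary components -/

/-- The length of the set of radii in `[R, 2 R]` of the circles around `c` met by `p`. -/
def radial (c : ℂ) (R : ℝ) (p : Set (OnePoint ℂ)) : ℝ≥0∞ :=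
  volume ((fun z : ℂ => ‖z - c‖) '' ((fun z : ℂ => (z : OnePoint ℂ)) ⁻¹' p) ∩ Icc R (2 * R))

theorem exists_mem_annulus_of_radial_ne_zero {c : ℂ} {R : ℝ} {p : Set (OnePoint ℂ)}
    (h : radial c R p ≠ 0) : ∃ z ∈ annulus c R, (z : OnePoint ℂ) ∈ p := by
  obtain ⟨-, ⟨z, hz, rfl⟩, hs⟩ := nonempty_of_measure_ne_zero h
  exact ⟨z, hs, hz⟩

theorem radial_le (c : ℂ) (R : ℝ) (p : Set (OnePoint ℂ)) : radial c R p ≤ ENNReal.ofReal R := by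
  refine (measure_mono inter_subset_right).trans ?_
  rw [Real.volume_Icc]
  exact ENNReal.ofReal_le_ofReal (by linarith)

theorem radial_closedBall_le (c a : ℂ) (R r : ℝ) :
    radial c R ((fun z : ℂ => (z : OnePoint ℂ)) '' Metric.closedBall a r) ≤
      ENNReal.ofReal (2 * r) := by
  have : (fun z : ℂ => ‖z - c‖) '' ((fun z : ℂ => (z : OnePoint ℂ)) ⁻¹'
      ((fun z : ℂ => (z : OnePoint ℂ)) '' Metric.closedBall a r)) ⊆
      Icc (‖a - c‖ - r) (‖a - c‖ + r) := by
    rw [preimage_image_eq _ OnePoint.coe_injective]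
    rintro - ⟨z, hz, rfl⟩
    rw [mem_closedBall_iff_norm] at hz
    have h1 := abs_norm_sub_norm_le (z - c) (a - c)
    rw [sub_sub_sub_cancel_right] at h1
    have h2 := abs_le.1 (h1.trans hz)
    constructor <;> linarith [h2.1, h2.2]
  refine (measure_mono (inter_subset_left.trans this)).trans ?_
  rw [Real.volume_Icc]
  exact ENNReal.ofReal_le_ofReal (by linarith)

theorem exists_closedBall_subset {a z : ℂ} {r r' : ℝ} (hr' : 0 ≤ r') (hr : r' ≤ r)
    (hz : z ∈ Metric.closedBall a r) (hr0 : 0 < r) :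
    ∃ b, z ∈ Metric.closedBall b r' ∧ Metric.closedBall b r' ⊆ Metric.closedBall a r := by
  rw [mem_closedBall_iff_norm'] at hz
  have hq : 0 ≤ r' / r := by positivity
  have hq1 : r' / r ≤ 1 := (div_le_one hr0).2 hr
  refine ⟨z + (r' / r : ℝ) * (a - z), ?_, ?_⟩
  · rw [mem_closedBall_iff_norm', add_sub_cancel_left, norm_mul, Complex.norm_real,
      Real.norm_of_nonneg hq]
    calc r' / r * ‖a - z‖ ≤ r' / r * r := by gcongr
      _ = r' := div_mul_cancel₀ _ hr0.ne'
  · refine Metric.closedBall_subset_closedBall' ?_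
    rw [dist_eq_norm]
    have e : z + (r' / r : ℝ) * (a - z) - a = ((1 - r' / r : ℝ) : ℂ) * (z - a) := by
      push_cast; ring
    rw [e, norm_mul, Complex.norm_real, Real.norm_of_nonneg (by linarith), norm_sub_rev z a]
    have : (1 - r' / r) * ‖a - z‖ ≤ (1 - r' / r) * r := by
      gcongr
    have e2 : (1 - r' / r) * r = r - r' := by field_simp
    linarith

/-- Fatness of disks: the squared radial size is bounded by the area of a part of the component near
the annulus. This is the only place where the estimate uses that the components are disks. -/
theorem exists_radial_sq_le (hD : IsCircleDomain D) {c : ℂ} {R : ℝ} (hR : 0 < R)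
    (hinf : ∀ z ∈ annulus c R, hatMk D (z : OnePoint ℂ) ≠ hatMk D OnePoint.infty)
    {q : Hat D} (hq : q ∈ hatComponents D) :
    ∃ S : Set ℂ, MeasurableSet S ∧ (∀ z ∈ S, hatMk D (z : OnePoint ℂ) = q) ∧
      S ⊆ Metric.closedBall c (3 * R) ∧
      NNReal.pi * radial c R (fiber q) ^ 2 ≤ 4 * volume S := by
  rcases eq_or_ne (radial c R (fiber q)) 0 with h0 | h0
  · exact ⟨∅, MeasurableSet.empty, by simp, empty_subset _, by simp [h0]⟩
  obtain ⟨z, hz, hzq⟩ := exists_mem_annulus_of_radial_ne_zero h0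
  have hzq' : hatMk D (z : OnePoint ℂ) = q := hzq
  have hqi : OnePoint.infty ∉ fiber q := fun hi => hinf z hz (hzq'.trans (Eq.symm hi))
  have hcomp : fiber q ∈ complComponents D := by
    obtain ⟨v, hv, rfl⟩ := hq
    exact fiber_mem_complComponents hv
  have hpos : 0 < planeDiam (fiber q) := by
    rw [pos_iff_ne_zero]
    intro hd
    have := (Metric.ediam_eq_zero_iff.1 hd).image fun z : ℂ => ‖z - c‖
    exact h0 ((this.anti inter_subset_left).measure_zero _)
  rcases hD.2 _ ⟨hcomp, hpos⟩ with ⟨a, r, hr, hp⟩ | ⟨u, s, -, hp⟩ | ⟨a, r, -, hp⟩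
  · have hza : z ∈ Metric.closedBall a r := by
      rw [hp] at hzq
      obtain ⟨w, hw, h⟩ := hzq
      rwa [OnePoint.coe_injective h] at hw
    -- A large disk is replaced by a disk of radius `R / 2` inside it that meets the annulus. Its
    -- diameter `R` still bounds the radial size, and it stays in the disk of radius `2 R + R`.
    set r' := min r (R / 2)
    have hr' : 0 < r' := lt_min hr (by linarith)
    obtain ⟨b, hzb, hb⟩ := exists_closedBall_subset hr'.le (min_le_left r (R / 2)) hza hr
    refine ⟨Metric.closedBall b r', measurableSet_closedBall, fun w hw => ?_, fun w hw => ?_, ?_⟩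
    · have : (w : OnePoint ℂ) ∈ fiber q := by rw [hp]; exact ⟨w, hb hw, rfl⟩
      exact this
    · rw [mem_closedBall_iff_norm] at hw hzb ⊢
      have h1 : r' ≤ R / 2 := min_le_right _ _
      have h2 := hz.2
      have h3 : ‖w - c‖ ≤ ‖w - b‖ + ‖z - b‖ + ‖z - c‖ := by
        calc ‖w - c‖ = ‖(w - b) - (z - b) + (z - c)‖ := by congr 1; ring
          _ ≤ _ := (norm_add_le _ _).trans (add_le_add_left (norm_sub_le _ _) _)
      linarith
    · have h1 : radial c R (fiber q) ≤ ENNReal.ofReal (2 * r') := by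
        rcases min_choice r (R / 2) with h | h
        · simp only [r', h]
          rw [hp]; exact radial_closedBall_le c a R r
        · refine (radial_le c R _).trans (ENNReal.ofReal_le_ofReal ?_)
          simp only [r', h]; linarith
      rw [Complex.volume_closedBall]
      calc NNReal.pi * radial c R (fiber q) ^ 2 ≤ NNReal.pi * ENNReal.ofReal (2 * r') ^ 2 := by gcongr
        _ = 4 * (ENNReal.ofReal r' ^ 2 * NNReal.pi) := by
          rw [ENNReal.ofReal_mul (by norm_num), ENNReal.ofReal_ofNat]; ring
  · exact absurd (hp ▸ mem_insert _ _) hqi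
  · refine absurd ?_ hqi
    rw [hp]
    rintro ⟨w, -, h⟩
    exact OnePoint.coe_ne_infty w h

/-- The areas in `exists_radial_sq_le` belong to disjoint sets inside a disk of radius `3 R`; the
constant is `4 * 3 ^ 2`. -/
theorem tsum_radial_sq_le (hD : IsCircleDomain D) {c : ℂ} {R : ℝ} (hR : 0 < R)
    (hinf : ∀ z ∈ annulus c R, hatMk D (z : OnePoint ℂ) ≠ hatMk D OnePoint.infty) :
    ∑' q : {q : Hat D // q ∈ hatComponents D}, radial c R (fiber q.1) ^ 2 ≤
      ENNReal.ofReal R ^ 2 * 36 := by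
  choose S hS1 hS2 hS3 hS4 using fun q : {q : Hat D // q ∈ hatComponents D} =>
    exists_radial_sq_le hD hR hinf q.2
  have hdisj : Pairwise (Function.onFun Disjoint S) := by
    intro q q' hne
    rw [Function.onFun, Set.disjoint_left]
    exact fun z h1 h2 => hne (Subtype.ext ((hS2 q z h1).symm.trans (hS2 q' z h2)))
  have h0 : (NNReal.pi : ℝ≥0∞) ≠ 0 := by exact_mod_cast NNReal.pi_pos.ne'
  refine (ENNReal.mul_le_mul_iff_right h0 ENNReal.coe_ne_top).1 ?_
  calc NNReal.pi * ∑' q : {q : Hat D // q ∈ hatComponents D}, radial c R (fiber q.1) ^ 2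
      = ∑' q : {q : Hat D // q ∈ hatComponents D}, NNReal.pi * radial c R (fiber q.1) ^ 2 :=
        ENNReal.tsum_mul_left.symm
    _ ≤ ∑' q, 4 * volume (S q) := ENNReal.tsum_le_tsum hS4
    _ = 4 * ∑' q, volume (S q) := ENNReal.tsum_mul_left
    _ ≤ 4 * volume (Metric.closedBall c (3 * R)) := by
        gcongr
        exact (tsum_meas_le_meas_iUnion_of_disjoint _ hS1 hdisj).trans
          (measure_mono (iUnion_subset hS3))
    _ = NNReal.pi * (ENNReal.ofReal R ^ 2 * 36) := by
        rw [Complex.volume_closedBall, ENNReal.ofReal_mul (by norm_num), ENNReal.ofReal_ofNat]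
        ring

end

section

open MeasureTheory

/-! ### Pulling back densities by holomorphic maps -/

/-- The pull-back of the conformal density `σ` by `h`, on the set `E`. -/
def pullDensity (h : ℂ → ℂ) (E : Set ℂ) (σ : ℂ → ℝ≥0∞) : ℂ → ℝ≥0∞ :=
  E.indicator fun z => ‖deriv h z‖ₑ * σ (h z)

variable {h : ℂ → ℂ} {E : Set ℂ}

theorem measurable_pullDensity (hE : IsOpen E) (hh : DifferentiableOn ℂ h E) {σ : ℂ → ℝ≥0∞}
    (hσ : Measurable σ) : Measurable (pullDensity h E σ) := by
  classical
  -- `h` is controlled only on `E`, so it is replaced by `0` elsewhere before composing with `σ`.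
  have h1 : Measurable (E.piecewise h 0) :=
    hh.continuousOn.measurable_piecewise continuousOn_const hE.measurableSet
  have h2 : pullDensity h E σ = E.indicator fun z => ‖deriv h z‖ₑ * σ (E.piecewise h 0 z) := by
    refine indicator_congr fun z hz => ?_
    rw [piecewise_eq_of_mem _ _ _ hz]
  rw [h2]
  exact ((measurable_deriv h).enorm.mul (hσ.comp h1)).indicator hE.measurableSet

theorem abs_det_restrictScalars_toSpanSingleton (d : ℂ) :
    |((ContinuousLinearMap.toSpanSingleton ℂ d).restrictScalars ℝ).det| = ‖d‖ ^ 2 := by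
  have h1 := LinearMap.det_restrictScalars (R := ℝ) (S := ℂ)
    (f := (ContinuousLinearMap.toSpanSingleton ℂ d : ℂ →ₗ[ℂ] ℂ))
  have h2 : (((ContinuousLinearMap.toSpanSingleton ℂ d).restrictScalars ℝ : ℂ →L[ℝ] ℂ) :
      ℂ →ₗ[ℝ] ℂ) = (ContinuousLinearMap.toSpanSingleton ℂ d : ℂ →ₗ[ℂ] ℂ).restrictScalars ℝ := rfl
  rw [ContinuousLinearMap.det, h2, h1, LinearMap.det_ring, Algebra.norm_complex_apply]
  simp [Complex.normSq_eq_norm_sq]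

/-- The area integral of the square of a density is conformally invariant. -/
theorem lintegral_pullDensity_sq_le (hE : IsOpen E) (hh : DifferentiableOn ℂ h E)
    (hi : InjOn h E) (σ : ℂ → ℝ≥0∞) :
    ∫⁻ z, pullDensity h E σ z ^ 2 ≤ ∫⁻ v, σ v ^ 2 := by
  have hd : ∀ z ∈ E, HasFDerivWithinAt h
      ((ContinuousLinearMap.toSpanSingleton ℂ (deriv h z)).restrictScalars ℝ) E z := fun z hz =>
    ((hh.differentiableAt (hE.mem_nhds hz)).hasDerivAt.hasFDerivAt.restrictScalars
      ℝ).hasFDerivWithinAt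
  calc ∫⁻ z, pullDensity h E σ z ^ 2
      = ∫⁻ z, E.indicator (fun z => ENNReal.ofReal
          |((ContinuousLinearMap.toSpanSingleton ℂ (deriv h z)).restrictScalars ℝ).det| *
            σ (h z) ^ 2) z := by
        refine lintegral_congr fun z => ?_
        by_cases hz : z ∈ E
        · rw [pullDensity, indicator_of_mem hz, indicator_of_mem hz, mul_pow,
            abs_det_restrictScalars_toSpanSingleton, ENNReal.ofReal_pow (norm_nonneg _),
            ofReal_norm]
        · rw [pullDensity, indicator_of_notMem hz, indicator_of_notMem hz]
          simp
    _ = ∫⁻ v in h '' E, σ v ^ 2 := by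
        rw [lintegral_indicator hE.measurableSet,
          lintegral_image_eq_lintegral_abs_det_fderiv_mul volume hE.measurableSet hd hi
            fun v => σ v ^ 2]
    _ ≤ _ := setLIntegral_le_lintegral _ _

/-- The angles in `A` at which `h` maps the circle of radius `exp (-t)` into `S`. -/
def arcPart (h : ℂ → ℂ) (E : Set ℂ) (A : Set ℝ) (t : ℝ) (S : Set ℂ) : Set ℝ :=
  A ∩ pol t ⁻¹' (E ∩ h ⁻¹' S)

theorem continuous_pol_right (t : ℝ) : Continuous (pol t) :=
  continuous_pol.comp (continuous_const.prodMk continuous_id)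

theorem hasDerivAt_pol (t φ : ℝ) : HasDerivAt (pol t) (pol t φ * Complex.I) φ := by
  have h1 : HasDerivAt (fun x : ℝ => (x : ℂ) * Complex.I) (1 * Complex.I) φ :=
    (Complex.ofRealCLM.hasDerivAt (x := φ)).mul_const Complex.I
  have h2 := (h1.cexp).const_mul (Real.exp (-t) : ℂ)
  rw [one_mul, ← mul_assoc] at h2
  exact h2

theorem measurableSet_arcPart (hE : IsOpen E) (hh : ContinuousOn h E) {A : Set ℝ}
    (hA : MeasurableSet A) (t : ℝ) {S : Set ℂ} (hS : IsClosed S) :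
    MeasurableSet (arcPart h E A t S) := by
  refine hA.inter ((continuous_pol_right t).measurable ?_)
  have : E ∩ h ⁻¹' S = E \ (E ∩ h ⁻¹' Sᶜ) := by
    ext z
    simp only [mem_inter_iff, mem_preimage, mem_sdiff, mem_compl_iff]
    tauto
  rw [this]
  exact hE.measurableSet.diff (hh.isOpen_inter_preimage hE hS.isOpen_compl).measurableSet

theorem exists_hasDerivAt_norm {γ : ℝ → ℂ} {γ' : ℂ} {x : ℝ} (hγ : HasDerivAt γ γ' x)
    (h0 : γ x ≠ 0) : ∃ d, HasDerivAt (fun y => ‖γ y‖) d x ∧ |d| ≤ ‖γ'‖ := by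
  have hn : DifferentiableAt ℝ (fun v : ℂ => ‖v‖) (γ x) := differentiableAt_id.norm ℝ h0
  refine ⟨_, hn.hasFDerivAt.comp_hasDerivAt x hγ, ?_⟩
  have := (fderiv ℝ (fun v : ℂ => ‖v‖) (γ x)).le_opNorm γ'
  rwa [norm_fderiv_norm hn, one_mul, Real.norm_eq_abs] at this

theorem isClosed_annulus (c : ℂ) (R : ℝ) : IsClosed (annulus c R) :=
  isClosed_Icc.preimage (by fun_prop : Continuous fun z : ℂ => ‖z - c‖)

/-- The distances to the centre of an annulus attained on the image of an arc are controlled by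
the length of the image. -/
theorem volume_image_arcPart_le (hE : IsOpen E) (hh : DifferentiableOn ℂ h E) {A : Set ℝ}
    (hA : MeasurableSet A) (t : ℝ) (c : ℂ) {R : ℝ} (hR : 0 < R) :
    volume ((fun φ => ‖h (pol t φ) - c‖) '' arcPart h E A t (annulus c R)) ≤
      ∫⁻ φ in arcPart h E A t (annulus c R),
        ‖deriv h (pol t φ)‖ₑ * ENNReal.ofReal (Real.exp (-t)) := by
  have hS := measurableSet_arcPart hE hh.continuousOn hA t (isClosed_annulus c R)
  have key : ∀ φ ∈ arcPart h E A t (annulus c R), ∃ d,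
      HasDerivAt (fun φ => ‖h (pol t φ) - c‖) d φ ∧
        |d| ≤ ‖deriv h (pol t φ) * (pol t φ * Complex.I)‖ := by
    rintro φ ⟨-, hφE, hφ⟩
    refine exists_hasDerivAt_norm (γ := fun φ => h (pol t φ) - c) ?_ ?_
    · exact (((hh.differentiableAt (hE.mem_nhds hφE)).hasDerivAt.comp_of_eq φ
        (hasDerivAt_pol t φ) rfl).sub_const c)
    -- The image avoids the centre of the annulus, so the distance to the centre is differentiable
    -- there.
    · have : R ≤ ‖h (pol t φ) - c‖ := hφ.1
      rw [← norm_pos_iff]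
      linarith
  refine (addHaar_image_le_lintegral_abs_det_fderiv volume hS (f' := fun φ =>
    ContinuousLinearMap.toSpanSingleton ℝ (deriv (fun φ => ‖h (pol t φ) - c‖) φ))
    fun φ hφ => ?_).trans (setLIntegral_mono' hS fun φ hφ => ?_)
  · obtain ⟨d, hd, -⟩ := key φ hφ
    exact hd.differentiableAt.hasDerivAt.hasFDerivAt.hasFDerivWithinAt
  · obtain ⟨d, hd, hle⟩ := key φ hφ
    rw [ContinuousLinearMap.det_toSpanSingleton, hd.deriv]
    rw [norm_mul, norm_mul, norm_pol, Complex.norm_I, mul_one] at hle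
    rw [← ofReal_norm, ← ENNReal.ofReal_mul (norm_nonneg _)]
    exact ENNReal.ofReal_le_ofReal hle

/-! ### Sums over disjoint annuli -/

/-- At most one term is non-zero, so there are no cross terms. This turns `N` contributions of size
`1 / N ^ 2` into a total energy of order `1 / N`. -/
theorem sq_sum_eq {s : Finset ℕ} {a : ℕ → ℝ≥0∞}
    (ha : ∀ i ∈ s, ∀ j ∈ s, i ≠ j → a i = 0 ∨ a j = 0) :
    (∑ j ∈ s, a j) ^ 2 = ∑ j ∈ s, a j ^ 2 := by
  by_cases h0 : ∃ i ∈ s, a i ≠ 0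
  · obtain ⟨i, hi, hai⟩ := h0
    have hz : ∀ j ∈ s, j ≠ i → a j = 0 := fun j hj hne =>
      (ha i hi j hj hne.symm).resolve_left hai
    rw [Finset.sum_eq_single i hz fun h => absurd hi h,
      Finset.sum_eq_single i (fun j hj hne => by rw [hz j hj hne, zero_pow two_ne_zero])
        fun h => absurd hi h]
  · push Not at h0
    rw [Finset.sum_eq_zero h0, zero_pow two_ne_zero,
      Finset.sum_eq_zero fun j hj => by rw [h0 j hj, zero_pow two_ne_zero]]

/-- The density `1 / (N R)` on each of `N` annuli. -/
def annuliDensity (c : ℂ) (R : ℕ → ℝ) (N : ℕ) (v : ℂ) : ℝ≥0∞ :=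
  ∑ j ∈ Finset.range N, (annulus c (R j)).indicator (fun _ => (N * ENNReal.ofReal (R j))⁻¹) v

theorem measurable_annuliDensity (c : ℂ) (R : ℕ → ℝ) (N : ℕ) :
    Measurable (annuliDensity c R N) :=
  Finset.measurable_fun_sum _ fun j _ =>
    measurable_const.indicator (isClosed_annulus c (R j)).measurableSet

theorem inv_mul_sq {N : ℕ} (hN : N ≠ 0) {r : ℝ} (hr : 0 < r) (C : ℝ≥0∞) :
    (N * ENNReal.ofReal r)⁻¹ ^ 2 * (ENNReal.ofReal r ^ 2 * C) = (N : ℝ≥0∞)⁻¹ ^ 2 * C := by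
  have h0 : ENNReal.ofReal r ≠ 0 := by simpa using hr
  have h1 : (N : ℝ≥0∞) ≠ 0 := by exact_mod_cast hN
  rw [ENNReal.mul_inv (Or.inl h1) (Or.inl (ENNReal.natCast_ne_top N)), mul_pow, mul_assoc,
    ← mul_assoc (_ ^ 2) (_ ^ 2) C, ← mul_pow, ENNReal.inv_mul_cancel h0 ENNReal.ofReal_ne_top,
    one_pow, one_mul]

theorem sum_inv_sq {N : ℕ} (hN : N ≠ 0) (C : ℝ≥0∞) :
    ∑ _j ∈ Finset.range N, (N : ℝ≥0∞)⁻¹ ^ 2 * C = C / N := by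
  have h1 : (N : ℝ≥0∞) ≠ 0 := by exact_mod_cast hN
  rw [Finset.sum_const, Finset.card_range, nsmul_eq_mul, sq, mul_assoc, ← mul_assoc,
    ENNReal.mul_inv_cancel h1 (ENNReal.natCast_ne_top N), one_mul, mul_comm, div_eq_mul_inv]

theorem volume_annulus_le (c : ℂ) (R : ℝ) :
    volume (annulus c R) ≤ ENNReal.ofReal R ^ 2 * 16 := by
  have hsub : annulus c R ⊆ Metric.closedBall c (2 * R) := fun z hz =>
    mem_closedBall_iff_norm.2 hz.2
  refine (measure_mono hsub).trans ?_
  rw [Complex.volume_closedBall, ENNReal.ofReal_mul (by norm_num), ENNReal.ofReal_ofNat, mul_pow]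
  have hpi : (NNReal.pi : ℝ≥0∞) ≤ 4 := by exact_mod_cast Real.pi_le_four
  calc 2 ^ 2 * ENNReal.ofReal R ^ 2 * (NNReal.pi : ℝ≥0∞) ≤ 2 ^ 2 * ENNReal.ofReal R ^ 2 * 4 := by
        gcongr
    _ = _ := by ring

/-- The density has height `1 / (N R)` and an annulus has area at most `16 R ^ 2`, so each of the
`N` disjoint annuli contributes `16 / N ^ 2`. -/
theorem lintegral_annuliDensity_sq_le {c : ℂ} {R : ℕ → ℝ} {N : ℕ} (hN : N ≠ 0)
    (hR : ∀ j, 0 < R j) (hd : ∀ i j, i ≠ j → Disjoint (annulus c (R i)) (annulus c (R j))) :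
    ∫⁻ v, annuliDensity c R N v ^ 2 ≤ 16 / N := by
  have h1 : ∀ v, annuliDensity c R N v ^ 2 = ∑ j ∈ Finset.range N,
      (annulus c (R j)).indicator (fun _ => (N * ENNReal.ofReal (R j))⁻¹ ^ 2) v := by
    intro v
    rw [annuliDensity, sq_sum_eq]
    · refine Finset.sum_congr rfl fun j _ => ?_
      by_cases hv : v ∈ annulus c (R j)
      · rw [indicator_of_mem hv, indicator_of_mem hv]
      · rw [indicator_of_notMem hv, indicator_of_notMem hv, zero_pow two_ne_zero]
    · intro i _ j _ hij
      by_cases hv : v ∈ annulus c (R i)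
      · exact Or.inr (indicator_of_notMem ((Set.disjoint_left.1 (hd i j hij)) hv) _)
      · exact Or.inl (indicator_of_notMem hv _)
  simp only [h1]
  rw [lintegral_finsetSum _ fun j _ =>
    measurable_const.indicator (isClosed_annulus c (R j)).measurableSet, ← sum_inv_sq hN]
  refine Finset.sum_le_sum fun j _ => ?_
  rw [lintegral_indicator (isClosed_annulus c (R j)).measurableSet, setLIntegral_const,
    ← inv_mul_sq hN (hR j)]
  gcongr
  exact volume_annulus_le c (R j)

/-- The total weight of a set in `N` annuli. -/
def annuliWeight (c : ℂ) (R : ℕ → ℝ) (N : ℕ) (p : Set (OnePoint ℂ)) : ℝ≥0∞ :=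
  ∑ j ∈ Finset.range N, (N * ENNReal.ofReal (R j))⁻¹ * radial c (R j) p

/-- No component meets two annuli, so the squared weight is a sum of squares and `tsum_radial_sq_le`
applies annulus by annulus. -/
theorem tsum_annuliWeight_sq_le {D : Set (OnePoint ℂ)} (hD : IsCircleDomain D) {c : ℂ}
    {R : ℕ → ℝ} {N : ℕ} (hN : N ≠ 0) (hR : ∀ j, 0 < R j)
    (hd : ∀ i j, i ≠ j → ∀ z ∈ annulus c (R i), ∀ z' ∈ annulus c (R j),
      hatMk D (z : OnePoint ℂ) ≠ hatMk D (z' : OnePoint ℂ))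
    (hinf : ∀ j, ∀ z ∈ annulus c (R j), hatMk D (z : OnePoint ℂ) ≠ hatMk D OnePoint.infty) :
    ∑' q : {q : Hat D // q ∈ hatComponents D}, annuliWeight c R N (fiber q.1) ^ 2 ≤ 36 / N := by
  have h1 : ∀ q : Hat D, annuliWeight c R N (fiber q) ^ 2 = ∑ j ∈ Finset.range N,
      (N * ENNReal.ofReal (R j))⁻¹ ^ 2 * radial c (R j) (fiber q) ^ 2 := by
    intro q
    rw [annuliWeight, sq_sum_eq]
    · exact Finset.sum_congr rfl fun j _ => mul_pow _ _ _
    · intro i _ j _ hij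
      by_contra! hne
      obtain ⟨z, hz, hzq⟩ := exists_mem_annulus_of_radial_ne_zero (right_ne_zero_of_mul hne.1)
      obtain ⟨z', hz', hzq'⟩ := exists_mem_annulus_of_radial_ne_zero (right_ne_zero_of_mul hne.2)
      exact hd i j hij z hz z' hz' (Eq.trans hzq (Eq.symm hzq'))
  simp only [h1]
  rw [Summable.tsum_finsetSum fun _ _ => ENNReal.summable, ← sum_inv_sq hN]
  refine Finset.sum_le_sum fun j _ => ?_
  rw [ENNReal.tsum_mul_left, ← inv_mul_sq hN (hR j)]
  gcongr
  exact tsum_radial_sq_le hD (hR j) (hinf j)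

end

section

open MeasureTheory

/-! ### Circle domains conformally equivalent to the tripod domain -/

variable {D : Set (OnePoint ℂ)} {f : OnePoint ℂ → OnePoint ℂ}

/-- The finite points of `G` with finite image. -/
def finitePart (f : OnePoint ℂ → OnePoint ℂ) (G : Set (OnePoint ℂ)) : Set ℂ :=
  {z | (z : OnePoint ℂ) ∈ G ∧ f z ≠ OnePoint.infty}

/-- The map `f` in the plane coordinates. -/
def planeMap (f : OnePoint ℂ → OnePoint ℂ) (z : ℂ) : ℂ := toC (f z)

theorem isOpen_finitePart {G : Set (OnePoint ℂ)} (hG : IsOpen G)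
    (hf : ∀ z ∈ G, HolomorphicAtPoint f z) : IsOpen (finitePart f G) := by
  rw [isOpen_iff_mem_nhds]
  rintro z ⟨hz, hfz⟩
  have hc : ContinuousAt (fun w : ℂ => f w) z :=
    (hf z hz).1.comp OnePoint.continuous_coe.continuousAt
  filter_upwards [OnePoint.continuous_coe.continuousAt.eventually (hG.mem_nhds hz),
    hc.eventually (isOpen_ne.mem_nhds hfz)] with w h1 h2
  exact ⟨h1, h2⟩

theorem differentiableOn_planeMap {G : Set (OnePoint ℂ)}
    (hf : ∀ z ∈ G, HolomorphicAtPoint f z) :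
    DifferentiableOn ℂ (planeMap f) (finitePart f G) := fun z hz =>
  ((hf z hz.1).differentiableAt_toC hz.2).differentiableWithinAt

theorem injOn_planeMap {G : Set (OnePoint ℂ)} (hf : InjOn f G) :
    InjOn (planeMap f) (finitePart f G) := by
  intro z hz w hw h
  refine OnePoint.coe_injective (hf hz.1 hw.1 ?_)
  rw [← coe_toC hz.2, ← coe_toC hw.2]
  exact congrArg _ h

theorem map_mem_hatComponents {G : Set (OnePoint ℂ)} (hf : SurjOn f G D) {F : Hat G ≃ₜ Hat D}
    (hF : IsHatExtension f F) {q : Hat G} (hq : q ∈ hatComponents G) : F q ∈ hatComponents D := by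
  obtain ⟨v, hv⟩ := hatMk_surjective (F q)
  refine ⟨v, fun hvD => ?_, hv⟩
  obtain ⟨z, hz, rfl⟩ := hf hvD
  rw [← hF z hz] at hv
  exact hatMk_notMem_hatComponents hz (F.injective hv ▸ hq)

theorem fiber_mem_of_mem_hatComponents {G : Set (OnePoint ℂ)} {q : Hat G}
    (hq : q ∈ hatComponents G) : fiber q ∈ complComponents G := by
  obtain ⟨v, hv, rfl⟩ := hq
  exact fiber_mem_complComponents hv

/-- The plane diameter ignores `∞`, so a priori `p` could have two points; a connected set with more
than one point is infinite. -/
theorem exists_eq_singleton {p : Set (OnePoint ℂ)} (hp : IsConnected p) (h0 : planeDiam p = 0) :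
    ∃ w, p = {w} := by
  have hsub : p.Subsingleton := by
    by_contra hnt
    refine hp.isPreconnected.infinite_of_nontrivial (not_subsingleton_iff.1 hnt) ?_
    have h1 := ((Metric.ediam_eq_zero_iff.1 h0).image fun z : ℂ => (z : OnePoint ℂ)).finite
    refine (h1.insert OnePoint.infty).subset fun x hx => ?_
    induction x using OnePoint.rec with
    | infty => exact mem_insert _ _
    | coe x => exact Or.inr ⟨x, hx, rfl⟩
  obtain ⟨w, hw⟩ := hp.nonempty
  exact ⟨w, hsub.eq_singleton_of_mem hw⟩

variable {n : ℕ → ℕ} {t : ℕ → ℝ}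

/-- The image of the path of a ray meets every circle separating its end points. -/
theorem ofReal_le_ray {F : Hat Om ≃ₜ Hat D} (hD : IsOpen D) (hf : MapsTo f Om D)
    (hF : IsHatExtension f F) (h : IsRay n t) {w₀ : OnePoint ℂ} (hw : hatMk D w₀ = F origin)
    {c : ℂ} {R : ℝ}
    (hne : ∀ z ∈ annulus c R, hatMk D (z : OnePoint ℂ) ≠ hatMk D w₀)
    (hsep : ∀ s ∈ Icc R (2 * R), ∀ T, IsPreconnected T → w₀ ∈ T →
      (T ∩ fiber (F (node 1))).Nonempty → ∃ z : ℂ, ‖z - c‖ = s ∧ (z : OnePoint ℂ) ∈ T) :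
    ENNReal.ofReal R ≤
      ∑' k, volume ((fun φ => ‖planeMap f (pol (t k) φ) - c‖) '' arcPart (planeMap f)
        (finitePart f Om) (gap (n k) (n (k + 1))) (t k) (annulus c R)) +
      ∑' k, radial c R (fiber (F (node (n k)))) := by
  have := t2Space_hat hD
  have hcov : Icc R (2 * R) ⊆
      (⋃ k, (fun φ => ‖planeMap f (pol (t k) φ) - c‖) '' arcPart (planeMap f)
        (finitePart f Om) (gap (n k) (n (k + 1))) (t k) (annulus c R)) ∪
      ⋃ k, ((fun z : ℂ => ‖z - c‖) '' ((fun z : ℂ => (z : OnePoint ℂ)) ⁻¹'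
        fiber (F (node (n k)))) ∩ Icc R (2 * R)) := by
    intro s hs
    have hcont : Continuous fun x => F (rayPath h x) := F.continuous.comp (rayPath h).continuous
    have hjoin := rayPath_mem_joiningPaths h
    -- The image path, lifted to the sphere with its components filled in, is connected and joins
    -- `w₀` to the image of the first tripod. So it meets every circle of the annulus, either on an
    -- arc or in a component.
    have hT := isPreconnected_preimage_hatMk hD (isCompact_range hcont).isClosed
      (isPreconnected_range hcont)
    obtain ⟨y, hy⟩ := hatMk_surjective (F (node 1))
    obtain ⟨z, hzs, x, hx⟩ := hsep s hs _ hT ⟨1, by rw [hw]; exact congrArg F hjoin.2⟩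
      ⟨y, ⟨0, by rw [hy]; exact congrArg F hjoin.1⟩, hy⟩
    have hza : z ∈ annulus c R := by rw [annulus, mem_ofPred_eq, hzs]; exact hs
    have hx' : F (rayPathFun n t x) = hatMk D (z : OnePoint ℂ) := hx
    rcases rayPathFun_cases h x.2 with h1 | ⟨k, h1⟩ | ⟨k, h1⟩
    · rw [h1, ← hw] at hx'
      exact absurd hx'.symm (hne z hza)
    · refine Or.inr (mem_iUnion.2 ⟨k, ⟨z, ?_, hzs⟩, hs⟩)
      rw [h1] at hx'
      exact hx'.symm
    · have h2 := (mem_arcTimes_iff.1 h1).2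
      have hmem := pol_rayAngle_mem_Om h h2
      rw [← rayPath_ext h x.2, rayPath_ext_arcTimes h h1, hF _ hmem] at hx'
      have hfz : (z : OnePoint ℂ) ∈ fiber (hatMk D (f (pol (t k) (rayAngle n k (x / (1 - x)))))) :=
        hx'.symm
      rw [fiber_hatMk_of_mem (hf hmem), mem_singleton_iff] at hfz
      have hpl : planeMap f (pol (t k) (rayAngle n k (x / (1 - x)))) = z := by
        rw [planeMap, ← hfz, toC_coe]
      refine Or.inl (mem_iUnion.2 ⟨k, _, ⟨rayAngle_mem_gap h h2, ⟨hmem, ?_⟩, ?_⟩, ?_⟩)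
      · rw [← hfz]; exact OnePoint.coe_ne_infty z
      · rw [mem_preimage, hpl]; exact hza
      · simp only [hpl, hzs]
  calc ENNReal.ofReal R = volume (Icc R (2 * R)) := by rw [Real.volume_Icc]; congr 1; ring
    _ ≤ _ := (measure_mono hcov).trans ((measure_union_le _ _).trans
        (add_le_add (measure_iUnion_le _) (measure_iUnion_le _)))

/-- The length of the arcs of a ray with respect to the pulled back density of the annuli. -/
theorem sum_volume_image_le (hf : ∀ z ∈ Om, HolomorphicAtPoint f z) {c : ℂ} {R : ℕ → ℝ}
    (hR : ∀ j, 0 < R j) (hd : ∀ i j, i ≠ j → Disjoint (annulus c (R i)) (annulus c (R j)))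
    {N : ℕ} (hN : N ≠ 0) (m m' : ℕ) (t : ℝ) :
    ∑ j ∈ Finset.range N, (N * ENNReal.ofReal (R j))⁻¹ *
      volume ((fun φ => ‖planeMap f (pol t φ) - c‖) '' arcPart (planeMap f)
        (finitePart f Om) (gap m m') t (annulus c (R j))) ≤
      arcCost (pullDensity (planeMap f) (finitePart f Om) (annuliDensity c R N)) m m' t := by
  have hE := isOpen_finitePart isOpen_Om hf
  have hh := differentiableOn_planeMap hf
  have hgap : MeasurableSet (gap m m') := measurableSet_Ioo
  set S : ℕ → Set ℝ := fun j =>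
    arcPart (planeMap f) (finitePart f Om) (gap m m') t (annulus c (R j)) with hS
  have hSm : ∀ j, MeasurableSet (S j) := fun j =>
    measurableSet_arcPart hE hh.continuousOn hgap t (isClosed_annulus c (R j))
  have hNR : ∀ j, (N * ENNReal.ofReal (R j))⁻¹ ≠ ∞ := fun j => by
    rw [Ne, ENNReal.inv_eq_top, mul_eq_zero, not_or]
    exact ⟨by exact_mod_cast hN, by simpa using hR j⟩
  calc _ ≤ ∑ j ∈ Finset.range N, ∫⁻ φ in S j, pullDensity (planeMap f) (finitePart f Om)
        (annuliDensity c R N) (pol t φ) * ENNReal.ofReal (Real.exp (-t)) := by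
        refine Finset.sum_le_sum fun j hj => ?_
        refine (mul_le_mul_right (volume_image_arcPart_le hE hh hgap t c (hR j)) _).trans ?_
        rw [← lintegral_const_mul' _ _ (hNR j)]
        refine setLIntegral_mono' (hSm j) ?_
        rintro φ ⟨-, hφE, hφ⟩
        rw [pullDensity, indicator_of_mem hφE, ← mul_assoc, mul_comm _ ‖_‖ₑ]
        gcongr
        have h1 := Finset.single_le_sum (f := fun j => (annulus c (R j)).indicator
          (fun _ => (N * ENNReal.ofReal (R j))⁻¹) (planeMap f (pol t φ)))
          (fun _ _ => zero_le) hj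
        rwa [indicator_of_mem (mem_preimage.1 hφ)] at h1
    _ = ∫⁻ φ in ⋃ j ∈ Finset.range N, S j, pullDensity (planeMap f) (finitePart f Om)
        (annuliDensity c R N) (pol t φ) * ENNReal.ofReal (Real.exp (-t)) := by
        refine (lintegral_biUnion_finset ?_ (fun j _ => hSm j) _).symm
        intro i _ j _ hij
        rw [Function.onFun, Set.disjoint_left]
        exact fun φ h1 h2 => (Set.disjoint_left.1 (hd i j hij)) h1.2.2 h2.2.2
    _ ≤ _ := lintegral_mono_set (iUnion₂_subset fun j _ => inter_subset_left)

theorem planeDiam_fiber_origin_ne_zero (hD : IsCircleDomain D) (hf : IsConformalOnto f Om D)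
    {F : Hat Om ≃ₜ Hat D} (hF : IsHatExtension f F) : planeDiam (fiber (F origin)) ≠ 0 := by
  intro h0
  obtain ⟨w₀, hw₀⟩ := exists_eq_singleton (isConnected_fiber _) h0
  have hw : hatMk D w₀ = F origin := by
    have : w₀ ∈ fiber (F origin) := by rw [hw₀]; rfl
    exact this
  have hQ : w₀ ∉ fiber (F (node 1)) := fun hmem =>
    node_ne_origin le_rfl (F.injective (Eq.trans (Eq.symm hmem) hw))
  obtain ⟨c, R, hR, hd, hinf, hsep⟩ := exists_annuli hD.1.1 (by rw [hw, hw₀])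
    (isClosed_fiber hD.1.1 (F (node 1))) hQ
  have hdisj : ∀ i j, i ≠ j → Disjoint (annulus c (R i)) (annulus c (R j)) := fun i j hij =>
    Set.disjoint_left.2 fun z h1 h2 => hd i j hij z h1 z h2 rfl
  -- `N` is large enough to push both energies, `16 / N` and `36 / N`, below the threshold of
  -- `exists_cheap_ray`.
  obtain ⟨N, hN, hN36⟩ : ∃ N : ℕ, N ≠ 0 ∧ (36 : ℝ≥0∞) / N ≤ ENNReal.ofReal (1 / 4096) := by
    refine ⟨36 * 4096, by norm_num, ?_⟩
    rw [ENNReal.ofReal_div_of_pos (by norm_num), ENNReal.ofReal_one, ENNReal.ofReal_ofNat]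
    refine ENNReal.div_le_of_le_mul ?_
    rw [Nat.cast_mul, Nat.cast_ofNat, Nat.cast_ofNat, mul_comm (36 : ℝ≥0∞), ← mul_assoc,
      ENNReal.div_mul_cancel (by norm_num) (by norm_num),
      one_mul]
  have hN16 : (16 : ℝ≥0∞) / N ≤ ENNReal.ofReal (1 / 4096) :=
    (ENNReal.div_le_div_right (by norm_num) _).trans hN36
  have hE := isOpen_finitePart isOpen_Om hf.2
  have hh := differentiableOn_planeMap hf.2
  set ρ := pullDensity (planeMap f) (finitePart f Om) (annuliDensity c R N) with hρ
  set W : Hat Om → ℝ≥0∞ := fun q => annuliWeight c R N (fiber (F q)) with hW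
  have hWsum : ∑' q : {q : Hat Om // q ∈ hatComponents Om}, W q.1 ^ 2 ≤ 36 / N := by
    refine le_trans ?_ (tsum_annuliWeight_sq_le hD hN hR hd fun j z hz => (hinf j z hz).1)
    exact ENNReal.tsum_comp_le_tsum_of_injective
      (f := fun q : {q : Hat Om // q ∈ hatComponents Om} =>
        (⟨F q.1, map_mem_hatComponents hf.1.surjOn hF q.2⟩ : {q : Hat D // q ∈ hatComponents D}))
      (fun q q' hqq => Subtype.ext (F.injective (congrArg Subtype.val hqq)))
      fun q => annuliWeight c R N (fiber q.1) ^ 2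
  obtain ⟨n, t, hn0, hns, ht, hle⟩ := exists_cheap_ray
    (measurable_pullDensity hE hh (measurable_annuliDensity c R N))
    ((setLIntegral_le_lintegral _ _).trans ((lintegral_pullDensity_sq_le hE hh
      (injOn_planeMap hf.1.injOn) _).trans
      ((lintegral_annuliDensity_sq_le hN hR hdisj).trans hN16)))
    ((tsum_node_sq_le W).trans (hWsum.trans hN36))
  have h : IsRay n t := ⟨hn0, hns, ht⟩
  simp only [if_pos (h.one_le _)] at hle
  have hNt := ENNReal.natCast_ne_top N
  have hN0 : (N : ℝ≥0∞) ≠ 0 := by exact_mod_cast hN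
  -- The crossing estimate of the annulus `j`, normalised by `1 / (N R)`.
  have hj : ∀ j, (N : ℝ≥0∞)⁻¹ ≤ ∑' k, (N * ENNReal.ofReal (R j))⁻¹ *
      volume ((fun φ => ‖planeMap f (pol (t k) φ) - c‖) '' arcPart (planeMap f)
        (finitePart f Om) (gap (n k) (n (k + 1))) (t k) (annulus c (R j))) +
      ∑' k, (N * ENNReal.ofReal (R j))⁻¹ * radial c (R j) (fiber (F (node (n k)))) := by
    intro j
    have hRj : ENNReal.ofReal (R j) ≠ 0 := by simpa using hR j
    have := mul_le_mul_right (ofReal_le_ray hD.1.1 hf.1.mapsTo hF h hw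
      (fun z hz => (hinf j z hz).2) (hsep j)) (N * ENNReal.ofReal (R j))⁻¹
    rwa [mul_add, ← ENNReal.tsum_mul_left, ← ENNReal.tsum_mul_left,
      ENNReal.mul_inv (Or.inl hN0) (Or.inl hNt), mul_assoc,
      ENNReal.inv_mul_cancel hRj ENNReal.ofReal_ne_top, mul_one,
      ← ENNReal.mul_inv (Or.inl hN0) (Or.inl hNt)] at this
  have hone : (1 : ℝ≥0∞) ≤ ENNReal.ofReal (1 / 2) := by
    calc (1 : ℝ≥0∞) = ∑ _j ∈ Finset.range N, (N : ℝ≥0∞)⁻¹ := by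
          rw [Finset.sum_const, Finset.card_range, nsmul_eq_mul, ENNReal.mul_inv_cancel hN0 hNt]
      _ ≤ _ := Finset.sum_le_sum fun j _ => hj j
      _ = ∑' k, ∑ j ∈ Finset.range N, (N * ENNReal.ofReal (R j))⁻¹ *
            volume ((fun φ => ‖planeMap f (pol (t k) φ) - c‖) '' arcPart (planeMap f)
              (finitePart f Om) (gap (n k) (n (k + 1))) (t k) (annulus c (R j))) +
          ∑' k, W (node (n k)) := by
          rw [Finset.sum_add_distrib, Summable.tsum_finsetSum fun _ _ => ENNReal.summable]
          simp only [hW, annuliWeight]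
          rw [Summable.tsum_finsetSum fun _ _ => ENNReal.summable]
      _ ≤ _ := add_le_add (ENNReal.tsum_le_tsum fun k =>
          sum_volume_image_le hf.2 hR hdisj hN _ _ _) le_rfl
      _ ≤ _ := hle
  rw [ENNReal.one_le_ofReal] at hone
  norm_num at hone

theorem hatExtension_of_isCircleDomain (hD : IsCircleDomain D) (hf : IsConformalOnto f Om D) :
    (∃ F : Hat Om ≃ₜ Hat D, IsHatExtension f F) ∧
    ∀ F : Hat Om ≃ₜ Hat D, IsHatExtension f F →
      fiber (F (hatMk Om ((0 : ℂ) : OnePoint ℂ))) ∈ nonpointComponents D ∧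
      IsSphereDisk (fiber (F (hatMk Om ((0 : ℂ) : OnePoint ℂ)))) := by
  refine ⟨exists_hatExtension_of_isConformalOnto isSphereDomain_Om hD.1 hf, fun F hF => ?_⟩
  have h : fiber (F origin) ∈ nonpointComponents D :=
    ⟨fiber_mem_of_mem_hatComponents
      (map_mem_hatComponents hf.1.surjOn hF origin_mem_hatComponents),
      pos_iff_ne_zero.2 (planeDiam_fiber_origin_ne_zero hD hf hF)⟩
  exact ⟨h, hD.2 _ h⟩

end

end KoebeTripod

end

/-! ### The theorem. -/

theorem mainTheorem5 :
    ∃ Ω : Set (OnePoint ℂ),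
      KoebeTripod.IsSphereDomain Ω ∧
      (OnePoint.infty : OnePoint ℂ) ∈ Ω ∧
      (KoebeTripod.complComponents Ω).Countable ∧
      KoebeTripod.pointComponents Ω = {{((0 : ℂ) : OnePoint ℂ)}} ∧
      (∀ p ∈ KoebeTripod.nonpointComponents Ω, KoebeTripod.IsBilipschitzTripod (10 ^ 6) p) ∧
      KoebeTripod.QuasitripodCondition (10 ^ 12) Ω ∧
      (∀ N : ℕ, ¬ KoebeTripod.PackingCondition N Ω) ∧
      (∀ (D : Set (OnePoint ℂ)) (f : OnePoint ℂ → OnePoint ℂ),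
        KoebeTripod.IsCircleDomain D → KoebeTripod.IsConformalOnto f Ω D →
        (∃ F : KoebeTripod.Hat Ω ≃ₜ KoebeTripod.Hat D, KoebeTripod.IsHatExtension f F) ∧
        ∀ F : KoebeTripod.Hat Ω ≃ₜ KoebeTripod.Hat D, KoebeTripod.IsHatExtension f F →
          KoebeTripod.fiber (F (KoebeTripod.hatMk Ω ((0 : ℂ) : OnePoint ℂ))) ∈
            KoebeTripod.nonpointComponents D ∧
          KoebeTripod.IsSphereDisk
            (KoebeTripod.fiber (F (KoebeTripod.hatMk Ω ((0 : ℂ) : OnePoint ℂ))))) ∧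
      ∃ q : KoebeTripod.Hat Ω, KoebeTripod.fiber q ∈ KoebeTripod.nonpointComponents Ω ∧
        0 < KoebeTripod.transboundaryModulus
          (KoebeTripod.joiningPaths q (KoebeTripod.hatMk Ω ((0 : ℂ) : OnePoint ℂ))) :=
  ⟨KoebeTripod.Om, KoebeTripod.isSphereDomain_Om, KoebeTripod.infty_mem_Om,
    KoebeTripod.countable_complComponents_Om, KoebeTripod.pointComponents_Om,
    fun p hp => by
      rw [KoebeTripod.nonpointComponents_Om] at hp
      obtain ⟨m, hm, rfl⟩ := hp
      exact KoebeTripod.isBilipschitzTripod_tri hm,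
    KoebeTripod.quasitripodCondition_Om, KoebeTripod.not_packingCondition_Om,
    fun _ _ hD hf => KoebeTripod.hatExtension_of_isCircleDomain hD hf,
    KoebeTripod.exists_modulus_pos⟩
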